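/- Work with symmetric functions in infinitely many variables over $\mathbb{C}$: $p_n,h_n,e_n$ are the power sums, complete homogeneous and elementary symmetric functions, $s_\lambda$ the Schur functions, $\omega$ the involution with $\omega(h_n)=e_n$, $f[g]$ denotes plethysm, $F|_{\deg n}$ the degree-$n$ part of $F$, and ${\rm ch}$ the Frobenius characteristic. For $n\ge 1$ let $C_n\le S_n$ be generated by an $n$-cycle, and let ${Lie}_n$, resp. ${Lie}^{(2)}_n$, be the Frobenius characteristic of the $S_n$-module induced from the one-dimensional representation of $C_n$ in which the generator acts by $\exp(2\pi i/n)$, resp. by $\exp(2\pi i\,2^{k_n}/n)$, where $2^{k_n}$ is the largest power of $2$ dividing $n$. Put ${Lie}_{\ge2}=\sum_{n\ge2}{Lie}_n$ and ${Lie}^{(2)}_{\ge2}=\sum_{n\ge2}{Lie}^{(2)}_n$. Let $$\Delta_n^k=e_k[{Lie}^{(2)}_{\ge2}]\big|_{\deg n},\qquad D_n^k=h_k[{Lie}_{\ge2}]\big|_{\deg n},$$ $\Delta_n=\sum_{k\ge1}\Delta_n^k$ for $n\ge2$, and $\Delta_1=0$, $\Delta_0=1$. **Theorem.** 1. For all $n\ge2$,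 $$\Delta_n=\sum_{k=0}^n(-1)^k p_1^{n-k}h_k=p_1\Delta_{n-1}+(-1)^nh_n ,$$ and $\Delta_n$ is the Frobenius characteristic of the $S_n$-module afforded by the top reduced homology $\tilde H_{n-1}(\,\cdot\,;\mathbb{C})$ of the complex of injective words in the alphabet $\{1,\dots,n\}$ (the complex whose $r$-dimensional cells are the words of $r+1$ distinct letters, with faces obtained by deleting letters, and with $S_n$ permuting the letters). 2. For all $n\ge1$, $$\sum_{r\ge1}\omega(D_n^r)=\sum_{k=0}^n(-1)^kp_1^{n-k}h_k=\sum_{r\ge1}\Delta_n^r .$$ 3. For all $n\ge2$, $$\sum_{r\ge1}(-1)^{r-1}\,\omega\big(e_r[{Lie}_{\ge2}]|_{\deg n}\big)=s_{(2,1^{n-2})}=\sum_{r\ge1}(-1)^{r-1}\,h_r[{Lie}^{(2)}_{\ge2}]\big|_{\deg n}.$$ 4. The decomposition $\Delta_n=\sum_k\Delta_n^k$ differs from the Hodge decomposition $\Delta_n=\sum_k\omega(D_n^k)$ of Hanlon and Hersh: for $n=4$, neither of $\Delta_4^1,\Delta_4^2$ is equal to either of $\omega(D_4^1),\omega(D_4^2)$.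 -/

import Mathlib

noncomputable section

namespace SymFn

/-- Formal power series over `ℂ` in the variables `x_0, x_1, x_2, …`. Symmetric functions, and
infinite sums of symmetric functions of increasing degree, are elements of this ring. -/
abbrev Series : Type := MvPowerSeries ℕ ℂ

/-- The power sum `p_k = ∑ i, x_i ^ k` (for `k ≥ 1`). -/
def p (k : ℕ) : Series :=
  fun m => by classical exact if ∃ i, m = Finsupp.single i k then 1 else 0

/-- The complete homogeneous symmetric function `h_n`: the sum of all monomials of degree `n`. -/
def h (n : ℕ) : Series :=
  fun m => if m.degree = n then 1 else 0

/-- The elementary symmetric function `e_n`: the sum of all squarefree monomials of degree `n`. -/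
def e (n : ℕ) : Series :=
  fun m => by classical exact if m.degree = n ∧ ∀ i, m i ≤ 1 then 1 else 0

/-- The Schur function `s_μ`: the coefficient of a monomial `m` is the number of semistandard
Young tableaux of shape `μ` with content `m`. -/
def schur (μ : YoungDiagram) : Series :=
  fun m => (Nat.card {T : SemistandardYoungTableau μ //
    ∀ i, (μ.cells.filter fun c => T c.1 c.2 = i).card = m i} : ℂ)

/-! ### Power sums are algebraically independent -/

section AlgebraicIndependence

theorem esymm_mem_adjoin_psum (N k : ℕ) :
    MvPolynomial.esymm (Fin N) ℂ k ∈
      Algebra.adjoin ℂ (Set.range fun j : Fin N => MvPolynomial.psum (Fin N) ℂ (j + 1)) := by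
  induction k using Nat.strong_induction_on with
  | _ k ih =>
    rcases Nat.eq_zero_or_pos k with rfl | hk
    · simp [MvPolynomial.esymm_zero, one_mem]
    by_cases hkN : N < k
    · have : MvPolynomial.esymm (Fin N) ℂ k = 0 := by
        rw [MvPolynomial.esymm, Finset.powersetCard_eq_empty.2 (by simpa using hkN)]
        simp
      rw [this]
      exact zero_mem _
    · have key := MvPolynomial.mul_esymm_eq_sum (Fin N) ℂ k
      have hk0 : (k : ℂ) ≠ 0 := by exact_mod_cast hk.ne'
      have hsolve : MvPolynomial.esymm (Fin N) ℂ k =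
          (k : ℂ)⁻¹ • ((k : MvPolynomial (Fin N) ℂ) * MvPolynomial.esymm (Fin N) ℂ k) := by
        rw [← nsmul_eq_mul, ← Nat.cast_smul_eq_nsmul ℂ, smul_smul, inv_mul_cancel₀ hk0, one_smul]
      rw [hsolve, key]
      refine Subalgebra.smul_mem _ (mul_mem (pow_mem (neg_mem (one_mem _)) _) ?_) _
      refine sum_mem fun a ha => ?_
      rw [Finset.mem_filter, Finset.HasAntidiagonal.mem_antidiagonal] at ha
      refine mul_mem (mul_mem (pow_mem (neg_mem (one_mem _)) _) (ih _ ha.2)) ?_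
      refine Algebra.subset_adjoin ⟨⟨a.2 - 1, by omega⟩, ?_⟩
      have : a.2 - 1 + 1 = a.2 := by omega
      simp [this]

theorem algebraicIndependent_psum (N : ℕ) :
    AlgebraicIndependent ℂ (fun j : Fin N => MvPolynomial.psum (Fin N) ℂ (j + 1)) := by
  have halg : Algebra.IsAlgebraic
      (Algebra.adjoin ℂ (Set.range fun j : Fin N => MvPolynomial.psum (Fin N) ℂ (j + 1)))
      (MvPolynomial (Fin N) ℂ) := by
    set S := Algebra.adjoin ℂ (Set.range fun j : Fin N => MvPolynomial.psum (Fin N) ℂ (j + 1))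
      with hS
    have hX : ∀ i : Fin N, IsIntegral S (MvPolynomial.X i : MvPolynomial (Fin N) ℂ) := by
      intro i
      have hV := MvPolynomial.prod_C_add_X_eq_sum_esymm ℂ (Fin N)
      have hlift : (∏ j : Fin N, (Polynomial.X + Polynomial.C
          (MvPolynomial.X j : MvPolynomial (Fin N) ℂ))) ∈
          Polynomial.lifts (algebraMap S (MvPolynomial (Fin N) ℂ)) := by
        rw [hV]
        refine sum_mem fun j _ => mul_mem ?_ ?_
        · exact Polynomial.C_mem_lifts _ (⟨_, esymm_mem_adjoin_psum N j⟩ : S)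
        · exact pow_mem (Polynomial.X_mem_lifts _) _
      have hmonic : (∏ j : Fin N, (Polynomial.X + Polynomial.C
          (MvPolynomial.X j : MvPolynomial (Fin N) ℂ))).Monic :=
        Polynomial.monic_prod_of_monic _ _ fun j _ => Polynomial.monic_X_add_C _
      obtain ⟨q, hq, -, hqm⟩ := Polynomial.lifts_and_degree_eq_and_monic hlift hmonic
      have hneg : IsIntegral S (-(MvPolynomial.X i : MvPolynomial (Fin N) ℂ)) := by
        refine ⟨q, hqm, ?_⟩
        rw [← Polynomial.eval_map, hq, Polynomial.eval_prod]
        exact Finset.prod_eq_zero (Finset.mem_univ i) (by simp)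
      simpa using hneg.neg
    have : Algebra.IsIntegral S (MvPolynomial (Fin N) ℂ) := by
      refine ⟨fun f => ?_⟩
      induction f using MvPolynomial.induction_on with
      | C a => exact isIntegral_algebraMap (R := S) (x := algebraMap ℂ S a)
      | add f g hf hg => exact hf.add hg
      | mul_X f i hf => exact hf.mul (hX i)
    exact this.isAlgebraic
  refine (Algebra.IsAlgebraic.isTranscendenceBasis_of_lift_le_trdeg_of_finite ℂ
    (fun j : Fin N => MvPolynomial.psum (Fin N) ℂ (j + 1)) ?_).1
  simp

theorem killCompl_p (N k : ℕ) :
    MvPowerSeries.killCompl (R := ℂ) (Fin.valEmbedding (n := N)) (p (k + 1)) =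
      (MvPolynomial.psum (Fin N) ℂ (k + 1) : MvPowerSeries (Fin N) ℂ) := by
  classical
  ext m
  rw [MvPolynomial.coeff_coe, MvPolynomial.psum, MvPolynomial.coeff_sum]
  have h1 : MvPowerSeries.coeff m
      (MvPowerSeries.killCompl (R := ℂ) (Fin.valEmbedding (n := N)) (p (k + 1))) =
      if ∃ i, m.embDomain Fin.valEmbedding = Finsupp.single i (k + 1) then 1 else 0 := rfl
  rw [h1]
  simp only [MvPolynomial.coeff_X_pow]
  by_cases hm : ∃ j : Fin N, m = Finsupp.single j (k + 1)
  · obtain ⟨j, rfl⟩ := hm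
    rw [if_pos ⟨j, by simp⟩, Finset.sum_eq_single j]
    · simp
    · intro b _ hb
      rw [if_neg]
      intro hEq
      exact hb ((Finsupp.single_left_inj (by simp)).1 hEq)
    · simp
  · rw [if_neg, Finset.sum_eq_zero]
    · intro j _
      rw [if_neg]
      exact fun hEq => hm ⟨j, hEq.symm⟩
    · rintro ⟨i, hi⟩
      have hi' : i ∈ (m.embDomain Fin.valEmbedding).support := by
        rw [hi]; simp
      rw [Finsupp.support_embDomain, Finset.mem_map] at hi'
      obtain ⟨j, -, rfl⟩ := hi'
      refine hm ⟨j, ?_⟩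
      refine Finsupp.embDomain_injective Fin.valEmbedding ?_
      rw [hi, Finsupp.embDomain_single]

/-- The power sums `p_1, p_2, …` are algebraically independent. -/
theorem algebraicIndependent_p : AlgebraicIndependent ℂ (fun k : ℕ => p (k + 1)) := by
  rw [algebraicIndependent_iff]
  intro P hP
  obtain ⟨N, Q, rfl⟩ : ∃ (N : ℕ) (Q : MvPolynomial (Fin N) ℂ),
      P = MvPolynomial.rename (fun j : Fin N => (j : ℕ)) Q := by
    obtain ⟨N, hN⟩ := P.vars.exists_nat_subset_range
    obtain ⟨Q, hQ⟩ := MvPolynomial.exists_rename_eq_of_vars_subset_range P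
      (fun j : Fin N => (j : ℕ)) Fin.val_injective
      (fun i hi => ⟨⟨i, by simpa using hN hi⟩, rfl⟩)
    exact ⟨N, Q, hQ.symm⟩
  have h0 := congrArg (MvPowerSeries.killCompl (R := ℂ) (Fin.valEmbedding (n := N))) hP
  rw [MvPolynomial.aeval_rename, map_zero, MvPolynomial.comp_aeval_apply] at h0
  have hcoe : MvPolynomial.aeval (fun j : Fin N =>
      MvPowerSeries.killCompl (R := ℂ) (Fin.valEmbedding (n := N)) (p ((j : ℕ) + 1))) Q =
      MvPolynomial.coeToMvPowerSeries.algHom ℂ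
        (MvPolynomial.aeval (fun j : Fin N => MvPolynomial.psum (Fin N) ℂ (j + 1)) Q) := by
    rw [MvPolynomial.comp_aeval_apply]
    congr 2
    funext j
    rw [killCompl_p]
    simp [MvPolynomial.coeToMvPowerSeries.algHom_apply]
  have h1 : MvPolynomial.coeToMvPowerSeries.algHom ℂ
      (MvPolynomial.aeval (fun j : Fin N => MvPolynomial.psum (Fin N) ℂ (j + 1)) Q) =
      (0 : MvPowerSeries (Fin N) ℂ) := by
    rw [← hcoe]; exact h0
  have h2 : MvPolynomial.aeval (fun j : Fin N => MvPolynomial.psum (Fin N) ℂ (j + 1)) Q = 0 := by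
    apply MvPolynomial.coe_injective (Fin N) ℂ
    simpa [MvPolynomial.coeToMvPowerSeries.algHom_apply] using h1
  rw [(algebraicIndependent_iff.1 (algebraicIndependent_psum N)) Q h2, map_zero]

end AlgebraicIndependence

/-! ### Plethysm and the involution `ω` -/

/-- The expression of a symmetric function as a polynomial in the power sums; the variable of
index `k` stands for `p_{k+1}`. It is unique, since the power sums are algebraically independent
(see `toPowerSums_aeval`). -/
def toPowerSums (f : Series) : MvPolynomial ℕ ℂ :=
  Function.invFun (MvPolynomial.aeval fun k : ℕ => p (k + 1)) f

theorem toPowerSums_aeval (P : MvPolynomial ℕ ℂ) :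
    toPowerSums (MvPolynomial.aeval (fun k : ℕ => p (k + 1)) P) = P :=
  Function.leftInverse_invFun algebraicIndependent_p P

/-- The plethysm `f[g]` of a symmetric function `f` with `g`: the image of `f` under the
`ℂ`-algebra homomorphism with `p_k ↦ p_k[g] = g(x_0 ^ k, x_1 ^ k, …)`. -/
def plethysm (f g : Series) : Series :=
  MvPolynomial.aeval (fun k : ℕ => MvPowerSeries.expand (k + 1) k.succ_ne_zero g) (toPowerSums f)

/-- The involution `ω` on symmetric functions: the `ℂ`-algebra homomorphism with
`p_k ↦ (-1) ^ (k - 1) p_k`, which exchanges `h_n` and `e_n`. -/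
def omega (f : Series) : Series :=
  MvPolynomial.aeval (fun k : ℕ => (-1 : Series) ^ k * p (k + 1)) (toPowerSums f)

/-- The part of degree `n` of a series. -/
def deg (n : ℕ) (f : Series) : Series :=
  MvPowerSeries.homogeneousComponent n f

/-- The formal infinite sum `∑_{n ≥ 2} q_n`, where each `q_n` is homogeneous of degree `n`. -/
def sumGeTwo (q : ℕ → Series) : Series :=
  fun m => if 2 ≤ m.degree then MvPowerSeries.coeff m (q m.degree) else 0

/-! ### Frobenius characteristic and the modules `Lie_n` and `Lie_n^{(2)}` -/

/-- The Frobenius characteristic of a representation of the symmetric group of a finite set `α`: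
`(1 / |α|!) ∑_σ tr(ρ(σ)) p_{λ(σ)}`, where `λ(σ)` is the cycle type of `σ` (with fixed points). -/
def frobeniusChar {α V : Type} [Fintype α] [DecidableEq α] [AddCommGroup V] [Module ℂ V]
    (ρ : Representation ℂ (Equiv.Perm α) V) : Series :=
  ((Fintype.card α).factorial : ℂ)⁻¹ •
    ∑ σ : Equiv.Perm α, LinearMap.trace ℂ V (ρ σ) • (σ.partition.parts.map p).prod

/-- The one-dimensional representation of the cyclic group `C_n` on `ℂ` in which the generator
acts as multiplication by `exp (2 π i r / n)`. -/
def cyclicRep (n : ℕ) [NeZero n] (r : ℕ) : Representation ℂ (Multiplicative (ZMod n)) ℂ :=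
  (algebraMap ℂ (Module.End ℂ ℂ) : ℂ →* Module.End ℂ ℂ).comp
    ((ZMod.stdAddChar : AddChar (ZMod n) ℂ).toMonoidHom ^ r)

/-- `C_n` as the subgroup of the symmetric group of the `n`-element set `ℤ/n` generated by the
`n`-cycle `x ↦ x + 1`. -/
def cyclicEmbedding (n : ℕ) : Multiplicative (ZMod n) →* Equiv.Perm (ZMod n) :=
  MulAction.toPermHom (Multiplicative (ZMod n)) (ZMod n)

/-- The Frobenius characteristic of the induced representation
`exp ((2 π i / n) r) ↑_{C_n}^{S_n}`, for `n ≥ 1`. -/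
def cyclicIndChar : ℕ → ℕ → Series
  | 0, _ => 0
  | n + 1, r => frobeniusChar (Representation.ind (cyclicEmbedding (n + 1)) (cyclicRep (n + 1) r))

/-- The Frobenius characteristic of `Lie_n = exp (2 π i / n) ↑_{C_n}^{S_n}`. -/
def lie (n : ℕ) : Series := cyclicIndChar n 1

/-- The Frobenius characteristic of `Lie_n^{(2)} = exp ((2 π i / n) 2 ^ k) ↑_{C_n}^{S_n}`, where
`2 ^ k` is the largest power of `2` dividing `n`. -/
def lieTwo (n : ℕ) : Series := cyclicIndChar n (2 ^ padicValNat 2 n)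

/-- `D_n^k`: the degree `n` part of `h_k[Lie_{≥ 2}]`. -/
def hodgePiece (n k : ℕ) : Series := deg n (plethysm (h k) (sumGeTwo lie))

/-- `Δ_n^k`: the degree `n` part of `e_k[Lie^{(2)}_{≥ 2}]`. -/
def deltaPiece (n k : ℕ) : Series := deg n (plethysm (e k) (sumGeTwo lieTwo))

/-- `Δ_0 = 1`, `Δ_1 = 0`, and `Δ_n = ∑_{k ≥ 1} Δ_n^k` for `n ≥ 2`. -/
def delta : ℕ → Series
  | 0 => 1
  | 1 => 0
  | n + 2 => ∑ᶠ (k : ℕ) (_ : 1 ≤ k), deltaPiece (n + 2) k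

/-- The partition `(2, 1^{n-2})` of `n ≥ 2`, as a Young diagram. -/
def hookTwo (n : ℕ) : YoungDiagram :=
  YoungDiagram.ofRowLens (2 :: List.replicate (n - 2) 1) (by
    apply List.Pairwise.sortedGE
    rw [List.pairwise_cons]
    refine ⟨fun a ha => ?_, ?_⟩
    · rw [List.eq_of_mem_replicate ha]; norm_num
    · exact List.pairwise_replicate.2 (Or.inr le_rfl))

/-! ### The complex of injective words -/

section Homology

variable {G A B C : Type} [Group G] [AddCommGroup A] [Module ℂ A] [AddCommGroup B] [Module ℂ B]
  [AddCommGroup C] [Module ℂ C]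

/-- The homology `ker g / (im f ∩ ker g)` at `B` of `A → B → C`; when `g ∘ f = 0` this is
`ker g / im f`. -/
abbrev Homology (f : A →ₗ[ℂ] B) (g : B →ₗ[ℂ] C) : Type :=
  LinearMap.ker g ⧸ (LinearMap.range f).submoduleOf (LinearMap.ker g)

/-- The action of a group on the homology of `A → B → C` induced by its action on `B`, when
`A → B` and `B → C` are equivariant. -/
def homologyRep (ρA : Representation ℂ G A) (ρB : Representation ℂ G B)
    (ρC : Representation ℂ G C) (f : A →ₗ[ℂ] B) (g : B →ₗ[ℂ] C)
    (hf : ∀ s x, f (ρA s x) = ρB s (f x)) (hg : ∀ s x, g (ρB s x) = ρC s (g x)) :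
    Representation ℂ G (Homology f g) :=
  (ρB.subrepresentation (LinearMap.ker g) fun s x hx => by
    rw [LinearMap.mem_ker] at hx
    rw [Submodule.mem_comap, LinearMap.mem_ker, hg, hx, map_zero]).quotient _ fun s x hx => by
      obtain ⟨y, hy⟩ := hx
      exact ⟨ρA s y, by rw [hf, hy]; rfl⟩

end Homology

/-- The chains on injective words of length `r` in the alphabet `α` (the cells of dimension
`r - 1`; the empty word spans the augmentation), with the action of the symmetric group on
letters. -/
def wordRep (α : Type) (r : ℕ) : Representation ℂ (Equiv.Perm α) ((Fin r ↪ α) →₀ ℂ) where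
  toFun σ := Finsupp.lmapDomain ℂ ℂ fun w => w.trans σ.toEmbedding
  map_one' := by ext; simp; rfl
  map_mul' σ τ := by ext; simp; rfl

/-- The boundary map `a_0 a_1 ⋯ a_r ↦ ∑_i (-1)^i a_0 ⋯ â_i ⋯ a_r`. -/
def wordBoundary (α : Type) (r : ℕ) : ((Fin (r + 1) ↪ α) →₀ ℂ) →ₗ[ℂ] ((Fin r ↪ α) →₀ ℂ) :=
  Finsupp.linearCombination ℂ fun w =>
    ∑ i : Fin (r + 1), (-1 : ℂ) ^ (i : ℕ) •
      Finsupp.single ((Fin.succAboveEmb i).trans w) 1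

theorem wordBoundary_comm (α : Type) (r : ℕ) (σ : Equiv.Perm α) (x : (Fin (r + 1) ↪ α) →₀ ℂ) :
    wordBoundary α r (wordRep α (r + 1) σ x) = wordRep α r σ (wordBoundary α r x) := by
  have : wordBoundary α r ∘ₗ wordRep α (r + 1) σ = wordRep α r σ ∘ₗ wordBoundary α r := by
    ext1 w
    ext1
    simp [wordBoundary, wordRep, Finsupp.mapDomain_single, Function.Embedding.trans_assoc]
  exact LinearMap.congr_fun this x

/-- The representation of the symmetric group of `α` on the reduced homology
`H̃_r = ker ∂_r / im ∂_{r+1}`, with coefficients in `ℂ`, of the complex of injective words in the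
alphabet `α`. -/
def injectiveWordsHomology (α : Type) (r : ℕ) :
    Representation ℂ (Equiv.Perm α) (Homology (wordBoundary α (r + 1)) (wordBoundary α r)) :=
  homologyRep (wordRep α (r + 2)) (wordRep α (r + 1)) (wordRep α r) _ _
    (wordBoundary_comm α (r + 1)) (wordBoundary_comm α r)

end SymFn

end

noncomputable section

namespace SymFn

open Finset

/-! ### Degrees, the Euler derivation, Newton's identities -/

/-! All plethystic identities are compared through logarithmic derivatives. `IsExp q g` says that `∑
g_n t^n` starts with 1 and has logarithmic derivative `∑ q_i t^i`; over `ℂ` this determines `g`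
(`IsExp.unique`). Newton's identities put `h_n` and `e_n` in this form with `q_i = c_i p_{i+1}`,
where `c_i = 1` or `c_i = (-1)^i`, and hence also `h_k[f]` and `e_k[f]`, with `p_{i+1}[f]` in place
of `p_{i+1}`.

To sum over `k` in a fixed degree, the Euler derivation is applied: it turns the plethystic
exponential of `f` into a sequence with logarithmic derivative `∑_i c_i p_{i+1}[E f]`, sorted by
degree (`IsExp.euler`, `isExp_sum_deg`). For a sum of modules induced from cyclic groups, the degree
`n` part of `E f` is `∑_{d ∣ n} ψ(d) p_d^{n/d}`, with `ψ(d)` a Ramanujan sum (`smul_cyclicIndChar`),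
corrected for the missing `n = 1`. If `c_{k-1}` and `ψ(d)` are inverse under Dirichlet convolution,
only `p_1^m - c_{m-1} p_m` survives in degree `m` (`sum_deg_expand_cyclicSum`). For `Lie` the
inversion is that of the Möbius function; for `Lie^{(2)}` it is `sum_neg_one_pow_mul_ramanujanSum`.
So the generating functions are `E(-t)/(1 - p_1 t)` for `h[Lie_{≥2}]` and `H(-t)/(1 - p_1 t)` for
`e[Lie^{(2)}_{≥2}]`, and `ω` exchanges them. Alternating signs invert the series and give `(1 - p_1
t) H(t)` and `(1 - p_1 t) E(t)`; the coefficient `p_1 e_{n-1} - e_n` is the hook Schur function by a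
count of tableaux (`schur_hookTwo`).

For injective words, the chains on words of length `k` have characteristic `p_1^k h_{n-k}`
(`sum_trace_wordRep_smul`), so the top homology is their alternating sum once the complex is known
to be acyclic below the top. Acyclicity (`exists_listBoundary_eq`) comes from an operator `N` that
prepends new letters: `∂N + N∂` is `n - r` plus a signed move-to-front operator on words of length
`r`. That operator has no negative integer eigenvalue, so `∂N` is injective, hence bijective, on
cycles.

The degree four claim compares the coefficients of `p_1^4` and `p_4`. -/

theorem coeff_deg (n : ℕ) (f : Series) (m : ℕ →₀ ℕ) :
    MvPowerSeries.coeff m (deg n f) = if m.degree = n then MvPowerSeries.coeff m f else 0 :=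
  MvPowerSeries.coeff_homogeneousComponent n m f

open Classical in
theorem coeff_p (k : ℕ) (m : ℕ →₀ ℕ) :
    MvPowerSeries.coeff m (p (k + 1)) = if ∃ i, m = Finsupp.single i (k + 1) then 1 else 0 := by
  change p (k + 1) m = _
  simp only [p]

theorem coeff_h (n : ℕ) (m : ℕ →₀ ℕ) :
    MvPowerSeries.coeff m (h n) = if m.degree = n then 1 else 0 := rfl

open Classical in
theorem coeff_e (n : ℕ) (m : ℕ →₀ ℕ) :
    MvPowerSeries.coeff m (e n) = if m.degree = n ∧ ∀ i, m i ≤ 1 then 1 else 0 := by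
  classical
  change e n m = _
  simp only [e]

theorem deg_mul (n : ℕ) (f g : Series) :
    deg n (f * g) = ∑ ij ∈ antidiagonal n, deg ij.1 f * deg ij.2 g := by
  classical
  ext m
  rw [coeff_deg, map_sum]
  simp only [MvPowerSeries.coeff_mul, coeff_deg]
  rw [Finset.sum_comm]
  split_ifs with hm
  · refine sum_congr rfl fun ab hab => ?_
    rw [HasAntidiagonal.mem_antidiagonal] at hab
    rw [sum_eq_single (ab.1.degree, ab.2.degree)]
    · simp
    · rintro ⟨i, j⟩ _ hne
      by_cases h1 : ab.1.degree = i
      · by_cases h2 : ab.2.degree = j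
        · exact absurd (by rw [h1, h2]) hne
        · simp [h2]
      · simp [h1]
    · intro hne
      exact absurd (HasAntidiagonal.mem_antidiagonal.2 (by rw [← hm, ← hab, map_add])) hne
  · symm
    refine sum_eq_zero fun ab hab => sum_eq_zero fun ij hij => ?_
    rw [HasAntidiagonal.mem_antidiagonal] at hab hij
    by_cases h1 : ab.1.degree = ij.1
    · by_cases h2 : ab.2.degree = ij.2
      · exact absurd (by rw [← hab, map_add, h1, h2, hij]) hm
      · simp [h2]
    · simp [h1]

theorem deg_add (n : ℕ) (f g : Series) : deg n (f + g) = deg n f + deg n g := map_add _ f g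
theorem deg_smul (n : ℕ) (a : ℂ) (f : Series) : deg n (a • f) = a • deg n f := map_smul _ a f
theorem deg_zero (n : ℕ) : deg n 0 = 0 := map_zero _
theorem deg_sum {ι : Type*} (n : ℕ) (s : Finset ι) (f : ι → Series) :
    deg n (∑ i ∈ s, f i) = ∑ i ∈ s, deg n (f i) := map_sum _ f s

theorem deg_one (n : ℕ) : deg n (1 : Series) = if n = 0 then 1 else 0 := by
  classical
  ext m
  rw [coeff_deg, MvPowerSeries.coeff_one]
  by_cases hm : m = 0
  · subst hm; simp only [map_zero]; split_ifs <;> simp_all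
  · have : m.degree ≠ 0 := by rwa [Ne, Finsupp.degree_eq_zero_iff]
    split_ifs <;> simp_all [MvPowerSeries.coeff_one]

theorem deg_p (n k : ℕ) : deg n (p (k + 1)) = if n = k + 1 then p (k + 1) else 0 := by
  ext m
  rw [coeff_deg, coeff_p]
  by_cases hm : ∃ i, m = Finsupp.single i (k + 1)
  · obtain ⟨i, rfl⟩ := hm
    rw [Finsupp.degree_single]
    by_cases hk : n = k + 1
    · rw [if_pos hk.symm, if_pos ⟨i, rfl⟩, if_pos hk, coeff_p, if_pos ⟨i, rfl⟩]
    · simp [hk, Ne.symm hk]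
  · have h0 : MvPowerSeries.coeff m (p (k + 1)) = 0 := by rw [coeff_p, if_neg hm]
    rw [if_neg hm, ite_self]
    split_ifs
    · exact h0.symm
    · simp

theorem deg_prod_p (s : Multiset ℕ) (hs : ∀ i ∈ s, 0 < i) (n : ℕ) :
    deg n (s.map p).prod = if n = s.sum then (s.map p).prod else 0 := by
  induction s using Multiset.induction_on generalizing n with
  | empty => rw [Multiset.map_zero, Multiset.prod_zero, Multiset.sum_zero]; exact deg_one n
  | cons a s ih =>
    obtain ⟨k, rfl⟩ : ∃ k, a = k + 1 := ⟨a - 1, by have := hs a (by simp); omega⟩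
    rw [Multiset.map_cons, Multiset.prod_cons, deg_mul, Multiset.sum_cons]
    have ih' := ih fun i hi => hs i (by simp [hi])
    simp only [ih', deg_p]
    split_ifs with hn
    · rw [sum_eq_single (k + 1, s.sum)]
      · simp
      · rintro ⟨i, j⟩ _ hne
        by_cases h1 : i = k + 1
        · by_cases h2 : j = s.sum
          · exact absurd (by rw [h1, h2]) hne
          · simp [h2]
        · simp [h1]
      · intro h1; exact absurd (HasAntidiagonal.mem_antidiagonal.2 hn.symm) h1
    · refine sum_eq_zero fun ij hij => ?_
      rw [HasAntidiagonal.mem_antidiagonal] at hij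
      by_cases h1 : ij.1 = k + 1
      · by_cases h2 : ij.2 = s.sum
        · exact absurd (by rw [← hij, h1, h2]) hn
        · simp [h2]
      · simp [h1]

/-- The Euler derivation, multiplying the degree `n` part by `n`. -/
def euler : Series →ₗ[ℂ] Series where
  toFun f := fun m => (m.degree : ℂ) * MvPowerSeries.coeff m f
  map_add' f g := by
    ext m
    exact mul_add (m.degree : ℂ) (MvPowerSeries.coeff m f) (MvPowerSeries.coeff m g)
  map_smul' a f := by
    ext m
    change _ * _ = a * (_ * _)
    rw [MvPowerSeries.coeff_smul]; ring

theorem coeff_euler (m : ℕ →₀ ℕ) (f : Series) :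
    MvPowerSeries.coeff m (euler f) = (m.degree : ℂ) * MvPowerSeries.coeff m f := rfl

theorem euler_mul (f g : Series) : euler (f * g) = euler f * g + f * euler g := by
  classical
  ext m
  rw [coeff_euler, map_add]
  simp only [MvPowerSeries.coeff_mul, coeff_euler]
  rw [mul_sum, ← sum_add_distrib]
  refine sum_congr rfl fun ab hab => ?_
  rw [HasAntidiagonal.mem_antidiagonal] at hab
  rw [← hab, map_add, Nat.cast_add]
  ring

theorem euler_one : euler 1 = 0 := by
  have := euler_mul 1 1
  simpa using this

theorem deg_euler (n : ℕ) (f : Series) : deg n (euler f) = (n : ℂ) • deg n f := by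
  ext m
  rw [coeff_deg, MvPowerSeries.coeff_smul, coeff_deg, coeff_euler]
  split_ifs with hm
  · rw [hm]
  · simp

/-! ### The substitution of `k`-th powers for the variables. -/

theorem coeff_expand (k : ℕ) (hk : k ≠ 0) (f : Series) (m : ℕ →₀ ℕ) (hm : ¬ ∃ m', m = k • m') :
    MvPowerSeries.coeff m (MvPowerSeries.expand k hk f) = 0 := by
  by_contra hne
  refine hm ?_
  have : ∀ i, k ∣ m i := by
    intro i
    by_contra hi
    exact hne (MvPowerSeries.coeff_expand_of_not_dvd k hk f hi)
  refine ⟨m.mapRange (fun j => j / k) (by simp), ?_⟩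
  ext i
  simp [Nat.mul_div_cancel' (this i)]

theorem euler_expand (k : ℕ) (hk : k ≠ 0) (f : Series) :
    euler (MvPowerSeries.expand k hk f) = (k : ℂ) • MvPowerSeries.expand k hk (euler f) := by
  ext m
  rw [coeff_euler, MvPowerSeries.coeff_smul]
  by_cases hm : ∃ m', m = k • m'
  · obtain ⟨m', rfl⟩ := hm
    rw [MvPowerSeries.coeff_expand_smul, MvPowerSeries.coeff_expand_smul, coeff_euler, map_nsmul]
    simp [mul_assoc]
  · rw [coeff_expand _ _ _ _ hm, coeff_expand _ _ _ _ hm]; simp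

theorem deg_expand (k : ℕ) (hk : k ≠ 0) (f : Series) (n : ℕ) :
    deg n (MvPowerSeries.expand k hk f) =
      if k ∣ n then MvPowerSeries.expand k hk (deg (n / k) f) else 0 := by
  ext m
  rw [coeff_deg]
  by_cases hm : ∃ m', m = k • m'
  · obtain ⟨m', rfl⟩ := hm
    rw [map_nsmul, smul_eq_mul]
    by_cases hn : k ∣ n
    · obtain ⟨j, rfl⟩ := hn
      rw [if_pos (dvd_mul_right _ _), Nat.mul_div_cancel_left _ (Nat.pos_of_ne_zero hk),
        MvPowerSeries.coeff_expand_smul, MvPowerSeries.coeff_expand_smul, coeff_deg]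
      simp [hk]
    · rw [if_neg, if_neg hn]
      · simp
      · rintro rfl; exact hn (dvd_mul_right _ _)
  · rw [coeff_expand _ _ _ _ hm, ite_self]
    split_ifs
    · rw [coeff_expand _ _ _ _ hm]
    · simp

theorem expand_p (k : ℕ) (hk : k ≠ 0) (j : ℕ) :
    MvPowerSeries.expand k hk (p (j + 1)) = p (k * (j + 1)) := by
  obtain ⟨l, hl⟩ : ∃ l, k * (j + 1) = l + 1 := ⟨k * (j + 1) - 1, by
    have : 0 < k * (j + 1) := by positivity
    omega⟩
  ext m
  rw [hl, coeff_p]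
  by_cases hm : ∃ m', m = k • m'
  · obtain ⟨m', rfl⟩ := hm
    rw [MvPowerSeries.coeff_expand_smul, coeff_p]
    congr 1
    rw [← hl]
    refine propext (exists_congr fun i => ⟨?_, fun hi => ?_⟩)
    · rintro rfl; rw [Finsupp.smul_single, smul_eq_mul]
    · ext t
      have := DFunLike.congr_fun hi t
      simp only [Finsupp.smul_apply, smul_eq_mul, Finsupp.single_apply] at this ⊢
      split_ifs at this ⊢
      · exact Nat.eq_of_mul_eq_mul_left (Nat.pos_of_ne_zero hk) this
      · simpa [hk] using this
  · rw [coeff_expand _ _ _ _ hm, if_neg]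
    rintro ⟨i, rfl⟩
    exact hm ⟨Finsupp.single i (j + 1), by rw [Finsupp.smul_single, smul_eq_mul, hl]⟩

theorem coeff_p_mul (k : ℕ) (f : Series) (m : ℕ →₀ ℕ) :
    MvPowerSeries.coeff m (p (k + 1) * f) =
      ∑ s ∈ m.support, if k + 1 ≤ m s then
        MvPowerSeries.coeff (m - Finsupp.single s (k + 1)) f else 0 := by
  classical
  rw [MvPowerSeries.coeff_mul, ← sum_filter]
  simp only [coeff_p, ite_mul, one_mul, zero_mul]
  rw [← sum_filter]
  symm
  refine sum_bij (fun s _ => (Finsupp.single s (k + 1), m - Finsupp.single s (k + 1))) ?_ ?_ ?_ ?_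
  · intro s hs
    rw [mem_filter] at hs ⊢
    refine ⟨HasAntidiagonal.mem_antidiagonal.2 ?_, s, rfl⟩
    exact add_tsub_cancel_of_le (Finsupp.single_le_iff.2 hs.2)
  · intro s _ t _ hst
    exact (Finsupp.single_left_inj (by simp)).1 (Prod.ext_iff.1 hst).1
  · rintro ⟨a, b⟩ hab
    rw [mem_filter, HasAntidiagonal.mem_antidiagonal] at hab
    obtain ⟨hab, s, hs⟩ := hab
    simp only at hab hs
    subst hs
    refine ⟨s, ?_, ?_⟩
    · subst hab
      rw [mem_filter, Finsupp.mem_support_iff, Finsupp.add_apply, Finsupp.single_eq_same]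
      omega
    · subst hab; rw [add_tsub_cancel_left]
  · intro s hs; rfl

theorem degree_tsub_single {m : ℕ →₀ ℕ} {s k : ℕ} (hk : k ≤ m s) :
    (m - Finsupp.single s k).degree + k = m.degree := by
  conv_rhs => rw [← tsub_add_cancel_of_le (Finsupp.single_le_iff.2 hk)]
  simp

/-- Newton's identity for the complete homogeneous symmetric functions. -/
theorem newton_h (n : ℕ) :
    ((n + 1 : ℕ) : ℂ) • h (n + 1) = ∑ ij ∈ antidiagonal n, p (ij.1 + 1) * h ij.2 := by
  ext m
  rw [map_sum, MvPowerSeries.coeff_smul, coeff_h]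
  simp only [coeff_p_mul, coeff_h]
  rw [sum_comm]
  by_cases hm : m.degree = n + 1
  · rw [if_pos hm, mul_one, ← hm, Finsupp.degree_apply, Nat.cast_sum]
    -- The variable `s` can be stripped of `1, …, m s` copies, so it contributes `m s`; the total is
    -- the degree.
    refine sum_congr rfl fun s hs => ?_
    rw [Finset.Nat.sum_antidiagonal_eq_sum_range_succ_mk]
    have hle : m s ≤ n + 1 := hm ▸ Finsupp.le_degree s m
    rw [← sum_subset (range_subset_range.2 hle)]
    · rw [sum_congr rfl (g := fun _ => (1 : ℂ))]
      · simp
      · intro i hi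
        rw [mem_range] at hi
        have := degree_tsub_single (show i + 1 ≤ m s by omega)
        rw [if_pos (by omega), if_pos (by simp only; omega)]
    · intro i _ hi
      rw [mem_range] at hi
      rw [if_neg (by simp only; omega)]
  · rw [if_neg hm, mul_zero]
    symm
    refine sum_eq_zero fun s hs => sum_eq_zero fun ij hij => ?_
    rw [HasAntidiagonal.mem_antidiagonal] at hij
    split_ifs with h1 h2
    · have := degree_tsub_single h1
      omega
    · rfl
    · rfl

/-- Newton's identity for the elementary symmetric functions. -/
theorem newton_e (n : ℕ) :
    ((n + 1 : ℕ) : ℂ) • e (n + 1) =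
      ∑ ij ∈ antidiagonal n, (-1 : ℂ) ^ ij.1 • (p (ij.1 + 1) * e ij.2) := by
  classical
  ext m
  rw [map_sum, MvPowerSeries.coeff_smul, coeff_e]
  simp only [MvPowerSeries.coeff_smul, coeff_p_mul, coeff_e, mul_sum]
  rw [sum_comm]
  by_cases hm : m.degree = n + 1
  · have key : ∀ s ∈ m.support, (∑ ij ∈ antidiagonal n, (-1 : ℂ) ^ ij.1 *
        (if ij.1 + 1 ≤ m s then if (m - Finsupp.single s (ij.1 + 1)).degree = ij.2 ∧
          ∀ i, (m - Finsupp.single s (ij.1 + 1)) i ≤ 1 then (1 : ℂ) else 0 else 0)) =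
        if ∀ i, m i ≤ 1 then 1 else 0 := by
      intro s hs
      rw [Finsupp.mem_support_iff] at hs
      rw [Finset.Nat.sum_antidiagonal_eq_sum_range_succ_mk]
      have hle : m s ≤ n + 1 := hm ▸ Finsupp.le_degree s m
      rw [← sum_subset (range_subset_range.2 hle)]
      -- Removing `i + 1` copies of `s` leaves a squarefree monomial only if at most one copy
      -- remains. So only the two largest values of `i` count, and their signs cancel unless `m s =
      -- 1`.
      · have step : ∀ i ∈ range (m s), (-1 : ℂ) ^ i * (if i + 1 ≤ m s then
            if (m - Finsupp.single s (i + 1)).degree = n - i ∧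
              ∀ t, (m - Finsupp.single s (i + 1)) t ≤ 1 then (1 : ℂ) else 0 else 0) =
            if (∀ t, t ≠ s → m t ≤ 1) ∧ m s ≤ i + 2 then (-1 : ℂ) ^ i else 0 := by
          intro i hi
          rw [mem_range] at hi
          have hd := degree_tsub_single (show i + 1 ≤ m s by omega)
          rw [if_pos (show i + 1 ≤ m s by omega), mul_ite, mul_one, mul_zero]
          refine if_congr ?_ rfl rfl
          constructor
          · rintro ⟨-, h2⟩
            refine ⟨fun t ht => ?_, ?_⟩
            · simpa [Finsupp.single_apply, Ne.symm ht] using h2 t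
            · have := h2 s
              simp at this
              omega
          · rintro ⟨h1, h2⟩
            refine ⟨by omega, fun t => ?_⟩
            by_cases ht : t = s
            · subst ht; simp; omega
            · simpa [Finsupp.single_apply, Ne.symm ht] using h1 t ht
        rw [sum_congr rfl step]
        by_cases hall : ∀ t, t ≠ s → m t ≤ 1
        · rw [sum_congr rfl fun i _ => if_congr (and_iff_right hall) rfl rfl]
          obtain ⟨a, ha⟩ : ∃ a, m s = a + 1 := ⟨m s - 1, by omega⟩
          rw [ha, sum_range_succ]
          rcases a with _ | a
          · rw [if_pos (show ∀ i, m i ≤ 1 from ?_)]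
            · simp
            · intro t
              by_cases ht : t = s
              · rw [ht, ha]
              · exact hall t ht
          · rw [sum_range_succ, sum_eq_zero, if_neg (show ¬ ∀ i, m i ≤ 1 from ?_)]
            · simp [pow_succ]
            · intro hh; have := hh s; omega
            · intro x hx
              rw [mem_range] at hx
              rw [if_neg]; omega
        · rw [if_neg (fun hh => hall fun t _ => hh t)]
          simp [hall]
      · intro i _ hi
        rw [mem_range] at hi
        rw [if_neg (by simp only; omega), mul_zero]
    rw [sum_congr rfl key, hm]
    by_cases hall : ∀ i, m i ≤ 1
    · simp only [hall, implies_true, and_self, if_true, mul_one, sum_const, nsmul_eq_mul]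
      congr 1
      rw [← hm, Finsupp.degree_apply, sum_congr rfl (g := fun _ => 1)]
      · simp
      · intro i hi
        rw [Finsupp.mem_support_iff] at hi
        have := hall i
        omega
    · simp [hall]
  · rw [if_neg (show ¬ (m.degree = n + 1 ∧ ∀ i, m i ≤ 1) from fun hh => hm hh.1), mul_zero]
    symm
    refine sum_eq_zero fun s hs => sum_eq_zero fun ij hij => ?_
    rw [HasAntidiagonal.mem_antidiagonal] at hij
    split_ifs with h1 h2
    · have := degree_tsub_single h1
      omega
    · simp
    · simp

theorem h_zero : h 0 = 1 := by
  classical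
  ext m
  rw [coeff_h, MvPowerSeries.coeff_one]
  simp [Finsupp.degree_eq_zero_iff]

theorem e_zero : e 0 = 1 := by
  classical
  ext m
  rw [coeff_e, MvPowerSeries.coeff_one]
  have : (m.degree = 0 ∧ ∀ i, m i ≤ 1) ↔ m = 0 := by
    rw [Finsupp.degree_eq_zero_iff]
    refine ⟨fun hh => hh.1, ?_⟩
    rintro rfl
    simp
  simp only [this]

/-! ### Sequences with a given logarithmic derivative -/

/-- The sequence `g` satisfies `g_0 = 1` and `(n + 1) g_{n+1} = ∑_{i+j=n} q_i g_j`, that is,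
its generating function has logarithmic derivative `∑ q_i t^i`. -/
structure IsExp {R : Type*} [CommRing R] [Algebra ℂ R] (q g : ℕ → R) : Prop where
  zero : g 0 = 1
  succ : ∀ n, ((n + 1 : ℕ) : ℂ) • g (n + 1) = ∑ ij ∈ antidiagonal n, q ij.1 * g ij.2

namespace IsExp
variable {R S : Type*} [CommRing R] [Algebra ℂ R] [CommRing S] [Algebra ℂ S] {q g g' : ℕ → R}

theorem unique (hg : IsExp q g) (hg' : IsExp q g') (n : ℕ) : g n = g' n := by
  induction n using Nat.strong_induction_on with
  | _ n ih =>
    rcases n with _ | n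
    · rw [hg.zero, hg'.zero]
    · have hn : ((n + 1 : ℕ) : ℂ) ≠ 0 := by exact_mod_cast n.succ_ne_zero
      refine (isUnit_iff_ne_zero.2 hn).smul_left_cancel.1 ?_
      rw [hg.succ, hg'.succ]
      refine sum_congr rfl fun ij hij => ?_
      rw [HasAntidiagonal.mem_antidiagonal] at hij
      rw [ih ij.2 (by omega)]

theorem map (hg : IsExp q g) (φ : R →ₐ[ℂ] S) : IsExp (fun i => φ (q i)) fun n => φ (g n) where
  zero := by rw [hg.zero, map_one]
  succ n := by rw [← map_smul, hg.succ, map_sum]; simp only [map_mul]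

/-- This is the substitution of `-t` for `t` in the generating function. -/
theorem signed (hg : IsExp q g) :
    IsExp (fun i => (-1 : ℂ) ^ (i + 1) • q i) fun n => (-1 : ℂ) ^ n • g n where
  zero := by rw [hg.zero, pow_zero, one_smul]
  succ n := by
    rw [smul_comm, hg.succ, smul_sum]
    refine sum_congr rfl fun ij hij => ?_
    rw [HasAntidiagonal.mem_antidiagonal] at hij
    rw [smul_mul_smul_comm, ← pow_add, ← hij]
    congr 2
    omega

theorem derivative (hg : IsExp q g) :
    PowerSeries.derivative R (PowerSeries.mk g) = PowerSeries.mk q * PowerSeries.mk g := by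
  ext n
  rw [PowerSeries.coeff_derivative, PowerSeries.coeff_mul]
  simp only [PowerSeries.coeff_mk]
  rw [← hg.succ, Algebra.smul_def, mul_comm]
  simp

theorem of_derivative (h0 : g 0 = 1)
    (hg : PowerSeries.derivative R (PowerSeries.mk g) = PowerSeries.mk q * PowerSeries.mk g) :
    IsExp q g where
  zero := h0
  succ n := by
    have := congrArg (PowerSeries.coeff n) hg
    rw [PowerSeries.coeff_derivative, PowerSeries.coeff_mul] at this
    simp only [PowerSeries.coeff_mk] at this
    rw [← this, Algebra.smul_def, mul_comm]
    simp

/-- The recurrence says `(1 - x t) A(t) = G(t)`, and `1/(1 - x t)` has logarithmic derivative `∑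
x^{i+1} t^i`. The proof multiplies the claim by the unit `1 - x t` to avoid division. -/
theorem geom (hg : IsExp q g) (x : R) {a : ℕ → R} (h0 : a 0 = 1)
    (ha : ∀ n, a (n + 1) = x * a n + g (n + 1)) : IsExp (fun i => x ^ (i + 1) + q i) a := by
  refine of_derivative h0 ?_
  have h1 : (1 - PowerSeries.C x * PowerSeries.X) * PowerSeries.mk a = PowerSeries.mk g := by
    ext n
    rw [sub_mul, one_mul, map_sub, mul_assoc, PowerSeries.coeff_C_mul]
    rcases n with _ | n
    · simp [h0, hg.zero]
    · simp [PowerSeries.coeff_succ_X_mul, ha]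
  have h2 : (1 - PowerSeries.C x * PowerSeries.X) * PowerSeries.mk (fun i => x ^ (i + 1)) =
      PowerSeries.C x := by
    ext n
    rw [sub_mul, one_mul, map_sub, mul_assoc, PowerSeries.coeff_C_mul]
    rcases n with _ | n
    · simp
    · simp [PowerSeries.coeff_succ_X_mul, pow_succ, mul_comm]
  have h3 : IsUnit (1 - PowerSeries.C x * PowerSeries.X) := by
    rw [PowerSeries.isUnit_iff_constantCoeff]
    simp
  have h4 : PowerSeries.mk (fun i => x ^ (i + 1) + q i) =
      PowerSeries.mk (fun i => x ^ (i + 1)) + PowerSeries.mk q := by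
    ext n; simp
  refine h3.mul_left_cancel ?_
  have h5 := hg.derivative
  rw [← h1, Derivation.leibniz, map_sub, Derivation.leibniz] at h5
  simp only [PowerSeries.derivative_C, PowerSeries.derivative_X, smul_eq_mul, mul_one, mul_zero,
    add_zero, Derivation.map_one_eq_zero, zero_sub] at h5
  rw [h4, add_mul, mul_add, ← mul_assoc, h2]
  linear_combination h5

end IsExp

/-- The polynomials `g_n` in the power sums with `(n + 1) g_{n+1} = ∑_{i+j=n} c_i p_{i+1} g_j`. -/
def newtonPoly (c : ℕ → ℂ) : ℕ → MvPolynomial ℕ ℂ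
  | 0 => 1
  | n + 1 => ((n + 1 : ℕ) : ℂ)⁻¹ • ∑ i : Fin (n + 1),
      (c i • MvPolynomial.X (i : ℕ)) * newtonPoly c (n - i)
  decreasing_by omega

theorem isExp_newtonPoly (c : ℕ → ℂ) :
    IsExp (fun i => c i • (MvPolynomial.X i : MvPolynomial ℕ ℂ)) (newtonPoly c) where
  zero := by rw [newtonPoly]
  succ n := by
    have hn : ((n + 1 : ℕ) : ℂ) ≠ 0 := by exact_mod_cast n.succ_ne_zero
    rw [newtonPoly, smul_inv_smul₀ hn, Finset.Nat.sum_antidiagonal_eq_sum_range_succ_mk,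
      Finset.sum_range]

theorem isExp_aeval_newtonPoly {R : Type*} [CommRing R] [Algebra ℂ R] (c : ℕ → ℂ) (y : ℕ → R) :
    IsExp (fun i => c i • y i) fun n => MvPolynomial.aeval y (newtonPoly c n) := by
  simpa using (isExp_newtonPoly c).map (MvPolynomial.aeval y)

theorem isExp_h : IsExp (fun i => p (i + 1)) h := ⟨h_zero, newton_h⟩

theorem isExp_e : IsExp (fun i => (-1 : ℂ) ^ i • p (i + 1)) e :=
  ⟨e_zero, fun n => by rw [newton_e]; simp only [smul_mul_assoc]⟩

theorem aeval_newtonPoly_h (n : ℕ) :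
    MvPolynomial.aeval (fun k => p (k + 1)) (newtonPoly (fun _ => 1) n) = h n := by
  refine IsExp.unique (isExp_aeval_newtonPoly _ _) ?_ n
  simpa using isExp_h

theorem aeval_newtonPoly_e (n : ℕ) :
    MvPolynomial.aeval (fun k => p (k + 1)) (newtonPoly (fun i => (-1) ^ i) n) = e n :=
  IsExp.unique (isExp_aeval_newtonPoly _ _) isExp_e n

/-- `newtonPoly` gives an explicit preimage of `h n` in the power sums, and algebraic independence
makes it the one chosen by `toPowerSums`. -/
theorem plethysm_h (n : ℕ) (f : Series) : plethysm (h n) f = MvPolynomial.aeval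
    (fun k : ℕ => MvPowerSeries.expand (k + 1) k.succ_ne_zero f) (newtonPoly (fun _ => 1) n) := by
  rw [plethysm, ← aeval_newtonPoly_h, toPowerSums_aeval]

theorem plethysm_e (n : ℕ) (f : Series) : plethysm (e n) f = MvPolynomial.aeval
    (fun k : ℕ => MvPowerSeries.expand (k + 1) k.succ_ne_zero f)
      (newtonPoly (fun i => (-1) ^ i) n) := by
  rw [plethysm, ← aeval_newtonPoly_e, toPowerSums_aeval]

/-- Formally `log G = ∑ c_i y_i t^{i+1} / (i+1)`, so the factor `i + 1` in `hyz` cancels the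
denominator and `E G = G · ∑ c_i z_i t^{i+1}`. The induction avoids the logarithm. -/
theorem IsExp.euler {c : ℕ → ℂ} {y z g : ℕ → Series} (hg : IsExp (fun i => c i • y i) g)
    (hyz : ∀ i, euler (y i) = ((i + 1 : ℕ) : ℂ) • z i) (k : ℕ) :
    SymFn.euler (g (k + 1)) = ∑ ij ∈ antidiagonal k, (c ij.1 • z ij.1) * g ij.2 := by
  induction k using Nat.strong_induction_on with
  | _ k ih =>
    have hk : ((k + 1 : ℕ) : ℂ) ≠ 0 := by exact_mod_cast k.succ_ne_zero
    refine (isUnit_iff_ne_zero.2 hk).smul_left_cancel.1 ?_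
    set G := PowerSeries.mk g with hG
    set Y := PowerSeries.mk (fun i => c i • y i) with hY
    set Z := PowerSeries.mk (fun i => c i • z i) with hZ
    have hE : ∀ j ≤ k, SymFn.euler (g j) = PowerSeries.coeff j (PowerSeries.X * (Z * G)) := by
      intro j hj
      rcases j with _ | j
      · rw [hg.zero, euler_one]; simp
      · rw [ih j (by omega), PowerSeries.coeff_succ_X_mul, PowerSeries.coeff_mul]
        simp [hZ, hG]
    have h1 : ∑ ij ∈ antidiagonal k, (c ij.1 • y ij.1) * SymFn.euler (g ij.2) =
        PowerSeries.coeff k (Y * (PowerSeries.X * (Z * G))) := by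
      rw [PowerSeries.coeff_mul]
      refine sum_congr rfl fun ij hij => ?_
      rw [HasAntidiagonal.mem_antidiagonal] at hij
      rw [hE ij.2 (by omega), hY, PowerSeries.coeff_mk]
    -- Replacing `Y G` by `G'` turns the unknown terms into `j z_i g_j`; together with the `(i + 1)
    -- z_i g_j` from `hyz` they add up to the factor `k + 1`.
    have h2 : Y * (PowerSeries.X * (Z * G)) =
        Z * (PowerSeries.X * PowerSeries.derivative Series G) := by
      rw [hg.derivative]; ring
    have h3 : ∀ j, PowerSeries.coeff j (PowerSeries.X * PowerSeries.derivative Series G) =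
        (j : ℂ) • g j := by
      intro j
      rcases j with _ | j
      · simp
      · rw [PowerSeries.coeff_succ_X_mul, PowerSeries.coeff_derivative, hG, PowerSeries.coeff_mk,
          Algebra.smul_def, mul_comm]
        simp
    rw [← map_smul, hg.succ, map_sum]
    simp only [euler_mul, sum_add_distrib, map_smul]
    rw [h1, h2, PowerSeries.coeff_mul, ← sum_add_distrib, smul_sum]
    refine sum_congr rfl fun ij hij => ?_
    rw [HasAntidiagonal.mem_antidiagonal] at hij
    rw [h3, hyz, hZ, PowerSeries.coeff_mk, ← hij]
    simp only [smul_mul_assoc, mul_smul_comm, smul_smul, ← add_smul]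
    congr 1
    push_cast
    ring

/-- This makes the sums over all `k` finite in each degree: `g k` has no component below degree `k`.
-/
theorem deg_eq_zero_of_isExp {q g : ℕ → Series} (hg : IsExp q g)
    (hq : ∀ i n, n < i + 1 → deg n (q i) = 0) (k n : ℕ) (hn : n < k) : deg n (g k) = 0 := by
  induction k using Nat.strong_induction_on generalizing n with
  | _ k ih =>
    rcases k with _ | k
    · omega
    have hk : ((k + 1 : ℕ) : ℂ) ≠ 0 := by exact_mod_cast k.succ_ne_zero
    refine (isUnit_iff_ne_zero.2 hk).smul_left_cancel.1 ?_
    rw [← deg_smul, hg.succ, deg_sum, smul_zero]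
    refine sum_eq_zero fun ij hij => ?_
    rw [HasAntidiagonal.mem_antidiagonal] at hij
    rw [deg_mul]
    refine sum_eq_zero fun ab hab => ?_
    rw [HasAntidiagonal.mem_antidiagonal] at hab
    by_cases ha : ab.1 < ij.1 + 1
    · rw [hq _ _ ha, zero_mul]
    · rw [ih ij.2 (by omega) _ (by omega), mul_zero]

theorem sum_range_sum_antidiagonal {M : Type*} [AddCommMonoid M] (N : ℕ) (f : ℕ → ℕ → M)
    (hf : ∀ i j, N ≤ i + j → f i j = 0) :
    ∑ k ∈ range N, ∑ ij ∈ antidiagonal k, f ij.1 ij.2 =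
      ∑ i ∈ range N, ∑ j ∈ range N, f i j := by
  have h1 : ∑ i ∈ range N, ∑ j ∈ range N, f i j =
      ∑ x ∈ (range N ×ˢ range N).filter (fun x => x.1 + x.2 < N), f x.1 x.2 := by
    rw [sum_filter_of_ne, sum_product]
    intro x _ hx
    by_contra hlt
    exact hx (hf _ _ (by omega))
  rw [h1, ← sum_fiberwise_of_maps_to (t := range N) (g := fun x : ℕ × ℕ => x.1 + x.2)]
  · refine sum_congr rfl fun k hk => sum_congr ?_ fun _ _ => rfl
    ext x
    simp only [HasAntidiagonal.mem_antidiagonal, mem_filter, mem_product, mem_range] at hk ⊢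
    omega
  · intro x hx
    exact mem_range.2 (mem_filter.1 hx).2

/-- The logarithmic derivative of the degree decomposition of a plethystic exponential. -/
theorem isExp_sum_deg {c : ℕ → ℂ} {y z g : ℕ → Series} (hg : IsExp (fun i => c i • y i) g)
    (hyz : ∀ i, euler (y i) = ((i + 1 : ℕ) : ℂ) • z i)
    (hy : ∀ i n, n < i + 1 → deg n (y i) = 0) :
    IsExp (fun a => ∑ i ∈ range (a + 1), c i • deg (a + 1) (z i))
      fun n => ∑ k ∈ range (n + 1), deg n (g k) := by
  have hz : ∀ i n, n < i + 1 → deg n (z i) = 0 := by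
    intro i n hn
    have hi : ((i + 1 : ℕ) : ℂ) ≠ 0 := by exact_mod_cast i.succ_ne_zero
    refine (isUnit_iff_ne_zero.2 hi).smul_left_cancel.1 ?_
    rw [← deg_smul, ← hyz, deg_euler, hy i n hn, smul_zero, smul_zero]
  have hgk := deg_eq_zero_of_isExp hg fun i n hn => by rw [deg_smul, hy i n hn, smul_zero]
  refine ⟨by simp [hg.zero, deg_one], fun n => ?_⟩
  have h1 : ((n + 1 : ℕ) : ℂ) • ∑ k ∈ range (n + 1 + 1), deg (n + 1) (g k) =
      ∑ k ∈ range (n + 1), ∑ ij ∈ antidiagonal k, ∑ ab ∈ antidiagonal n,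
        (c ij.1 • deg (ab.1 + 1) (z ij.1)) * deg ab.2 (g ij.2) := by
    rw [sum_range_succ', hg.zero, deg_one, if_neg n.succ_ne_zero, add_zero, smul_sum]
    refine sum_congr rfl fun k _ => ?_
    rw [← deg_euler, hg.euler hyz, deg_sum]
    refine sum_congr rfl fun ij _ => ?_
    -- No `z i` has a part of degree 0, so the first factor may be indexed by `ab.1 + 1`.
    rw [smul_mul_assoc, deg_smul, deg_mul, Finset.Nat.sum_antidiagonal_succ, hz _ _ (by omega),
      zero_mul, zero_add, smul_sum]
    simp only [smul_mul_assoc]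
  rw [h1, sum_range_sum_antidiagonal (n + 1) fun i j => ∑ ab ∈ antidiagonal n,
    (c i • deg (ab.1 + 1) (z i)) * deg ab.2 (g j)]
  · have h2 : ∀ ab ∈ antidiagonal n, (∑ i ∈ range (ab.1 + 1), c i • deg (ab.1 + 1) (z i)) *
        (∑ k ∈ range (ab.2 + 1), deg ab.2 (g k)) = ∑ i ∈ range (n + 1), ∑ j ∈ range (n + 1),
        (c i • deg (ab.1 + 1) (z i)) * deg ab.2 (g j) := by
      intro ab hab
      rw [HasAntidiagonal.mem_antidiagonal] at hab
      rw [← sum_mul_sum]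
      congr 1
      · refine sum_subset (range_subset_range.2 (by omega)) fun i _ hi => ?_
        rw [mem_range] at hi
        rw [hz _ _ (by omega), smul_zero]
      · refine sum_subset (range_subset_range.2 (by omega)) fun i _ hi => ?_
        rw [mem_range] at hi
        rw [hgk _ _ (by omega)]
    rw [sum_congr rfl h2]
    exact (sum_comm.trans (sum_congr rfl fun i _ => sum_comm)).symm
  · intro i j hij
    refine sum_eq_zero fun ab hab => ?_
    rw [HasAntidiagonal.mem_antidiagonal] at hab
    by_cases ha : ab.1 + 1 < i + 1
    · rw [hz _ _ ha, smul_zero, zero_mul]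
    · rw [hgk j _ (by omega), mul_zero]

/-! ### The character of an induced representation -/

theorem trace_eq_card_fixedPoints {X V : Type*} [Fintype X] [DecidableEq X] [AddCommGroup V]
    [Module ℂ V] (b : Module.Basis X ℂ V) (f : X → X) (T : V →ₗ[ℂ] V) (hT : ∀ x, T (b x) = b (f x)) :
    LinearMap.trace ℂ V T = ((univ.filter fun x => f x = x).card : ℂ) := by
  rw [LinearMap.trace_eq_matrix_trace ℂ b, Matrix.trace]
  simp [LinearMap.toMatrix_apply, hT, Finsupp.single_apply]

/-- Averaging over `G` factors through the coinvariants and gives a section `s` of the quotient map.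
Then `T'` is the quotient map after `T ∘ s`, and cyclicity of the trace replaces it by `T` composed
with the average. -/
theorem trace_coinvariants {G V : Type*} [Group G] [Fintype G] [AddCommGroup V] [Module ℂ V]
    [Module.Finite ℂ V] (ρ : Representation ℂ G V) (T : V →ₗ[ℂ] V)
    (T' : ρ.Coinvariants →ₗ[ℂ] ρ.Coinvariants)
    (hT : T' ∘ₗ Representation.Coinvariants.mk ρ = Representation.Coinvariants.mk ρ ∘ₗ T) :
    LinearMap.trace ℂ _ T' =
      (Fintype.card G : ℂ)⁻¹ * ∑ g, LinearMap.trace ℂ V (T ∘ₗ ρ g) := by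
  have hG : (Fintype.card G : ℂ) ≠ 0 := by exact_mod_cast Fintype.card_ne_zero
  set a : V →ₗ[ℂ] V := (Fintype.card G : ℂ)⁻¹ • ∑ g, ρ g with ha
  have hinv : ∀ g, a ∘ₗ ρ g = a := by
    intro g
    ext v
    simp only [ha, LinearMap.comp_apply, LinearMap.smul_apply, LinearMap.sum_apply]
    congr 1
    exact Fintype.sum_equiv (Equiv.mulRight g) _ _ fun x => by simp
  set s := Representation.Coinvariants.lift ρ a hinv with hs
  have h1 : Representation.Coinvariants.mk ρ ∘ₗ s = LinearMap.id := by
    ext v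
    simp [hs, ha, map_sum, ← Nat.cast_smul_eq_nsmul ℂ, smul_smul, hG]
  have h2 : s ∘ₗ Representation.Coinvariants.mk ρ = a := rfl
  have h3 : T' = Representation.Coinvariants.mk ρ ∘ₗ (T ∘ₗ s) := by
    rw [← LinearMap.comp_assoc, ← hT, LinearMap.comp_assoc, h1, LinearMap.comp_id]
  rw [h3, LinearMap.trace_comp_comm', LinearMap.comp_assoc, h2, ha, LinearMap.comp_smul, map_smul,
    smul_eq_mul]
  congr 1
  rw [← map_sum (LinearMap.trace ℂ V) fun g => T ∘ₗ ρ g]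
  congr 1
  ext v
  simp [LinearMap.sum_apply]

theorem trace_ind {G H : Type*} [Group G] [Fintype G] [Group H] [Fintype H] [DecidableEq H]
    (φ : G →* H) (χ : Representation ℂ G ℂ) (σ : H) :
    LinearMap.trace ℂ _ (Representation.ind φ χ σ) = (Fintype.card G : ℂ)⁻¹ *
      ∑ g, ((univ.filter fun x => φ g * x * σ⁻¹ = x).card : ℂ) * LinearMap.trace ℂ ℂ (χ g) := by
  let b : Module.Basis H ℂ (MonoidAlgebra ℂ H) := ⟨MonoidAlgebra.coeffLinearEquiv ℂ⟩
  have hb : ∀ x, b x = MonoidAlgebra.single x 1 := fun x => rfl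
  have : Module.Finite ℂ (MonoidAlgebra ℂ H) := Module.Finite.of_basis b
  have : Module.Free ℂ (MonoidAlgebra ℂ H) := Module.Free.of_basis b
  rw [trace_coinvariants _ ((MonoidAlgebra.mapDomainLinearMap ℂ ℂ fun x => x * σ⁻¹).rTensor _) _
    rfl]
  congr 1
  refine sum_congr rfl fun g _ => ?_
  have h1 : (MonoidAlgebra.mapDomainLinearMap ℂ ℂ fun x => x * σ⁻¹).rTensor ℂ ∘ₗ
      (Representation.tprod ((Representation.leftRegular ℂ H).comp φ) χ) g =
      TensorProduct.map ((MonoidAlgebra.mapDomainLinearMap ℂ ℂ fun x => x * σ⁻¹) ∘ₗ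
        Representation.leftRegular ℂ H (φ g)) (χ g) := by
    ext; simp
  rw [h1, LinearMap.trace_tensorProduct']
  congr 1
  refine trace_eq_card_fixedPoints b _ _ fun x => ?_
  simp [hb]

/-- The product of power sums `p_{λ(σ)}`, where `λ(σ)` is the cycle type of `σ`. -/
def cyclePowerSum {α : Type*} [Fintype α] [DecidableEq α] (σ : Equiv.Perm α) : Series :=
  (σ.partition.parts.map p).prod

theorem cyclePowerSum_conj {α : Type*} [Fintype α] [DecidableEq α] (σ τ : Equiv.Perm α) :
    cyclePowerSum (τ * σ * τ⁻¹) = cyclePowerSum σ := by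
  have : IsConj σ (τ * σ * τ⁻¹) := isConj_iff.2 ⟨τ, rfl⟩
  rw [cyclePowerSum, cyclePowerSum, Equiv.Perm.partition_eq_of_isConj.1 this]

/-- After exchanging the sums, for given `g` and `x` the fixed-point condition singles out `σ = x⁻¹
φ(g) x`, conjugate to `φ g`. The choices of `x` then cancel the factorial. -/
theorem frobeniusChar_ind {G α : Type} [Group G] [Fintype G] [Fintype α] [DecidableEq α]
    (φ : G →* Equiv.Perm α) (χ : Representation ℂ G ℂ) :
    frobeniusChar (Representation.ind φ χ) = (Fintype.card G : ℂ)⁻¹ •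
      ∑ g, LinearMap.trace ℂ ℂ (χ g) • cyclePowerSum (φ g) := by
  have hα : ((Fintype.card α).factorial : ℂ) ≠ 0 := by exact_mod_cast Nat.factorial_ne_zero _
  have h1 : ∀ σ : Equiv.Perm α, LinearMap.trace ℂ _ (Representation.ind φ χ σ) •
      (σ.partition.parts.map p).prod = (Fintype.card G : ℂ)⁻¹ • ∑ g, LinearMap.trace ℂ ℂ (χ g) •
        ∑ x, if φ g * x * σ⁻¹ = x then cyclePowerSum σ else 0 := by
    intro σ
    rw [trace_ind, mul_smul, sum_smul]
    congr 1
    refine sum_congr rfl fun g _ => ?_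
    rw [mul_comm, mul_smul, Nat.cast_smul_eq_nsmul, ← sum_filter, sum_const]
    rfl
  rw [frobeniusChar, sum_congr rfl fun σ _ => h1 σ, ← smul_sum, smul_comm, sum_comm]
  congr 1
  rw [smul_sum]
  refine sum_congr rfl fun g _ => ?_
  rw [← smul_sum, sum_comm, smul_comm]
  congr 1
  have h2 : ∀ x : Equiv.Perm α, ∑ σ : Equiv.Perm α,
      (if φ g * x * σ⁻¹ = x then cyclePowerSum σ else 0) = cyclePowerSum (φ g) := by
    intro x
    rw [sum_eq_single (x⁻¹ * φ g * x)]
    · rw [if_pos (by group)]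
      simpa using cyclePowerSum_conj (φ g) x⁻¹
    · intro σ _ hσ
      rw [if_neg]
      intro h
      refine hσ ?_
      rw [mul_inv_eq_iff_eq_mul] at h
      rw [mul_assoc, h, inv_mul_cancel_left]
    · simp
  rw [sum_congr rfl fun x _ => h2 x, sum_const, card_univ, Fintype.card_perm,
    ← Nat.cast_smul_eq_nsmul ℂ, inv_smul_smul₀ hα]

/-! ### Cyclic groups -/

/-- On a cycle of length `l`, the power `σ ^ l` has a fixed point, so it is the identity; hence
every cycle has length `orderOf σ`. -/
theorem partition_parts_of_free {α : Type*} [Fintype α] [DecidableEq α] [Nonempty α]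
    (σ : Equiv.Perm α) (hσ : ∀ (k : ℕ) (x : α), (σ ^ k) x = x → σ ^ k = 1) :
    σ.partition.parts = Multiset.replicate (Fintype.card α / orderOf σ) (orderOf σ) := by
  rw [Equiv.Perm.parts_partition]
  by_cases h1 : σ = 1
  · simp [h1]
  have hsupp : σ.support = univ := by
    ext x
    simp only [Equiv.Perm.mem_support, mem_univ, iff_true]
    intro hx
    exact h1 (by simpa using hσ 1 x (by simpa using hx))
  have h2 : ∀ k ∈ σ.cycleType, k = orderOf σ := by
    intro k hk
    refine Nat.dvd_antisymm (Equiv.Perm.dvd_of_mem_cycleType hk) ?_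
    rw [Equiv.Perm.cycleType_def, Multiset.mem_map] at hk
    obtain ⟨c, hc, rfl⟩ := hk
    rw [Finset.mem_val, Equiv.Perm.mem_cycleFactorsFinset_iff] at hc
    obtain ⟨hcyc, hcσ⟩ := hc
    obtain ⟨x, hx⟩ := hcyc.nonempty_support
    have h3 : ∀ k : ℕ, (σ ^ k) x = (c ^ k) x ∧ (c ^ k) x ∈ c.support := by
      intro k
      induction k with
      | zero => simpa using hx
      | succ k ih =>
        rw [pow_succ', pow_succ', Equiv.Perm.mul_apply, Equiv.Perm.mul_apply, ih.1,
          ← hcσ _ ih.2]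
        exact ⟨rfl, Equiv.Perm.apply_mem_support.2 ih.2⟩
    refine orderOf_dvd_of_pow_eq_one (hσ _ x ?_)
    rw [(h3 _).1, Function.comp, ← hcyc.orderOf, pow_orderOf_eq_one]
    rfl
  have h4 := Multiset.eq_replicate_card.2 h2
  have h5 : Multiset.card σ.cycleType * orderOf σ = Fintype.card α := by
    have := Equiv.Perm.sum_cycleType σ
    rwa [h4, Multiset.sum_replicate, hsupp, card_univ, smul_eq_mul] at this
  rw [hsupp, card_univ, Nat.sub_self, Multiset.replicate_zero, add_zero, h4, ← h5,
    Nat.mul_div_cancel _ (orderOf_pos σ)]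

theorem cyclicEmbedding_apply (n : ℕ) (a : Multiplicative (ZMod n)) (x : ZMod n) :
    cyclicEmbedding n a x = a.toAdd + x := rfl

theorem cyclicEmbedding_injective (n : ℕ) : Function.Injective (cyclicEmbedding n) := by
  intro a b hab
  have := Equiv.congr_fun hab 0
  rw [cyclicEmbedding_apply, cyclicEmbedding_apply, add_zero, add_zero] at this
  exact Multiplicative.toAdd.injective this

theorem cyclePowerSum_cyclicEmbedding (n : ℕ) [NeZero n] (a : Multiplicative (ZMod n)) :
    cyclePowerSum (cyclicEmbedding n a) = p (orderOf a) ^ (n / orderOf a) := by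
  rw [cyclePowerSum, partition_parts_of_free,
    orderOf_injective (cyclicEmbedding n) (cyclicEmbedding_injective n)]
  · rw [Multiset.map_replicate, Multiset.prod_replicate, ZMod.card]
  · intro k x hx
    rw [← map_pow, cyclicEmbedding_apply, add_eq_right] at hx
    rw [← map_pow, show a ^ k = 1 from hx, map_one]

/-- The sum of the `r`-th powers of the primitive `d`-th roots of unity. -/
def ramanujanSum (r d : ℕ) : ℂ := ∑ ζ ∈ primitiveRoots d ℂ, ζ ^ r

theorem sum_zmod_eq_sum_nthRoots {M : Type*} [AddCommMonoid M] (n : ℕ) [NeZero n] (f : ℂ → M) :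
    ∑ a : ZMod n, f (ZMod.stdAddChar a) = ∑ ζ ∈ Polynomial.nthRootsFinset n (1 : ℂ), f ζ := by
  have hn : 0 < n := Nat.pos_of_ne_zero (NeZero.ne n)
  rw [← sum_image (s := univ) (g := fun a : ZMod n => (ZMod.stdAddChar a : ℂ)) (f := f)
    fun a _ b _ hab => ZMod.injective_stdAddChar hab]
  congr 1
  refine eq_of_subset_of_card_le ?_ ?_
  · intro ζ hζ
    obtain ⟨a, -, rfl⟩ := mem_image.1 hζ
    rw [Polynomial.mem_nthRootsFinset hn, ← AddChar.map_nsmul_eq_pow]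
    simp
  · rw [card_image_of_injective _ ZMod.injective_stdAddChar, card_univ, ZMod.card,
      (Complex.isPrimitiveRoot_exp n hn.ne').card_nthRootsFinset]

theorem sum_nthRoots_eq_sum_divisors {M : Type*} [AddCommMonoid M] (n : ℕ) (f : ℂ → M) :
    ∑ ζ ∈ Polynomial.nthRootsFinset n (1 : ℂ), f ζ =
      ∑ d ∈ n.divisors, ∑ ζ ∈ primitiveRoots d ℂ, f ζ := by
  classical
  rw [IsPrimitiveRoot.nthRoots_one_eq_biUnion_primitiveRoots, sum_biUnion]
  intro a _ b _ hab
  exact IsPrimitiveRoot.disjoint hab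

/-- The primitive `d`-th roots for `d ∣ n` make up all `n`-th roots of unity, and the rest is
orthogonality of characters. This summatory formula is all that is used to evaluate Ramanujan sums,
including those at 2 and 4. -/
theorem sum_ramanujanSum (r n : ℕ) (hn : 0 < n) :
    ∑ d ∈ n.divisors, ramanujanSum r d = if n ∣ r then (n : ℂ) else 0 := by
  have : NeZero n := ⟨hn.ne'⟩
  simp only [ramanujanSum]
  rw [← sum_nthRoots_eq_sum_divisors n fun ζ => ζ ^ r, ← sum_zmod_eq_sum_nthRoots n fun ζ => ζ ^ r]
  have h1 : ∀ a : ZMod n, (ZMod.stdAddChar a : ℂ) ^ r = ((ZMod.stdAddChar ^ r : AddChar (ZMod n) ℂ) a) :=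
    fun a => rfl
  split_ifs with hr
  · rw [sum_congr rfl (g := fun _ => (1 : ℂ))]
    · simp
    · intro a _
      rw [← AddChar.map_nsmul_eq_pow, nsmul_eq_mul, (ZMod.natCast_eq_zero_iff r n).2 hr, zero_mul,
        AddChar.map_zero_eq_one]
  · simp only [h1]
    refine AddChar.sum_eq_zero_of_ne_one fun h => hr ?_
    have h2 := DFunLike.congr_fun h 1
    rw [← h1, ← AddChar.map_nsmul_eq_pow, AddChar.one_apply, nsmul_one,
      ← AddChar.map_zero_eq_one (ZMod.stdAddChar (N := n))] at h2
    exact (ZMod.natCast_eq_zero_iff r n).1 (ZMod.injective_stdAddChar h2)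

theorem orderOf_stdAddChar (n : ℕ) [NeZero n] (a : Multiplicative (ZMod n)) :
    orderOf (ZMod.stdAddChar a.toAdd : ℂ) = orderOf a :=
  orderOf_injective (ZMod.stdAddChar (N := n)).toMonoidHom
    (fun _ _ h => ZMod.injective_stdAddChar h) a

/-- Group the elements of `C_n` by order: one of order `d` acts with `n / d` cycles of length `d`,
and the character values at order `d` are the `r`-th powers of the primitive `d`-th roots of unity.
-/
theorem smul_cyclicIndChar (n r : ℕ) : (n : ℂ) • cyclicIndChar n r =
    ∑ d ∈ n.divisors, ramanujanSum r d • p d ^ (n / d) := by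
  rcases n with _ | n
  · simp
  have hn : ((n + 1 : ℕ) : ℂ) ≠ 0 := by exact_mod_cast n.succ_ne_zero
  rw [cyclicIndChar, frobeniusChar_ind, Fintype.card_multiplicative, ZMod.card, smul_inv_smul₀ hn]
  have h1 : ∀ a : Multiplicative (ZMod (n + 1)), LinearMap.trace ℂ ℂ (cyclicRep (n + 1) r a) =
      (ZMod.stdAddChar a.toAdd : ℂ) ^ r := by
    intro a
    have : cyclicRep (n + 1) r a =
        ((ZMod.stdAddChar a.toAdd : ℂ) ^ r) • (LinearMap.id : ℂ →ₗ[ℂ] ℂ) := by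
      ext
      rfl
    rw [this, map_smul, LinearMap.trace_id]
    simp
  have h2 : ∀ a : Multiplicative (ZMod (n + 1)), LinearMap.trace ℂ ℂ (cyclicRep (n + 1) r a) •
      cyclePowerSum (cyclicEmbedding (n + 1) a) = (fun ζ : ℂ => ζ ^ r • p (orderOf ζ) ^
        ((n + 1) / orderOf ζ)) (ZMod.stdAddChar a.toAdd) := by
    intro a
    simp only
    rw [h1, cyclePowerSum_cyclicEmbedding, orderOf_stdAddChar]
  rw [sum_congr rfl fun a _ => h2 a]
  refine (Fintype.sum_equiv Multiplicative.toAdd _ (fun a => (fun ζ : ℂ => ζ ^ r • p (orderOf ζ) ^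
    ((n + 1) / orderOf ζ)) (ZMod.stdAddChar a)) fun _ => rfl).trans ?_
  refine (sum_zmod_eq_sum_nthRoots (n + 1) (fun ζ : ℂ => ζ ^ r • p (orderOf ζ) ^
    ((n + 1) / orderOf ζ))).trans ?_
  rw [sum_nthRoots_eq_sum_divisors]
  refine sum_congr rfl fun d hd => ?_
  rw [ramanujanSum, sum_smul]
  refine sum_congr rfl fun ζ hζ => ?_
  rw [← ((mem_primitiveRoots (Nat.pos_of_mem_divisors hd)).1 hζ).eq_orderOf]

/-! ### The plethystic exponentials of `Lie` and `Lie^{(2)}` -/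

theorem sum_ramanujanSum_one (m : ℕ) (hm : 0 < m) :
    ∑ d ∈ m.divisors, ramanujanSum 1 d = if m = 1 then 1 else 0 := by
  rw [sum_ramanujanSum 1 m hm]
  simp only [Nat.dvd_one]
  split_ifs with h1
  · simp [h1]
  · rfl

theorem dvd_two_pow_iff (m K : ℕ) (hK : padicValNat 2 m ≤ K) :
    m ∣ 2 ^ K ↔ m ∣ 2 ^ padicValNat 2 m := by
  refine ⟨fun h => ?_, fun h => h.trans (pow_dvd_pow 2 hK)⟩
  obtain ⟨j, -, rfl⟩ := (Nat.dvd_prime_pow Nat.prime_two).1 h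
  have : Fact (Nat.Prime 2) := ⟨Nat.prime_two⟩
  rw [padicValNat.prime_pow]

/-- The summatory values depend only on whether `m ∣ 2 ^ K`, which is the same for every `K ≥
v_2(m)`; induction over proper divisors recovers the sums themselves. Thus the exponent `2 ^ v_2(n)`
of `Lie^{(2)}_n` yields a value at `d ∣ n` that does not depend on `n`. -/
theorem ramanujanSum_two_pow (m : ℕ) (hm : 0 < m) (K : ℕ) (hK : padicValNat 2 m ≤ K) :
    ramanujanSum (2 ^ K) m = ramanujanSum (2 ^ padicValNat 2 m) m := by
  induction m using Nat.strong_induction_on generalizing K with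
  | _ m ih =>
    have h1 := sum_ramanujanSum (2 ^ K) m hm
    have h2 := sum_ramanujanSum (2 ^ padicValNat 2 m) m hm
    simp only [dvd_two_pow_iff m K hK] at h1
    rw [← h2, ← Nat.insert_self_properDivisors hm.ne', sum_insert Nat.self_notMem_properDivisors,
      sum_insert Nat.self_notMem_properDivisors] at h1
    refine add_right_cancel (h1.trans ?_)
    congr 1
    refine Eq.symm ?_
    refine sum_congr rfl fun d hd => ?_
    rw [Nat.mem_properDivisors] at hd
    have hd0 : 0 < d := Nat.pos_of_dvd_of_pos hd.1 hm
    have hv : padicValNat 2 d ≤ padicValNat 2 m :=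
      (padicValNat_dvd_iff_le hm.ne').1 (pow_padicValNat_dvd.trans hd.1)
    rw [ih d hd.2 hd0 _ hv, ih d hd.2 hd0 _ (hv.trans hK)]

/-- For odd `m` all signs are `+` and this is Möbius inversion. For `m = 2l` the sum is the
summatory function at `2l` minus twice the one at `l`, and these cancel. -/
theorem sum_neg_one_pow_mul_ramanujanSum (m : ℕ) (hm : 0 < m) :
    ∑ x ∈ m.divisorsAntidiagonal, (-1 : ℂ) ^ (x.1 - 1) *
      ramanujanSum (2 ^ padicValNat 2 x.2) x.2 = if m = 1 then 1 else 0 := by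
  have hv : ∀ d ∈ m.divisors, ramanujanSum (2 ^ padicValNat 2 d) d =
      ramanujanSum (2 ^ padicValNat 2 m) d := by
    intro d hd
    refine (ramanujanSum_two_pow d (Nat.pos_of_mem_divisors hd) _ ?_).symm
    exact (padicValNat_dvd_iff_le hm.ne').1
      (pow_padicValNat_dvd.trans (Nat.dvd_of_mem_divisors hd))
  rw [Nat.sum_divisorsAntidiagonal' (f := fun a b => (-1 : ℂ) ^ (a - 1) *
      ramanujanSum (2 ^ padicValNat 2 b) b), sum_congr rfl fun d hd => by rw [hv d hd]]
  rcases Nat.even_or_odd m with he | ho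
  · obtain ⟨l, rfl⟩ := he.two_dvd
    have hl : 0 < l := by omega
    set K := padicValNat 2 (2 * l) with hK
    -- The sign is `-1` exactly when the cofactor `2l / d` is even, that is, when `d ∣ l`.
    have h1 : ∀ d ∈ (2 * l).divisors, (-1 : ℂ) ^ (2 * l / d - 1) * ramanujanSum (2 ^ K) d =
        ramanujanSum (2 ^ K) d - if d ∣ l then 2 * ramanujanSum (2 ^ K) d else 0 := by
      intro d hd
      have hd0 := Nat.pos_of_mem_divisors hd
      obtain ⟨q, hq⟩ := Nat.dvd_of_mem_divisors hd
      have hq0 : q ≠ 0 := by rintro rfl; omega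
      have hdl : d ∣ l ↔ Even q := by
        rw [even_iff_two_dvd]
        constructor
        · rintro ⟨t, rfl⟩
          refine ⟨t, Nat.eq_of_mul_eq_mul_left hd0 ?_⟩
          rw [← hq]; ring
        · rintro ⟨t, rfl⟩
          refine ⟨t, Nat.eq_of_mul_eq_mul_left two_pos ?_⟩
          rw [hq]; ring
      rw [hq, Nat.mul_div_cancel_left _ hd0]
      split_ifs with h
      · have : Odd (q - 1) := Nat.Even.sub_odd (by omega) (hdl.1 h) odd_one
        rw [this.neg_one_pow]; ring
      · have : Even (q - 1) := Nat.Odd.sub_odd (Nat.not_even_iff_odd.1 fun h' => h (hdl.2 h')) odd_one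
        rw [this.neg_one_pow]; ring
    have h2 : (2 * l).divisors.filter (fun d => d ∣ l) = l.divisors := by
      ext d
      simp only [mem_filter, Nat.mem_divisors]
      exact ⟨fun h => ⟨h.2, hl.ne'⟩, fun h => ⟨⟨h.1.mul_left 2, by omega⟩, h.1⟩⟩
    -- Because `K = v_2(2l)`, a power of two `l` is `2 ^ (K - 1)`, so there is room for one more
    -- factor 2.
    have h3 : 2 * l ∣ 2 ^ K ↔ l ∣ 2 ^ K := by
      refine ⟨fun h => (dvd_mul_left _ _).trans h, fun h => ?_⟩
      obtain ⟨j, -, rfl⟩ := (Nat.dvd_prime_pow Nat.prime_two).1 h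
      have : Fact (Nat.Prime 2) := ⟨Nat.prime_two⟩
      rw [hK, ← pow_succ', padicValNat.prime_pow]
    rw [sum_congr rfl h1, sum_sub_distrib, ← sum_filter, h2, ← mul_sum, sum_ramanujanSum _ _ hm,
      sum_ramanujanSum _ _ hl, if_neg (show ¬ 2 * l = 1 by omega)]
    simp only [h3]
    split_ifs
    · push_cast; ring
    · ring
  · have hK : padicValNat 2 m = 0 :=
      padicValNat.eq_zero_of_not_dvd ho.not_two_dvd_nat
    rw [← sum_ramanujanSum_one m hm, hK]
    refine sum_congr rfl fun d hd => ?_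
    have : Odd (m / d) := by
      obtain ⟨q, hq⟩ := Nat.dvd_of_mem_divisors hd
      rw [hq, Nat.mul_div_cancel_left _ (Nat.pos_of_mem_divisors hd)]
      exact (Nat.odd_mul.1 (hq ▸ ho)).2
    rw [(Nat.Odd.sub_odd this odd_one).neg_one_pow, one_mul, pow_zero]

theorem ramanujanSum_self_one (r : ℕ) : ramanujanSum r 1 = 1 := by
  simp [ramanujanSum]

theorem sum_divisors_sum_divisors {M : Type*} [AddCommMonoid M] (m : ℕ) (f : ℕ → ℕ → M) :
    ∑ k ∈ m.divisors, ∑ d ∈ (m / k).divisors, f k d =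
      ∑ D ∈ m.divisors, ∑ x ∈ D.divisorsAntidiagonal, f x.1 x.2 := by
  rw [sum_sigma', sum_sigma']
  refine sum_bij' (fun x _ => ⟨x.1 * x.2, (x.1, x.2)⟩) (fun y _ => ⟨y.2.1, y.2.2⟩) ?_ ?_ ?_ ?_ ?_
  · rintro ⟨k, d⟩ hx
    simp only [mem_sigma, Nat.mem_divisors, Nat.mem_divisorsAntidiagonal, true_and] at hx ⊢
    obtain ⟨⟨⟨q, rfl⟩, hm⟩, hd, hq⟩ := hx
    have hk : 0 < k := Nat.pos_of_ne_zero (left_ne_zero_of_mul hm)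
    rw [Nat.mul_div_cancel_left _ hk] at hd hq
    exact ⟨⟨mul_dvd_mul_left k hd, hm⟩, mul_ne_zero hk.ne' (ne_zero_of_dvd_ne_zero hq hd)⟩
  · rintro ⟨D, k, d⟩ hy
    simp only [mem_sigma, Nat.mem_divisors, Nat.mem_divisorsAntidiagonal] at hy ⊢
    obtain ⟨⟨⟨q, rfl⟩, hm⟩, rfl, hkd⟩ := hy
    have hk : 0 < k := Nat.pos_of_ne_zero (left_ne_zero_of_mul hkd)
    rw [mul_assoc, Nat.mul_div_cancel_left _ hk]
    exact ⟨⟨dvd_mul_right _ _, by rwa [← mul_assoc]⟩, dvd_mul_right _ _,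
      right_ne_zero_of_mul (by rwa [mul_assoc] at hm)⟩
  · rintro ⟨k, d⟩ hx
    rfl
  · rintro ⟨D, k, d⟩ hy
    simp only [mem_sigma, Nat.mem_divisorsAntidiagonal] at hy
    obtain ⟨-, rfl, -⟩ := hy
    rfl
  · rintro ⟨k, d⟩ hx
    rfl

theorem deg_cyclicIndChar (n r j : ℕ) :
    deg j (cyclicIndChar n r) = if j = n then cyclicIndChar n r else 0 := by
  rcases Nat.eq_zero_or_pos n with rfl | hn
  · simp [cyclicIndChar, deg_zero]
  have hn' : (n : ℂ) ≠ 0 := by exact_mod_cast hn.ne'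
  refine (isUnit_iff_ne_zero.2 hn').smul_left_cancel.1 ?_
  have h1 : ∀ d ∈ n.divisors, deg j (p d ^ (n / d)) = if j = n then p d ^ (n / d) else 0 := by
    intro d hd
    have := deg_prod_p (Multiset.replicate (n / d) d) (fun i hi => by
      rw [Multiset.eq_of_mem_replicate hi]; exact Nat.pos_of_mem_divisors hd) j
    rwa [Multiset.map_replicate, Multiset.prod_replicate, Multiset.sum_replicate, smul_eq_mul,
      Nat.div_mul_cancel (Nat.dvd_of_mem_divisors hd)] at this
  rw [← deg_smul, smul_ite, smul_zero, smul_cyclicIndChar, deg_sum]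
  split_ifs with hj
  · refine sum_congr rfl fun d hd => ?_
    rw [deg_smul, h1 d hd, if_pos hj]
  · refine sum_eq_zero fun d hd => ?_
    rw [deg_smul, h1 d hd, if_neg hj, smul_zero]

theorem deg_sumGeTwo (q : ℕ → Series) (n : ℕ) :
    deg n (sumGeTwo q) = if 2 ≤ n then deg n (q n) else 0 := by
  ext m
  have h1 : MvPowerSeries.coeff m (sumGeTwo q) =
    if 2 ≤ m.degree then MvPowerSeries.coeff m (q m.degree) else 0 := rfl
  rw [coeff_deg, h1]
  by_cases hm : m.degree = n
  · subst hm
    rw [if_pos rfl]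
    split_ifs with h2
    · rw [coeff_deg, if_pos rfl]
    · simp
  · rw [if_neg hm]
    split_ifs
    · rw [coeff_deg, if_neg hm]
    · simp

/-- `∑_{n ≥ 2} exp ((2 π i / n) r_n) ↑_{C_n}^{S_n}`. -/
def cyclicSum (r : ℕ → ℕ) : Series := sumGeTwo fun n => cyclicIndChar n (r n)

theorem deg_cyclicSum (r : ℕ → ℕ) (n : ℕ) :
    deg n (cyclicSum r) = if 2 ≤ n then cyclicIndChar n (r n) else 0 := by
  rw [cyclicSum, deg_sumGeTwo, deg_cyclicIndChar, if_pos rfl]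

theorem deg_euler_cyclicSum {r : ℕ → ℕ} {ψ : ℕ → ℂ} (h1 : ψ 1 = 1)
    (hψ : ∀ n, ∀ d ∈ n.divisors, ramanujanSum (r n) d = ψ d) (n : ℕ) (hn : 0 < n) :
    deg n (euler (cyclicSum r)) = (∑ d ∈ n.divisors, ψ d • p d ^ (n / d)) -
      if n = 1 then p 1 else 0 := by
  rw [deg_euler, deg_cyclicSum]
  by_cases h2 : 2 ≤ n
  · rw [if_pos h2, smul_cyclicIndChar, if_neg (by omega), sub_zero]
    exact sum_congr rfl fun d hd => by rw [hψ n d hd]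
  · obtain rfl : n = 1 := by omega
    simp [h1]

/-- Collecting the terms with `k d = D`, the coefficient of `p_D^{(a+1)/D}` is the Dirichlet
convolution in `hc`, which leaves only `D = 1`. The term `c_a p_{a+1}` comes from the summand of
degree 1 missing in `cyclicSum`, met only when `k = a + 1`. -/
theorem sum_deg_expand_cyclicSum {c : ℕ → ℂ} {r : ℕ → ℕ} {ψ : ℕ → ℂ} (h1 : ψ 1 = 1)
    (hψ : ∀ n, ∀ d ∈ n.divisors, ramanujanSum (r n) d = ψ d)
    (hc : ∀ m, 0 < m → ∑ x ∈ m.divisorsAntidiagonal, c (x.1 - 1) * ψ x.2 =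
      if m = 1 then 1 else 0) (a : ℕ) :
    ∑ i ∈ range (a + 1), c i • deg (a + 1)
      (MvPowerSeries.expand (i + 1) i.succ_ne_zero (euler (cyclicSum r))) =
      p 1 ^ (a + 1) - c a • p (a + 1) := by
  set g : ℕ → Series := fun k => if k ∣ a + 1 then c (k - 1) • ((∑ d ∈ ((a + 1) / k).divisors,
    ψ d • p (k * d) ^ ((a + 1) / (k * d))) - if k = a + 1 then p k else 0) else 0 with hg
  have hterm : ∀ i ∈ range (a + 1), c i • deg (a + 1)
      (MvPowerSeries.expand (i + 1) i.succ_ne_zero (euler (cyclicSum r))) = g (i + 1) := by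
    intro i _
    simp only [hg]
    rw [deg_expand]
    split_ifs with hd hk
    · rw [← hk, Nat.div_self i.succ_pos, deg_euler_cyclicSum h1 hψ 1 one_pos, map_sub]
      simp [expand_p i.succ i.succ_ne_zero 0, h1]
    · obtain ⟨q, hq⟩ := hd
      have hq0 : 0 < q := Nat.pos_of_ne_zero (by rintro rfl; omega)
      rw [hq, Nat.mul_div_cancel_left _ i.succ_pos, deg_euler_cyclicSum h1 hψ q hq0, if_neg,
        sub_zero, sub_zero, map_sum]
      · congr 1
        refine sum_congr rfl fun d hd => ?_
        obtain ⟨e, rfl⟩ : ∃ e, d = e + 1 := ⟨d - 1, by have := Nat.pos_of_mem_divisors hd; omega⟩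
        rw [map_smul, map_pow, expand_p, Nat.mul_div_mul_left _ _ i.succ_pos]
      · rintro rfl
        exact hk (by omega)
    · rw [smul_zero]
  have hdiv : (Ico 1 (a + 1 + 1)).filter (fun k => k ∣ a + 1) = (a + 1).divisors := rfl
  rw [sum_congr rfl hterm, range_eq_Ico, sum_Ico_add' g 0 (a + 1) 1, zero_add, hg, ← sum_filter, hdiv]
  simp only [smul_sub, sum_sub_distrib, smul_ite, smul_zero, smul_sum]
  congr 1
  · rw [sum_divisors_sum_divisors (a + 1) fun k d =>
      c (k - 1) • ψ d • p (k * d) ^ ((a + 1) / (k * d))]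
    have h2 : ∀ D ∈ (a + 1).divisors, ∑ x ∈ D.divisorsAntidiagonal,
        c (x.1 - 1) • ψ x.2 • p (x.1 * x.2) ^ ((a + 1) / (x.1 * x.2)) =
        if D = 1 then p 1 ^ (a + 1) else 0 := by
      intro D hD
      have h3 : ∀ x ∈ D.divisorsAntidiagonal,
          c (x.1 - 1) • ψ x.2 • p (x.1 * x.2) ^ ((a + 1) / (x.1 * x.2)) =
          (c (x.1 - 1) * ψ x.2) • p D ^ ((a + 1) / D) := by
        intro x hx
        rw [(Nat.mem_divisorsAntidiagonal.1 hx).1, smul_smul]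
      rw [sum_congr rfl h3, ← sum_smul, hc D (Nat.pos_of_mem_divisors hD)]
      split_ifs with hD1
      · simp [hD1]
      · rw [zero_smul]
    rw [sum_congr rfl h2]
    simp
  · simp

/-! ### Symmetric functions and the involution `ω` -/

/-- The algebra generated by the power sums. -/
def powerSumAlgebra : Subalgebra ℂ Series :=
  (MvPolynomial.aeval (R := ℂ) fun k : ℕ => p (k + 1)).range

/-- The algebra homomorphism defining `ω`, on polynomials in the power sums. -/
def omegaHom : MvPolynomial ℕ ℂ →ₐ[ℂ] Series :=
  MvPolynomial.aeval fun k : ℕ => (-1 : Series) ^ k * p (k + 1)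

theorem omega_aeval (P : MvPolynomial ℕ ℂ) :
    omega (MvPolynomial.aeval (fun k : ℕ => p (k + 1)) P) = omegaHom P := by
  rw [omega, toPowerSums_aeval]; rfl

/-- Membership is needed because `toPowerSums` takes an arbitrary value outside the algebra of the
power sums, where `omega` need not be additive. -/
theorem omega_add {f g : Series} (hf : f ∈ powerSumAlgebra) (hg : g ∈ powerSumAlgebra) :
    omega (f + g) = omega f + omega g := by
  obtain ⟨P, rfl⟩ := hf
  obtain ⟨Q, rfl⟩ := hg
  simp only [AlgHom.toRingHom_eq_coe, RingHom.coe_coe, ← map_add, omega_aeval]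

theorem omega_mul {f g : Series} (hf : f ∈ powerSumAlgebra) (hg : g ∈ powerSumAlgebra) :
    omega (f * g) = omega f * omega g := by
  obtain ⟨P, rfl⟩ := hf
  obtain ⟨Q, rfl⟩ := hg
  simp only [AlgHom.toRingHom_eq_coe, RingHom.coe_coe, ← map_mul, omega_aeval]

theorem omega_algebraMap (a : ℂ) : omega (algebraMap ℂ Series a) = algebraMap ℂ Series a := by
  have := omega_aeval (algebraMap ℂ _ a)
  simpa only [AlgHom.commutes] using this

theorem omega_smul (a : ℂ) {f : Series} (hf : f ∈ powerSumAlgebra) :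
    omega (a • f) = a • omega f := by
  rw [Algebra.smul_def, omega_mul (algebraMap_mem _ a) hf, omega_algebraMap, ← Algebra.smul_def]

theorem omega_zero : omega 0 = 0 := by
  simpa using omega_algebraMap 0

theorem omega_one : omega 1 = 1 := by
  simpa using omega_algebraMap 1

theorem omega_sum {ι : Type*} (s : Finset ι) {f : ι → Series}
    (hf : ∀ i ∈ s, f i ∈ powerSumAlgebra) : omega (∑ i ∈ s, f i) = ∑ i ∈ s, omega (f i) := by
  classical
  induction s using Finset.induction_on with
  | empty => simp [omega_zero]
  | insert a s ha ih =>
    rw [sum_insert ha, sum_insert ha, omega_add (hf a (by simp))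
      (sum_mem fun i hi => hf i (by simp [hi])), ih fun i hi => hf i (by simp [hi])]

theorem omega_pow {f : Series} (hf : f ∈ powerSumAlgebra) (n : ℕ) :
    omega (f ^ n) = omega f ^ n := by
  induction n with
  | zero => rw [pow_zero, pow_zero, omega_one]
  | succ n ih => rw [pow_succ, pow_succ, omega_mul (pow_mem hf n) hf, ih]

theorem p_mem (k : ℕ) : p (k + 1) ∈ powerSumAlgebra := ⟨MvPolynomial.X k, by simp⟩

theorem h_mem (n : ℕ) : h n ∈ powerSumAlgebra := ⟨_, aeval_newtonPoly_h n⟩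

theorem e_mem (n : ℕ) : e n ∈ powerSumAlgebra := ⟨_, aeval_newtonPoly_e n⟩

theorem omega_p (k : ℕ) : omega (p (k + 1)) = (-1) ^ k * p (k + 1) := by
  have := omega_aeval (MvPolynomial.X k)
  simpa [omegaHom] using this

theorem neg_one_pow_smul (k : ℕ) (f : Series) : (-1 : ℂ) ^ k • f = (-1) ^ k * f := by
  rcases neg_one_pow_eq_or ℂ k with hk | hk <;> rcases Nat.even_or_odd k with he | he <;>
    simp [he.neg_one_pow]

theorem isExp_omegaHom_newtonPoly (c : ℕ → ℂ) :
    IsExp (fun i => (c i * (-1) ^ i) • p (i + 1)) fun n => omegaHom (newtonPoly c n) := by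
  have h1 : omegaHom = MvPolynomial.aeval fun k : ℕ => (-1 : ℂ) ^ k • p (k + 1) := by
    simp only [omegaHom, neg_one_pow_smul]
  rw [h1]
  simpa only [smul_smul] using
    isExp_aeval_newtonPoly c (fun k : ℕ => (-1 : ℂ) ^ k • p (k + 1))

theorem omega_h (n : ℕ) : omega (h n) = e n := by
  rw [← aeval_newtonPoly_h, omega_aeval]
  exact IsExp.unique (isExp_omegaHom_newtonPoly _) (by simpa only [one_mul] using isExp_e) n

theorem omega_e (n : ℕ) : omega (e n) = h n := by
  rw [← aeval_newtonPoly_e, omega_aeval]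
  refine IsExp.unique (isExp_omegaHom_newtonPoly _) ?_ n
  simpa [← mul_pow] using isExp_h

theorem expand_mem {f : Series} (hf : f ∈ powerSumAlgebra) (k : ℕ) (hk : k ≠ 0) :
    MvPowerSeries.expand k hk f ∈ powerSumAlgebra := by
  obtain ⟨P, rfl⟩ := hf
  simp only [AlgHom.toRingHom_eq_coe, RingHom.coe_coe]
  induction P using MvPolynomial.induction_on with
  | C a =>
    rw [MvPolynomial.aeval_C, AlgHom.commutes]
    exact algebraMap_mem _ a
  | add P Q hP hQ => rw [map_add, map_add]; exact add_mem hP hQ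
  | mul_X P i hP =>
    rw [map_mul, map_mul, MvPolynomial.aeval_X, expand_p]
    obtain ⟨l, hl⟩ : ∃ l, k * (i + 1) = l + 1 := ⟨k * (i + 1) - 1, by
      have : 0 < k * (i + 1) := by positivity
      omega⟩
    rw [hl]
    exact mul_mem hP (p_mem l)

theorem cyclicIndChar_mem (n r : ℕ) : cyclicIndChar n r ∈ powerSumAlgebra := by
  rcases Nat.eq_zero_or_pos n with rfl | hn
  · exact zero_mem _
  have hn' : (n : ℂ) ≠ 0 := by exact_mod_cast hn.ne'
  rw [← inv_smul_smul₀ hn' (cyclicIndChar n r), smul_cyclicIndChar]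
  refine Subalgebra.smul_mem _ (sum_mem fun d hd => Subalgebra.smul_mem _ (pow_mem ?_ _) _) _
  obtain ⟨e, rfl⟩ : ∃ e, d = e + 1 := ⟨d - 1, by have := Nat.pos_of_mem_divisors hd; omega⟩
  exact p_mem e

/-- The plethysms with infinite sums need not lie in `powerSumAlgebra`, but their homogeneous parts
do, and `omega` is applied only to those. -/
theorem deg_aeval_mem {y : ℕ → Series} (hy : ∀ i n, deg n (y i) ∈ powerSumAlgebra)
    (P : MvPolynomial ℕ ℂ) (n : ℕ) : deg n (MvPolynomial.aeval y P) ∈ powerSumAlgebra := by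
  induction P using MvPolynomial.induction_on generalizing n with
  | C a =>
    rw [MvPolynomial.aeval_C, Algebra.algebraMap_eq_smul_one, deg_smul, deg_one]
    refine Subalgebra.smul_mem _ ?_ _
    split_ifs
    · exact one_mem _
    · exact zero_mem _
  | add P Q hP hQ => rw [map_add, deg_add]; exact add_mem (hP n) (hQ n)
  | mul_X P i hP =>
    rw [map_mul, deg_mul, MvPolynomial.aeval_X]
    exact sum_mem fun ab _ => mul_mem (hP _) (hy _ _)

theorem deg_expand_cyclicSum_mem (r : ℕ → ℕ) (i n : ℕ) :
    deg n (MvPowerSeries.expand (i + 1) i.succ_ne_zero (cyclicSum r)) ∈ powerSumAlgebra := by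
  rw [deg_expand]
  split_ifs
  · refine expand_mem ?_ _ _
    rw [deg_cyclicSum]
    split_ifs
    · exact cyclicIndChar_mem _ _
    · exact zero_mem _
  · exact zero_mem _

theorem deg_plethysm_mem (f : Series) (r : ℕ → ℕ) (n : ℕ) :
    deg n (plethysm f (cyclicSum r)) ∈ powerSumAlgebra :=
  deg_aeval_mem (deg_expand_cyclicSum_mem r) _ n

/-! ### The sums of the plethysms -/

/-- `∑_{k=0}^n x^{n-k} g_k`. -/
def geomSum (x : Series) (g : ℕ → Series) (n : ℕ) : Series :=
  ∑ k ∈ range (n + 1), x ^ (n - k) * g k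

theorem geomSum_succ (x : Series) (g : ℕ → Series) (n : ℕ) :
    geomSum x g (n + 1) = x * geomSum x g n + g (n + 1) := by
  rw [geomSum, sum_range_succ, Nat.sub_self, pow_zero, one_mul, geomSum, mul_sum]
  congr 1
  refine sum_congr rfl fun k hk => ?_
  rw [mem_range] at hk
  rw [show n + 1 - k = n - k + 1 by omega, pow_succ]
  ring

theorem IsExp.geomSum {q g : ℕ → Series} (hg : IsExp q g) (x : Series) :
    IsExp (fun i => x ^ (i + 1) + q i) (geomSum x g) :=
  hg.geom x (by simp [SymFn.geomSum, hg.zero]) (geomSum_succ x g)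

section

variable {c : ℕ → ℂ} {r : ℕ → ℕ} {ψ : ℕ → ℂ} {g : ℕ → Series}

theorem deg_expand_cyclicSum_eq_zero (r : ℕ → ℕ) (i n : ℕ) (hn : n < i + 1) :
    deg n (MvPowerSeries.expand (i + 1) i.succ_ne_zero (cyclicSum r)) = 0 := by
  rw [deg_expand]
  split_ifs
  · rw [Nat.div_eq_of_lt hn, deg_cyclicSum, if_neg (by omega), map_zero]
  · rfl

theorem deg_plethystic_eq_zero (hg : IsExp (fun i => c i •
      MvPowerSeries.expand (i + 1) i.succ_ne_zero (cyclicSum r)) g) (k n : ℕ) (hn : n < k) :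
    deg n (g k) = 0 :=
  deg_eq_zero_of_isExp hg (fun i n hn => by
    rw [deg_smul, deg_expand_cyclicSum_eq_zero r i n hn, smul_zero]) k n hn

theorem isExp_plethystic (h1 : ψ 1 = 1)
    (hψ : ∀ n, ∀ d ∈ n.divisors, ramanujanSum (r n) d = ψ d)
    (hc : ∀ m, 0 < m → ∑ x ∈ m.divisorsAntidiagonal, c (x.1 - 1) * ψ x.2 =
      if m = 1 then 1 else 0)
    (hg : IsExp (fun i => c i •
      MvPowerSeries.expand (i + 1) i.succ_ne_zero (cyclicSum r)) g) :
    IsExp (fun i => p 1 ^ (i + 1) - c i • p (i + 1))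
      fun n => ∑ k ∈ range (n + 1), deg n (g k) := by
  have := isExp_sum_deg hg (fun i => euler_expand (i + 1) i.succ_ne_zero (cyclicSum r))
    (deg_expand_cyclicSum_eq_zero r)
  simpa only [sum_deg_expand_cyclicSum h1 hψ hc] using this

/-- Negating the logarithmic derivative inverts the generating function, so the inversion hypothesis
`hc` is used for `c`, not for `-c`. -/
theorem isExp_signed_plethystic (h1 : ψ 1 = 1)
    (hψ : ∀ n, ∀ d ∈ n.divisors, ramanujanSum (r n) d = ψ d)
    (hc : ∀ m, 0 < m → ∑ x ∈ m.divisorsAntidiagonal, c (x.1 - 1) * ψ x.2 =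
      if m = 1 then 1 else 0)
    (hg : IsExp (fun i => -c i •
      MvPowerSeries.expand (i + 1) i.succ_ne_zero (cyclicSum r)) g) :
    IsExp (fun i => -(p 1 ^ (i + 1) - c i • p (i + 1)))
      fun n => ∑ k ∈ range (n + 1), deg n (g k) := by
  have := isExp_sum_deg (c := fun i => -c i) hg
    (fun i => euler_expand (i + 1) i.succ_ne_zero (cyclicSum r))
    (deg_expand_cyclicSum_eq_zero r)
  simpa only [neg_smul, sum_neg_distrib, sum_deg_expand_cyclicSum h1 hψ hc] using this

end

theorem isExp_plethysm_h (f : Series) : IsExp (fun i => (1 : ℂ) •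
    MvPowerSeries.expand (i + 1) i.succ_ne_zero f) fun n => plethysm (h n) f := by
  simp only [plethysm_h]
  exact isExp_aeval_newtonPoly _ _

theorem isExp_plethysm_e (f : Series) : IsExp (fun i => (-1 : ℂ) ^ i •
    MvPowerSeries.expand (i + 1) i.succ_ne_zero f) fun n => plethysm (e n) f := by
  simp only [plethysm_e]
  exact isExp_aeval_newtonPoly _ _

/-- The exponents defining `Lie^{(2)}`. -/
abbrev twoPart (n : ℕ) : ℕ := 2 ^ padicValNat 2 n

theorem sumGeTwo_lie : sumGeTwo lie = cyclicSum fun _ => 1 := rfl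

theorem sumGeTwo_lieTwo : sumGeTwo lieTwo = cyclicSum twoPart := rfl

theorem sum_divisorsAntidiagonal_ramanujanSum_one (m : ℕ) (hm : 0 < m) :
    ∑ x ∈ m.divisorsAntidiagonal, 1 * ramanujanSum 1 x.2 = if m = 1 then 1 else 0 := by
  rw [← sum_ramanujanSum_one m hm,
    Nat.sum_divisorsAntidiagonal' (f := fun _ b => 1 * ramanujanSum 1 b)]
  simp only [one_mul]

theorem ramanujanSum_twoPart (n d : ℕ) (hd : d ∈ n.divisors) :
    ramanujanSum (twoPart n) d = ramanujanSum (twoPart d) d :=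
  ramanujanSum_two_pow d (Nat.pos_of_mem_divisors hd) _
    ((padicValNat_dvd_iff_le (Nat.ne_zero_of_mem_divisors hd)).1
      (pow_padicValNat_dvd.trans (Nat.dvd_of_mem_divisors hd)))

theorem neg_one_pow_succ_mul (i : ℕ) : (-1 : ℂ) ^ (i + 1) * (-1) ^ i = -1 := by
  rw [← pow_add, Odd.neg_one_pow ⟨i, by ring⟩]

/-- Both generating functions equal `E(-t) / (1 - p_1 t)`. -/
theorem sum_deg_plethysm_h_lie (n : ℕ) :
    ∑ k ∈ range (n + 1), deg n (plethysm (h k) (sumGeTwo lie)) =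
      geomSum (p 1) (fun k => (-1 : ℂ) ^ k • e k) n := by
  refine IsExp.unique (isExp_plethystic (c := fun _ => 1) (ψ := ramanujanSum 1) (ramanujanSum_self_one 1)
    (fun _ _ _ => rfl) sum_divisorsAntidiagonal_ramanujanSum_one
    (isExp_plethysm_h (cyclicSum fun _ => 1))) ?_ n
  have := (isExp_e.signed).geomSum (p 1)
  simpa only [smul_smul, neg_one_pow_succ_mul, neg_smul, ← sub_eq_add_neg] using this

/-- Both generating functions equal `H(-t) / (1 - p_1 t)`. -/
theorem sum_deg_plethysm_e_lieTwo (n : ℕ) :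
    ∑ k ∈ range (n + 1), deg n (plethysm (e k) (sumGeTwo lieTwo)) =
      geomSum (p 1) (fun k => (-1 : ℂ) ^ k • h k) n := by
  refine IsExp.unique (isExp_plethystic (c := fun i => (-1) ^ i)
    (ψ := fun d => ramanujanSum (twoPart d) d) (ramanujanSum_self_one _)
    ramanujanSum_twoPart sum_neg_one_pow_mul_ramanujanSum
    (isExp_plethysm_e (cyclicSum twoPart))) ?_ n
  have := (isExp_h.signed).geomSum (p 1)
  simpa only [pow_succ, mul_neg_one, neg_smul, ← sub_eq_add_neg] using this

/-- The signed series is `(1 - p_1 t) H(t)`. Dividing by `1 - p_1 t`, which is what `geomSum` does,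
leaves `H(t)`, and the recurrence of `geomSum` is then solved for the coefficient. -/
theorem sum_signed_deg_plethysm_e_lie (n : ℕ) :
    ∑ k ∈ range (n + 1 + 1), (-1 : ℂ) ^ k • deg (n + 1) (plethysm (e k) (sumGeTwo lie)) =
      h (n + 1) - p 1 * h n := by
  have h1 := (isExp_plethysm_e (cyclicSum fun _ => 1)).signed
  simp only [smul_smul, neg_one_pow_succ_mul] at h1
  have h2 := isExp_signed_plethystic (c := fun _ => 1) (ψ := ramanujanSum 1) (ramanujanSum_self_one 1)
    (fun _ _ _ => rfl) sum_divisorsAntidiagonal_ramanujanSum_one h1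
  set G : ℕ → Series := fun n => ∑ k ∈ range (n + 1),
    deg n ((-1 : ℂ) ^ k • plethysm (e k) (cyclicSum fun _ => 1)) with hG
  have h3 := h2.geomSum (p 1)
  simp only [one_smul, neg_sub, add_sub_cancel] at h3
  have h4 : ∀ n, geomSum (p 1) G n = h n := h3.unique isExp_h
  have h5 := geomSum_succ (p 1) G n
  rw [h4, h4] at h5
  rw [h5, add_sub_cancel_left, hG]
  simp only [deg_smul, sumGeTwo_lie]

theorem sum_signed_deg_plethysm_h_lieTwo (n : ℕ) :
    ∑ k ∈ range (n + 1 + 1), (-1 : ℂ) ^ k • deg (n + 1) (plethysm (h k) (sumGeTwo lieTwo)) =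
      e (n + 1) - p 1 * e n := by
  have h1 := (isExp_plethysm_h (cyclicSum twoPart)).signed
  simp only [smul_smul, mul_one, pow_succ, mul_neg] at h1
  have h2 := isExp_signed_plethystic (c := fun i => (-1) ^ i)
    (ψ := fun d => ramanujanSum (twoPart d) d) (ramanujanSum_self_one _)
    ramanujanSum_twoPart sum_neg_one_pow_mul_ramanujanSum h1
  set G : ℕ → Series := fun n => ∑ k ∈ range (n + 1),
    deg n ((-1 : ℂ) ^ k • plethysm (h k) (cyclicSum twoPart)) with hG
  have h3 := h2.geomSum (p 1)
  simp only [neg_sub, add_sub_cancel] at h3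
  have h4 : ∀ n, geomSum (p 1) G n = e n := h3.unique isExp_e
  have h5 := geomSum_succ (p 1) G n
  rw [h4, h4] at h5
  rw [h5, add_sub_cancel_left, hG]
  simp only [deg_smul, sumGeTwo_lieTwo]

/-! ### The sums over `r ≥ 1` as finite sums. -/

theorem finsum_one_le_eq_sum {f : ℕ → Series} (n : ℕ) (hf : ∀ r, n < r → f r = 0) :
    ∑ᶠ (r : ℕ) (_ : 1 ≤ r), f r = ∑ r ∈ range n, f (r + 1) := by
  have h1 : ∀ r, (∑ᶠ (_ : 1 ≤ r), f r) = if 1 ≤ r then f r else 0 := fun r => finsum_eq_if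
  simp only [h1]
  rw [finsum_eq_sum_of_support_subset (s := range (n + 1)), sum_range_succ']
  · simp
  · intro r hr
    rw [Function.mem_support] at hr
    rw [coe_range, Set.mem_Iio]
    by_contra hlt
    exact hr (by rw [hf r (by omega), ite_self])

theorem deg_plethysm_h_eq_zero (r : ℕ → ℕ) {k n : ℕ} (hn : n < k) :
    deg n (plethysm (h k) (cyclicSum r)) = 0 :=
  deg_plethystic_eq_zero (isExp_plethysm_h _) k n hn

theorem deg_plethysm_e_eq_zero (r : ℕ → ℕ) {k n : ℕ} (hn : n < k) :
    deg n (plethysm (e k) (cyclicSum r)) = 0 :=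
  deg_plethystic_eq_zero (isExp_plethysm_e _) k n hn

theorem deg_plethysm_h_zero (f : Series) {n : ℕ} (hn : n ≠ 0) : deg n (plethysm (h 0) f) = 0 := by
  rw [(isExp_plethysm_h f).zero, deg_one, if_neg hn]

theorem deg_plethysm_e_zero (f : Series) {n : ℕ} (hn : n ≠ 0) : deg n (plethysm (e 0) f) = 0 := by
  rw [(isExp_plethysm_e f).zero, deg_one, if_neg hn]

theorem geomSum_signed_h (n : ℕ) : geomSum (p 1) (fun k => (-1 : ℂ) ^ k • h k) n =
    ∑ k ∈ range (n + 1), (-1) ^ k * p 1 ^ (n - k) * h k := by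
  refine sum_congr rfl fun k _ => ?_
  simp only [neg_one_pow_smul]; ring

theorem finsum_deltaPiece (n : ℕ) (hn : n ≠ 0) : ∑ᶠ (r : ℕ) (_ : 1 ≤ r), deltaPiece n r =
    ∑ k ∈ range (n + 1), (-1) ^ k * p 1 ^ (n - k) * h k := by
  rw [← geomSum_signed_h, ← sum_deg_plethysm_e_lieTwo, sum_range_succ', deg_plethysm_e_zero _ hn,
    add_zero, finsum_one_le_eq_sum n]
  · rfl
  · exact fun r hr => deg_plethysm_e_eq_zero _ hr

theorem finsum_omega_hodgePiece (n : ℕ) (hn : n ≠ 0) :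
    ∑ᶠ (r : ℕ) (_ : 1 ≤ r), omega (hodgePiece n r) =
      ∑ k ∈ range (n + 1), (-1) ^ k * p 1 ^ (n - k) * h k := by
  rw [finsum_one_le_eq_sum n, ← omega_sum]
  · have h1 := sum_deg_plethysm_h_lie n
    rw [sum_range_succ', deg_plethysm_h_zero _ hn, add_zero] at h1
    change omega (∑ i ∈ range n, deg n (plethysm (h (i + 1)) (sumGeTwo lie))) = _
    have hmem : ∀ k, (-1 : ℂ) ^ k • e k ∈ powerSumAlgebra := fun k =>
      Subalgebra.smul_mem _ (e_mem k) _
    rw [h1, geomSum, omega_sum _ fun k _ => mul_mem (pow_mem (p_mem 0) _) (hmem k),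
      ← geomSum_signed_h]
    refine sum_congr rfl fun k _ => ?_
    rw [omega_mul (pow_mem (p_mem 0) _) (hmem k), omega_pow (p_mem 0), omega_smul _ (e_mem k),
      omega_e, omega_p, pow_zero, one_mul]
  · exact fun r _ => deg_plethysm_mem _ _ n
  · intro r hr
    rw [hodgePiece, sumGeTwo_lie, deg_plethysm_h_eq_zero _ hr, omega_zero]

theorem finsum_signed_omega_deg_plethysm_e_lie (n : ℕ) : ∑ᶠ (r : ℕ) (_ : 1 ≤ r),
    (-1) ^ (r - 1) * omega (deg (n + 1) (plethysm (e r) (sumGeTwo lie))) =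
      p 1 * e n - e (n + 1) := by
  rw [finsum_one_le_eq_sum (n + 1)]
  · have h1 := congrArg omega (sum_signed_deg_plethysm_e_lie n)
    have hmem : ∀ k, deg (n + 1) (plethysm (e k) (sumGeTwo lie)) ∈ powerSumAlgebra := fun k =>
      deg_plethysm_mem _ _ _
    rw [sum_range_succ', deg_plethysm_e_zero _ n.succ_ne_zero, smul_zero, add_zero,
      omega_sum _ (fun k _ => Subalgebra.smul_mem _ (hmem _) _), sub_eq_add_neg,
      ← neg_one_smul ℂ (p 1 * h n), omega_add (h_mem _)
      (Subalgebra.smul_mem _ (mul_mem (p_mem 0) (h_mem n)) _),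
      omega_smul _ (mul_mem (p_mem 0) (h_mem n)), omega_mul (p_mem 0) (h_mem n), omega_h, omega_h,
      omega_p 0, pow_zero, one_mul, neg_one_smul] at h1
    rw [← neg_sub, sub_eq_add_neg, ← h1, ← sum_neg_distrib]
    refine sum_congr rfl fun k _ => ?_
    rw [omega_smul _ (hmem _), neg_one_pow_smul, pow_succ, Nat.add_sub_cancel]
    ring
  · intro r hr
    rw [sumGeTwo_lie, deg_plethysm_e_eq_zero _ hr, omega_zero, mul_zero]

theorem finsum_signed_deg_plethysm_h_lieTwo (n : ℕ) : ∑ᶠ (r : ℕ) (_ : 1 ≤ r),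
    (-1) ^ (r - 1) * deg (n + 1) (plethysm (h r) (sumGeTwo lieTwo)) =
      p 1 * e n - e (n + 1) := by
  rw [finsum_one_le_eq_sum (n + 1)]
  · have h1 := sum_signed_deg_plethysm_h_lieTwo n
    rw [sum_range_succ', deg_plethysm_h_zero _ n.succ_ne_zero, smul_zero, add_zero] at h1
    rw [← neg_sub, ← h1, ← sum_neg_distrib]
    refine sum_congr rfl fun k _ => ?_
    rw [neg_one_pow_smul, pow_succ, Nat.add_sub_cancel]
    ring
  · intro r hr
    rw [sumGeTwo_lieTwo, deg_plethysm_h_eq_zero _ hr, mul_zero]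

/-- The separately defined values `Δ_0 = 1` and `Δ_1 = p_1 - h_1 = 0` fit the formula, so the
recurrence for `Δ_n` is valid already at `n = 2`. -/
theorem delta_eq_geomSum (n : ℕ) : delta n = geomSum (p 1) (fun k => (-1 : ℂ) ^ k • h k) n := by
  rcases n with _ | _ | n
  · simp [delta, geomSum, h_zero]
  · have h1 := newton_h 0
    simp [h_zero] at h1
    simp [delta, geomSum, sum_range_succ, h_zero, h1]
  · rw [delta, finsum_deltaPiece _ (by omega), geomSum_signed_h]

section Hook

open scoped Classical

/-! ### The Schur function of the hook `(2, 1^{n-2})` -/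

theorem mem_hookTwo (k i j : ℕ) :
    (i, j) ∈ hookTwo (k + 2) ↔ (i = 0 ∧ j = 1) ∨ (i < k + 1 ∧ j = 0) := by
  rw [hookTwo, YoungDiagram.mem_ofRowLens]
  rcases i with _ | i
  · simp; omega
  · simp

theorem cells_hookTwo (k : ℕ) : (hookTwo (k + 2)).cells =
    insert (0, 1) ((range (k + 1)).image fun i => (i, 0)) := by
  ext ⟨i, j⟩
  rw [YoungDiagram.mem_cells, mem_hookTwo]
  simp only [mem_insert, Prod.mk.injEq, mem_image, mem_range]
  constructor
  · rintro (h | h)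
    · exact Or.inl h
    · exact Or.inr ⟨i, h.1, rfl, h.2.symm⟩
  · rintro (h | ⟨i', h1, rfl, h2⟩)
    · exact Or.inl h
    · exact Or.inr ⟨h1, h2.symm⟩

theorem card_cells_hookTwo_filter (k i : ℕ) (f : ℕ → ℕ → ℕ) :
    ((hookTwo (k + 2)).cells.filter fun c => f c.1 c.2 = i).card =
      (if f 0 1 = i then 1 else 0) + ((range (k + 1)).filter fun j => f j 0 = i).card := by
  have h1 : ((range (k + 1)).image fun i => (i, 0)).filter (fun c : ℕ × ℕ => f c.1 c.2 = i) =
      ((range (k + 1)).filter fun j => f j 0 = i).image fun i => (i, 0) := by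
    rw [filter_image]
  have h2 : (((range (k + 1)).filter fun j => f j 0 = i).image fun i => (i, 0)).card =
      ((range (k + 1)).filter fun j => f j 0 = i).card :=
    card_image_of_injective _ fun a b h => (Prod.ext_iff.1 h).1
  rw [cells_hookTwo, filter_insert, h1]
  split_ifs with h
  · rw [card_insert_of_notMem, h2, add_comm]
    simp
  · rw [h2, zero_add]

/-- The entries of the second column of a tableau of shape `(2, 1^k)` with content `m`. -/
def hookEntries (k : ℕ) (m : ℕ →₀ ℕ) : Finset ℕ :=
  m.support.filter fun s => (m - Finsupp.single s 1 : ℕ →₀ ℕ).degree = k + 1 ∧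
    ∀ i, (m - Finsupp.single s 1 : ℕ →₀ ℕ) i ≤ 1

/-- Adding `s` on top of the column with the remaining entries gives a longer column. -/
def IsBelow (m : ℕ →₀ ℕ) (s : ℕ) : Prop :=
  ∀ t ∈ (m - Finsupp.single s 1 : ℕ →₀ ℕ).support, s < t

theorem card_support_of_le_one {m : ℕ →₀ ℕ} (hm : ∀ i, m i ≤ 1) : m.support.card = m.degree := by
  rw [Finsupp.degree_apply, card_eq_sum_ones]
  refine sum_congr rfl fun i hi => ?_
  rw [Finsupp.mem_support_iff] at hi
  have := hm i
  omega

theorem coeff_p_one_mul_e (k : ℕ) (m : ℕ →₀ ℕ) :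
    MvPowerSeries.coeff m (p 1 * e (k + 1)) = ((hookEntries k m).card : ℂ) := by
  rw [coeff_p_mul 0, hookEntries, card_filter, Nat.cast_sum]
  refine sum_congr rfl fun s hs => ?_
  rw [Finsupp.mem_support_iff] at hs
  rw [if_pos (by omega), coeff_e]
  simp

/-- An `s` strictly below all remaining letters cannot recur among them, so `m` is squarefree and
`s` is its least letter; this choice is unique. -/
theorem card_hookEntries_lt (k : ℕ) (m : ℕ →₀ ℕ) :
    (((hookEntries k m).filter fun s => IsBelow m s).card : ℂ) =
      MvPowerSeries.coeff m (e (k + 2)) := by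
  rw [coeff_e]
  split_ifs with h
  · obtain ⟨hd, h1⟩ := h
    have hne : m.support.Nonempty := by
      rw [Finsupp.support_nonempty_iff]
      rintro rfl
      simp at hd
    have hmin := m.support.min'_mem hne
    rw [Finsupp.mem_support_iff] at hmin
    have hsub : ∀ s ∈ m.support, (m - Finsupp.single s 1 : ℕ →₀ ℕ).support = m.support.erase s := by
      intro s hs
      ext t
      have := h1 t
      rw [Finsupp.mem_support_iff, mem_erase, Finsupp.mem_support_iff, Finsupp.tsub_apply,
        Finsupp.single_apply]
      split_ifs with hst
      · subst hst; simp; omega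
      · simp [Ne.symm hst]
    rw [card_eq_one.2 ⟨m.support.min' hne, ?_⟩]
    · simp
    ext s
    rw [mem_filter, hookEntries, mem_filter, mem_singleton]
    constructor
    · rintro ⟨⟨hs, -⟩, hlt⟩
      rw [IsBelow, hsub s hs] at hlt
      refine le_antisymm ?_ (min'_le _ _ hs)
      by_contra hcon
      exact hcon (hlt _ (mem_erase.2 ⟨fun h => hcon h.ge, min'_mem _ _⟩)).le
    · rintro rfl
      refine ⟨⟨min'_mem _ _, ?_, fun i => ?_⟩, fun t ht => ?_⟩
      · have := degree_tsub_single (show 1 ≤ m (m.support.min' hne) by omega)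
        omega
      · exact (Nat.sub_le _ _).trans (h1 i)
      · rw [hsub _ (min'_mem _ _), mem_erase] at ht
        exact lt_of_le_of_ne (min'_le _ _ ht.2) (Ne.symm ht.1)
  · rw [card_eq_zero.2, Nat.cast_zero]
    rw [filter_eq_empty_iff]
    intro s hs hlt
    rw [hookEntries, mem_filter, Finsupp.mem_support_iff] at hs
    obtain ⟨hs, hd, h1⟩ := hs
    have := degree_tsub_single (show 1 ≤ m s by omega)
    refine h ⟨by omega, fun i => ?_⟩
    by_cases hi : i = s
    · subst hi
      by_contra hcon
      refine lt_irrefl i (hlt i ?_)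
      rw [Finsupp.mem_support_iff]
      simp
      omega
    · simpa [Finsupp.single_apply, Ne.symm hi] using h1 i

section Tableaux

variable {k : ℕ} {m : ℕ →₀ ℕ}

theorem column_lt (T : SemistandardYoungTableau (hookTwo (k + 2))) {i j : ℕ} (hij : i < j)
    (hj : j < k + 1) : T i 0 < T j 0 :=
  T.col_strict hij ((mem_hookTwo k j 0).2 (Or.inr ⟨hj, rfl⟩))

/-- The first column is strictly increasing, so after removal of the corner entry `T 0 1` each
letter is used at most once. -/
theorem tsub_single_apply_of_content (T : SemistandardYoungTableau (hookTwo (k + 2)))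
    (hT : ∀ i, ((hookTwo (k + 2)).cells.filter fun c => T c.1 c.2 = i).card = m i) (i : ℕ) :
    (m - Finsupp.single (T 0 1) 1 : ℕ →₀ ℕ) i = if i ∈ (range (k + 1)).image (fun j => T j 0) then 1 else 0 := by
  have h1 := hT i
  rw [card_cells_hookTwo_filter k i fun a b => T a b] at h1
  rw [Finsupp.tsub_apply, Finsupp.single_apply, ← h1, Nat.add_sub_cancel_left]
  split_ifs with h
  · rw [mem_image] at h
    obtain ⟨j, hj, rfl⟩ := h
    rw [card_eq_one]
    refine ⟨j, ?_⟩
    ext l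
    rw [mem_filter, mem_singleton]
    constructor
    · rintro ⟨hl, hlj⟩
      rw [mem_range] at hl hj
      rcases lt_trichotomy l j with h | h | h
      · exact absurd hlj (column_lt T h hj).ne
      · exact h
      · exact absurd hlj (column_lt T h hl).ne'
    · rintro rfl
      exact ⟨hj, rfl⟩
  · rw [card_eq_zero, filter_eq_empty_iff]
    intro j hj hji
    exact h (mem_image.2 ⟨j, hj, hji⟩)

theorem support_tsub_single_of_content (T : SemistandardYoungTableau (hookTwo (k + 2)))
    (hT : ∀ i, ((hookTwo (k + 2)).cells.filter fun c => T c.1 c.2 = i).card = m i) :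
    (m - Finsupp.single (T 0 1) 1 : ℕ →₀ ℕ).support = (range (k + 1)).image (fun j => T j 0) := by
  ext i
  rw [Finsupp.mem_support_iff, tsub_single_apply_of_content T hT]
  simp

theorem mem_hookEntries_of_content (T : SemistandardYoungTableau (hookTwo (k + 2)))
    (hT : ∀ i, ((hookTwo (k + 2)).cells.filter fun c => T c.1 c.2 = i).card = m i) :
    T 0 1 ∈ (hookEntries k m).filter
      fun s => ¬ IsBelow m s := by
  have h1 : ∀ i, (m - Finsupp.single (T 0 1) 1 : ℕ →₀ ℕ) i ≤ 1 := fun i => by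
    rw [tsub_single_apply_of_content T hT]; split_ifs <;> simp
  rw [mem_filter, hookEntries, mem_filter]
  refine ⟨⟨?_, ?_, h1⟩, ?_⟩
  · rw [Finsupp.mem_support_iff, ← hT, card_cells_hookTwo_filter k _ fun a b => T a b]
    simp
  · rw [← card_support_of_le_one h1, support_tsub_single_of_content T hT, card_image_of_injOn,
      card_range]
    intro a ha b hb hab
    rw [coe_range, Set.mem_Iio] at ha hb
    rcases lt_trichotomy a b with h | h | h
    · exact absurd hab (column_lt T h hb).ne
    · exact h
    · exact absurd hab (column_lt T h ha).ne'
  · intro hlt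
    rw [IsBelow, support_tsub_single_of_content T hT] at hlt
    have h2 := hlt (T 0 0) (mem_image.2 ⟨0, by simp, rfl⟩)
    have h3 : T 0 0 ≤ T 0 1 := T.row_weak one_pos ((mem_hookTwo k 0 1).2 (Or.inl ⟨rfl, rfl⟩))
    omega

/-- Given the content, the corner entry fixes the set of letters in the first column, and these can
be arranged increasingly in only one way. -/
theorem tableau_ext_of_content (T T' : SemistandardYoungTableau (hookTwo (k + 2)))
    (hT : ∀ i, ((hookTwo (k + 2)).cells.filter fun c => T c.1 c.2 = i).card = m i)
    (hT' : ∀ i, ((hookTwo (k + 2)).cells.filter fun c => T' c.1 c.2 = i).card = m i)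
    (h : T 0 1 = T' 0 1) : T = T' := by
  have himage : (range (k + 1)).image (fun j => T j 0) = (range (k + 1)).image (fun j => T' j 0) := by
    rw [← support_tsub_single_of_content T hT, ← support_tsub_single_of_content T' hT', h]
  have hcard : ((range (k + 1)).image (fun j => T j 0)).card = k + 1 := by
    have := mem_hookEntries_of_content T hT
    rw [mem_filter, hookEntries, mem_filter] at this
    rw [← support_tsub_single_of_content T hT, card_support_of_le_one this.1.2.2, this.1.2.1]
  have h1 := orderEmbOfFin_unique hcard (f := fun j : Fin (k + 1) => T j 0)
    (fun j => mem_image.2 ⟨j, mem_range.2 j.2, rfl⟩) fun a b hab => column_lt T hab b.2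
  have h2 := orderEmbOfFin_unique hcard (f := fun j : Fin (k + 1) => T' j 0)
    (fun j => himage ▸ mem_image.2 ⟨j, mem_range.2 j.2, rfl⟩) fun a b hab => column_lt T' hab b.2
  have h3 : ∀ j < k + 1, T j 0 = T' j 0 := fun j hj => congrFun (h1.trans h2.symm) ⟨j, hj⟩
  ext i j
  by_cases hij : (i, j) ∈ hookTwo (k + 2)
  · rcases (mem_hookTwo k i j).1 hij with ⟨rfl, rfl⟩ | ⟨hi, rfl⟩
    · exact h
    · exact h3 i hi
  · rw [T.zeros hij, T'.zeros hij]

theorem exists_tableau_of_mem_hookEntries {s : ℕ} (hs : s ∈ (hookEntries k m).filter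
      fun s => ¬ IsBelow m s) :
    ∃ T : SemistandardYoungTableau (hookTwo (k + 2)),
      (∀ i, ((hookTwo (k + 2)).cells.filter fun c => T c.1 c.2 = i).card = m i) ∧ T 0 1 = s := by
  rw [mem_filter, hookEntries, mem_filter, Finsupp.mem_support_iff] at hs
  obtain ⟨⟨hms, hd, h1⟩, h2⟩ := hs
  unfold IsBelow at h2
  push Not at h2
  obtain ⟨t, ht, hts⟩ := h2
  have hcard : (m - Finsupp.single s 1 : ℕ →₀ ℕ).support.card = k + 1 := by
    rw [card_support_of_le_one h1, hd]
  set c := (m - Finsupp.single s 1 : ℕ →₀ ℕ).support.orderEmbOfFin hcard with hc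
  have hc0 : c ⟨0, k.succ_pos⟩ ≤ s := by
    rw [hc, orderEmbOfFin_zero]
    exact (min'_le _ _ ht).trans hts
  set f : ℕ → ℕ → ℕ := fun i j => if h : i < k + 1 ∧ j = 0 then c ⟨i, h.1⟩ else
    if i = 0 ∧ j = 1 then s else 0 with hf
  have hf0 : ∀ i (hi : i < k + 1), f i 0 = c ⟨i, hi⟩ := fun i hi => dif_pos ⟨hi, rfl⟩
  have hf1 : f 0 1 = s := by simp [hf]
  refine ⟨⟨f, ?_, ?_, ?_⟩, ?_, hf1⟩
  · intro i j1 j2 hj hmem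
    rcases (mem_hookTwo k i j2).1 hmem with ⟨rfl, rfl⟩ | ⟨-, rfl⟩
    · obtain rfl : j1 = 0 := by omega
      rw [hf0 0 k.succ_pos, hf1]
      exact hc0
    · omega
  · intro i1 i2 j hi hmem
    rcases (mem_hookTwo k i2 j).1 hmem with ⟨rfl, -⟩ | ⟨hi2, rfl⟩
    · omega
    · rw [hf0 i1 (by omega), hf0 i2 hi2]
      exact c.strictMono hi
  · intro i j hmem
    rw [mem_hookTwo] at hmem
    push Not at hmem
    simp only [hf]
    rw [dif_neg (by tauto), if_neg (by tauto)]
  · intro i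
    change ((hookTwo (k + 2)).cells.filter fun c => f c.1 c.2 = i).card = m i
    rw [card_cells_hookTwo_filter, hf1]
    have h3 : ((range (k + 1)).filter fun j => f j 0 = i).card =
        (m - Finsupp.single s 1 : ℕ →₀ ℕ) i := by
      by_cases hi : i ∈ (m - Finsupp.single s 1 : ℕ →₀ ℕ).support
      · have hi' := hi
        rw [Finsupp.mem_support_iff] at hi'
        have := h1 i
        rw [show (m - Finsupp.single s 1 : ℕ →₀ ℕ) i = 1 by omega, card_eq_one]
        have hr : i ∈ Set.range c := by rw [hc, range_orderEmbOfFin]; exact hi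
        obtain ⟨⟨j, hj⟩, hji⟩ := hr
        refine ⟨j, ?_⟩
        ext l
        rw [mem_filter, mem_singleton, mem_range]
        constructor
        · rintro ⟨hl, hli⟩
          rw [hf0 l hl, ← hji] at hli
          exact congrArg Fin.val (c.injective hli)
        · rintro rfl
          exact ⟨hj, (hf0 l hj).trans hji⟩
      · rw [Finsupp.notMem_support_iff.1 hi, card_eq_zero, filter_eq_empty_iff]
        intro j hj hji
        rw [mem_range] at hj
        rw [hf0 j hj] at hji
        exact hi (hji ▸ orderEmbOfFin_mem _ hcard _)
    rw [h3, Finsupp.tsub_apply, Finsupp.single_apply]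
    split_ifs with hsi
    · subst hsi; omega
    · omega

end Tableaux

/-- A monomial of `p_1 e_{k+1}` amounts to a letter `s` and a strict column. Placing `s` to the
right of the top of the column gives a tableau unless `s` is smaller than the whole column, and
those exceptions are counted by `e_{k+2}`. -/
theorem schur_hookTwo (k : ℕ) : schur (hookTwo (k + 2)) = p 1 * e (k + 1) - e (k + 2) := by
  ext m
  rw [map_sub, coeff_p_one_mul_e, ← card_hookEntries_lt, ← card_filter_add_card_filter_not
    (s := hookEntries k m) fun s => IsBelow m s, Nat.cast_add,
    add_sub_cancel_left]
  change ((Nat.card {T : SemistandardYoungTableau (hookTwo (k + 2)) //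
    ∀ i, ((hookTwo (k + 2)).cells.filter fun c => T c.1 c.2 = i).card = m i} : ℕ) : ℂ) = _
  congr 1
  rw [← Nat.card_eq_finsetCard]
  refine Nat.card_congr (Equiv.ofBijective
    (fun T => ⟨T.1 0 1, mem_hookEntries_of_content T.1 T.2⟩) ⟨?_, ?_⟩)
  · intro T T' h
    exact Subtype.ext (tableau_ext_of_content T.1 T'.1 T.2 T'.2 (congrArg Subtype.val h))
  · rintro ⟨s, hs⟩
    obtain ⟨T, hT, hTs⟩ := exists_tableau_of_mem_hookEntries hs
    exact ⟨⟨T, hT⟩, Subtype.ext hTs⟩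

end Hook

/-! ### The Frobenius characteristic of the trivial representation -/

section Coloring

variable {α : Type*}

/-- The class of a point under a permutation: the orbits of `σ`. -/
abbrev Orbits (σ : Equiv.Perm α) : Type _ := Quotient (Equiv.Perm.SameCycle.setoid σ)

open Classical in
/-- The number of elements of an orbit. -/
def orbitCard [Fintype α] {σ : Equiv.Perm α} (q : Orbits σ) : ℕ :=
  (univ.filter fun x => (Quotient.mk _ x : Orbits σ) = q).card

theorem orbit_out_sameCycle {σ : Equiv.Perm α} (q : Orbits σ) (x : α) :
    (Quotient.mk _ x : Orbits σ) = q ↔ σ.SameCycle q.out x := by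
  constructor
  · rintro rfl
    exact Quotient.exact (Quotient.out_eq (Quotient.mk (Equiv.Perm.SameCycle.setoid σ) x))
  · intro h
    rw [← Quotient.out_eq q]
    exact (Quotient.sound h).symm

theorem orbitCard_of_mem [Fintype α] [DecidableEq α] {σ : Equiv.Perm α} (q : Orbits σ) (hq : q.out ∈ σ.support) :
    orbitCard q = (σ.cycleOf q.out).support.card := by
  classical
  rw [orbitCard]
  congr 1
  ext x
  rw [mem_filter, Equiv.Perm.mem_support_cycleOf_iff, orbit_out_sameCycle]
  simp only [mem_univ, true_and, hq, and_true]

theorem orbitCard_of_notMem [Fintype α] [DecidableEq α] {σ : Equiv.Perm α} (q : Orbits σ) (hq : q.out ∉ σ.support) :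
    orbitCard q = 1 := by
  classical
  rw [orbitCard, card_eq_one]
  refine ⟨q.out, ?_⟩
  rw [Equiv.Perm.notMem_support] at hq
  ext x
  rw [mem_filter, mem_singleton, orbit_out_sameCycle]
  simp only [mem_univ, true_and]
  constructor
  · rintro ⟨k, rfl⟩
    exact Equiv.Perm.zpow_apply_eq_self_of_apply_eq_self hq k
  · rintro rfl
    exact Equiv.Perm.SameCycle.refl _ _

theorem orbitCard_pos [Fintype α] {σ : Equiv.Perm α} (q : Orbits σ) : 0 < orbitCard q := by
  classical
  exact card_pos.2 ⟨q.out, by simp⟩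

/-- Treating fixed points as orbits of size 1 puts them on the same footing as the cycles, as needed
for counting invariant colorings. -/
theorem cyclePowerSum_eq_prod_orbits [Fintype α] [DecidableEq α] (σ : Equiv.Perm α) [Fintype (Orbits σ)] :
    cyclePowerSum σ = ∏ q : Orbits σ, p (orbitCard q) := by
  classical
  rw [cyclePowerSum, Equiv.Perm.parts_partition, Multiset.map_add, Multiset.prod_add,
    ← prod_filter_mul_prod_filter_not univ (fun q : Orbits σ => q.out ∈ σ.support)]
  congr 1
  · rw [Equiv.Perm.cycleType_def, Multiset.map_map]
    symm
    refine prod_bij (fun q _ => σ.cycleOf q.out) ?_ ?_ ?_ ?_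
    · intro q hq
      exact Equiv.Perm.cycleOf_mem_cycleFactorsFinset_iff.2 (mem_filter.1 hq).2
    · intro q hq q' hq' h
      have h1 : q'.out ∈ (σ.cycleOf q'.out).support :=
        Equiv.Perm.mem_support_cycleOf_iff.2 ⟨Equiv.Perm.SameCycle.refl _ _, (mem_filter.1 hq').2⟩
      rw [← h] at h1
      rw [← (orbit_out_sameCycle q q'.out).2 (Equiv.Perm.mem_support_cycleOf_iff.1 h1).1]
      exact Quotient.out_eq q'
    · intro c hc
      obtain ⟨x, hx⟩ := (Equiv.Perm.mem_cycleFactorsFinset_iff.1 hc).1.nonempty_support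
      have h1 : σ.SameCycle (Quotient.mk _ x : Orbits σ).out x := (orbit_out_sameCycle _ x).1 rfl
      have h2 := Equiv.Perm.cycle_is_cycleOf hx hc
      have h3 : x ∈ σ.support := Equiv.Perm.mem_cycleFactorsFinset_support_le hc hx
      refine ⟨Quotient.mk _ x, ?_, ?_⟩
      · rw [mem_filter]
        refine ⟨mem_univ _, ?_⟩
        rw [Equiv.Perm.mem_support, Ne, h1.apply_eq_self_iff, ← Ne, ← Equiv.Perm.mem_support]
        exact h3
      · rw [h2]; exact h1.cycleOf_eq
    · intro q hq
      rw [orbitCard_of_mem q (mem_filter.1 hq).2]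
      rfl
  · rw [Multiset.map_replicate, Multiset.prod_replicate, ← card_compl, ← prod_const]
    symm
    refine prod_bij (fun q _ => q.out) ?_ ?_ ?_ ?_
    · intro q hq
      exact mem_compl.2 (mem_filter.1 hq).2
    · intro q _ q' _ h
      exact Quotient.out_injective h
    · intro x hx
      have h1 : σ.SameCycle (Quotient.mk _ x : Orbits σ).out x := (orbit_out_sameCycle _ x).1 rfl
      rw [mem_compl, Equiv.Perm.notMem_support] at hx
      have h2 : (Quotient.mk _ x : Orbits σ).out = x := by
        obtain ⟨k, hk⟩ := h1.symm
        rw [← hk, Equiv.Perm.zpow_apply_eq_self_of_apply_eq_self hx k]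
      refine ⟨Quotient.mk _ x, ?_, h2⟩
      rw [mem_filter, h2, Equiv.Perm.notMem_support]
      exact ⟨mem_univ _, hx⟩
    · intro q hq
      rw [orbitCard_of_notMem q (mem_filter.1 hq).2]

/-- The content of a coloring by natural numbers. -/
def content {ι : Type*} [Fintype ι] (k : ι → ℕ) (f : ι → ℕ) : ℕ →₀ ℕ :=
  ∑ x, Finsupp.single (f x) (k x)

theorem coeff_prod_p {ι : Type*} [Fintype ι] (k : ι → ℕ) (hk : ∀ i, 0 < k i) (m : ℕ →₀ ℕ) :
    MvPowerSeries.coeff m (∏ i, p (k i)) = (Nat.card {g : ι → ℕ // content k g = m} : ℂ) := by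
  classical
  have h1 : ∀ i (l : ℕ →₀ ℕ), MvPowerSeries.coeff l (p (k i)) =
      if ∃ t, l = Finsupp.single t (k i) then 1 else 0 := by
    intro i l
    obtain ⟨j, hj⟩ : ∃ j, k i = j + 1 := ⟨k i - 1, by have := hk i; omega⟩
    rw [hj, coeff_p]
  rw [MvPowerSeries.coeff_prod]
  simp only [h1, prod_boole, mem_univ, forall_const]
  rw [sum_boole, ← Nat.card_eq_finsetCard]
  congr 1
  symm
  refine Nat.card_congr (Equiv.ofBijective
    (fun g => ⟨Finsupp.equivFunOnFinite.symm fun i => Finsupp.single (g.1 i) (k i), ?_⟩) ⟨?_, ?_⟩)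
  · rw [mem_filter, mem_finsuppAntidiag]
    exact ⟨⟨g.2, subset_univ _⟩, fun i => ⟨g.1 i, rfl⟩⟩
  · intro g g' h
    ext i
    have := DFunLike.congr_fun (congrArg Subtype.val h) i
    simp only [Finsupp.equivFunOnFinite_symm_apply_apply] at this
    exact (Finsupp.single_left_inj (hk i).ne').1 this
  · rintro ⟨l, hl⟩
    rw [mem_filter, mem_finsuppAntidiag] at hl
    obtain ⟨⟨hl1, -⟩, hl2⟩ := hl
    choose g hg using hl2
    refine ⟨⟨g, ?_⟩, ?_⟩
    · rw [← hl1, content]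
      exact sum_congr rfl fun i _ => (hg i).symm
    · ext1
      ext1 i
      exact (hg i).symm

/-- Colorings that are constant on the cycles of `σ` are colorings of the set of cycles. -/
def invariantColoringEquiv (σ : Equiv.Perm α) :
    (Orbits σ → ℕ) ≃ {f : α → ℕ // f ∘ σ = f} where
  toFun g := ⟨fun x => g (Quotient.mk _ x), by
    funext x
    exact congrArg g (Quotient.sound ⟨-1, by simp⟩)⟩
  invFun f := Quotient.lift f.1 fun x y hxy => by
    obtain ⟨k, rfl⟩ := hxy
    have h1 : ∀ x, f.1 (σ x) = f.1 x := congrFun f.2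
    have h2 : ∀ x, f.1 (σ⁻¹ x) = f.1 x := fun x => by rw [← h1 (σ⁻¹ x)]; simp
    induction k using Int.induction_on with
    | zero => rfl
    | succ k ih => rw [add_comm, zpow_add, Equiv.Perm.mul_apply, zpow_one, h1]; exact ih
    | pred k ih =>
      rw [sub_eq_add_neg, add_comm, zpow_add, Equiv.Perm.mul_apply, zpow_neg_one, h2]; exact ih
  left_inv g := by
    funext q
    induction q using Quotient.inductionOn with
    | h x => rfl
  right_inv f := rfl

theorem content_orbitCard [Fintype α] (σ : Equiv.Perm α) [Fintype (Orbits σ)] (g : Orbits σ → ℕ) :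
    content orbitCard g = content (fun _ => 1) (invariantColoringEquiv σ g).1 := by
  classical
  rw [content, content, ← sum_fiberwise_of_maps_to (s := univ) (t := univ)
    (g := fun x => (Quotient.mk _ x : Orbits σ)) fun _ _ => mem_univ _]
  refine sum_congr rfl fun q _ => ?_
  rw [sum_congr rfl (g := fun _ => Finsupp.single (g q) 1)]
  · rw [sum_const, Finsupp.smul_single, orbitCard]
    simp
  · intro x hx
    rw [← (mem_filter.1 hx).2]
    rfl

/-- Expanding the product amounts to choosing one variable for each cycle, that is, a coloring
constant on cycles. -/
theorem coeff_cyclePowerSum [Fintype α] [DecidableEq α] (σ : Equiv.Perm α) (m : ℕ →₀ ℕ) :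
    MvPowerSeries.coeff m (cyclePowerSum σ) =
      (Nat.card {f : α → ℕ // content (fun _ => 1) f = m ∧ f ∘ σ = f} : ℂ) := by
  classical
  have : Fintype (Orbits σ) := Fintype.ofFinite _
  rw [cyclePowerSum_eq_prod_orbits, coeff_prod_p _ orbitCard_pos]
  congr 1
  refine Nat.card_congr ⟨fun g => ⟨invariantColoringEquiv σ g.1, ?_, (invariantColoringEquiv σ g.1).2⟩,
    fun f => ⟨(invariantColoringEquiv σ).symm ⟨f.1, f.2.2⟩, ?_⟩, ?_, ?_⟩
  · rw [← content_orbitCard, g.2]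
  · rw [content_orbitCard, Equiv.apply_symm_apply, f.2.1]
  · intro g
    ext1
    simp
  · intro f
    ext1
    simp

end Coloring

theorem content_one_apply {α : Type*} [Fintype α] (f : α → ℕ) (i : ℕ) :
    content (fun _ => 1) f i = (univ.filter fun x => f x = i).card := by
  rw [content, Finsupp.finsetSum_apply, card_filter]
  simp only [Finsupp.single_apply]

theorem degree_content_one {α : Type*} [Fintype α] (f : α → ℕ) :
    (content (fun _ => 1) f).degree = Fintype.card α := by
  rw [content, map_sum]
  simp

theorem exists_content_one {α : Type*} [Fintype α] (m : ℕ →₀ ℕ) (hm : m.degree = Fintype.card α) :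
    ∃ f : α → ℕ, content (fun _ => 1) f = m := by
  classical
  have h1 : Fintype.card α = Fintype.card (Σ i : m.support, Fin (m i)) := by
    rw [← hm, Fintype.card_sigma, Finsupp.degree_apply]
    simp only [Fintype.card_fin]
    rw [← sum_coe_sort]
  let eqv := Fintype.equivOfCardEq h1
  refine ⟨fun x => (eqv x).1, ?_⟩
  have h2 : content (fun _ => 1) (fun x => ((eqv x).1 : ℕ)) =
      ∑ y : Σ i : m.support, Fin (m i), Finsupp.single (y.1 : ℕ) 1 :=
    Fintype.sum_equiv eqv _ _ fun _ => rfl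
  rw [h2, Fintype.sum_sigma]
  conv_rhs => rw [← Finsupp.sum_single m, Finsupp.sum, ← sum_coe_sort]
  refine sum_congr rfl fun i _ => ?_
  simp

theorem exists_perm_of_content_eq {α : Type*} [Fintype α] (f g : α → ℕ)
    (h : content (fun _ => 1) f = content (fun _ => 1) g) : ∃ τ : Equiv.Perm α, f ∘ τ = g := by
  classical
  have h1 : ∀ c, Nonempty ({a // g a = c} ≃ {b // f b = c}) := by
    intro c
    rw [← Fintype.card_eq, Fintype.card_subtype, Fintype.card_subtype, ← content_one_apply,
      ← content_one_apply, h]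
  have E := fun c => (h1 c).some
  exact ⟨Equiv.ofFiberEquiv E, funext fun a => Equiv.ofFiberEquiv_map E a⟩

/-- The complete homogeneous symmetric function is the Frobenius characteristic of the trivial
representation. -/
theorem sum_cyclePowerSum (α : Type*) [Fintype α] [DecidableEq α] :
    ∑ σ : Equiv.Perm α, cyclePowerSum σ =
      ((Fintype.card α).factorial : ℂ) • h (Fintype.card α) := by
  classical
  ext m
  rw [map_sum, MvPowerSeries.coeff_smul, coeff_h]
  simp only [coeff_cyclePowerSum]
  by_cases hm : m.degree = Fintype.card α
  · obtain ⟨f, hf⟩ := exists_content_one m hm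
    set C : Finset (α → ℕ) := univ.image fun τ : Equiv.Perm α => f ∘ τ with hC
    have hmem : ∀ g, content (fun _ => 1) g = m ↔ g ∈ C := by
      intro g
      constructor
      · intro hg
        obtain ⟨τ, hτ⟩ := exists_perm_of_content_eq f g (hf.trans hg.symm)
        exact mem_image.2 ⟨τ, mem_univ _, hτ⟩
      · intro hg
        obtain ⟨τ, -, rfl⟩ := mem_image.1 hg
        rw [← hf]
        exact Fintype.sum_equiv τ _ _ fun _ => rfl
    have h1 : ∀ σ : Equiv.Perm α, Nat.card {g : α → ℕ // content (fun _ => 1) g = m ∧ g ∘ σ = g} =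
        ∑ g ∈ C, if g ∘ σ = g then 1 else 0 := by
      intro σ
      rw [← card_filter, ← Nat.card_eq_finsetCard]
      refine Nat.card_congr (Equiv.subtypeEquivRight fun g => ?_)
      rw [mem_filter, hmem]
    -- Orbit counting: the symmetric group is transitive on colorings with content `m`, and left
    -- multiplication by `τ` carries the stabilizer of `g` to the permutations taking `f` to `g`.
    -- Summed over `g`, these exhaust the group.
    have h2 : ∀ g ∈ C, (∑ σ : Equiv.Perm α, if g ∘ σ = g then 1 else 0) =
        ∑ τ : Equiv.Perm α, if f ∘ τ = g then 1 else 0 := by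
      intro g hg
      obtain ⟨τ, -, rfl⟩ := mem_image.1 hg
      exact Fintype.sum_equiv (Equiv.mulLeft τ) _ _ fun σ => rfl
    rw [if_pos hm, mul_one, ← Nat.cast_sum, sum_congr rfl fun σ _ => h1 σ, sum_comm,
      sum_congr rfl h2, sum_comm]
    congr 1
    rw [sum_congr rfl (g := fun _ => 1)]
    · simp [Fintype.card_perm]
    · intro τ _
      rw [sum_ite_eq, if_pos (mem_image.2 ⟨τ, mem_univ _, rfl⟩)]
  · rw [if_neg hm, mul_zero]
    refine sum_eq_zero fun σ _ => ?_
    rw [Nat.cast_eq_zero, Nat.card_eq_zero]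
    left
    refine ⟨fun f => hm ?_⟩
    rw [← f.2.1, degree_content_one]

/-! ### The Frobenius characteristic of the chains on injective words -/

theorem cyclePowerSum_ofSubtype {α : Type*} [Fintype α] [DecidableEq α] (q : α → Prop)
    [DecidablePred q] (τ : Equiv.Perm (Subtype q)) :
    cyclePowerSum (Equiv.Perm.ofSubtype τ) =
      p 1 ^ (Fintype.card α - Fintype.card (Subtype q)) * cyclePowerSum τ := by
  have h1 : (Equiv.Perm.ofSubtype τ).support.card = τ.support.card := by
    rw [← Equiv.Perm.sum_cycleType, ← Equiv.Perm.sum_cycleType, Equiv.Perm.cycleType_ofSubtype]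
  have h2 := τ.support.card_le_univ
  have h3 : Fintype.card (Subtype q) ≤ Fintype.card α := Fintype.card_subtype_le q
  rw [cyclePowerSum, cyclePowerSum, Equiv.Perm.parts_partition, Equiv.Perm.parts_partition,
    Equiv.Perm.cycleType_ofSubtype, h1, Multiset.map_add, Multiset.prod_add, Multiset.map_add,
    Multiset.prod_add, Multiset.map_replicate, Multiset.prod_replicate, Multiset.map_replicate,
    Multiset.prod_replicate, mul_left_comm, ← pow_add]
  congr 2
  omega

theorem trans_eq_self_iff {α : Type*} {k : ℕ} (w : Fin k ↪ α) (σ : Equiv.Perm α) :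
    w.trans σ.toEmbedding = w ↔ ∀ a, ¬ a ∉ Set.range w → σ a = a := by
  constructor
  · intro h a ha
    obtain ⟨i, rfl⟩ := not_not.1 ha
    exact DFunLike.congr_fun h i
  · intro h
    ext i
    exact h _ (not_not.2 ⟨i, rfl⟩)

/-- The stabilizer of a word is the symmetric group of the unused letters, and the `k` letters of
the word are fixed points, contributing `p_1^k`. -/
theorem sum_cyclePowerSum_fixing {α : Type*} [Fintype α] [DecidableEq α] {k : ℕ} (w : Fin k ↪ α) :
    (∑ σ : Equiv.Perm α, if w.trans σ.toEmbedding = w then cyclePowerSum σ else 0) =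
      ((Fintype.card α - k).factorial : ℂ) • (p 1 ^ k * h (Fintype.card α - k)) := by
  classical
  have hk : k ≤ Fintype.card α := by simpa using Fintype.card_le_of_embedding w
  have hcard : Fintype.card {a // a ∉ Set.range w} = Fintype.card α - k := by
    rw [Fintype.card_subtype_compl]
    congr 1
    exact (Set.card_range_of_injective w.injective).trans (Fintype.card_fin k)
  simp only [trans_eq_self_iff]
  rw [← sum_filter]
  have h1 : ∑ τ : Equiv.Perm {a // a ∉ Set.range w}, cyclePowerSum (Equiv.Perm.ofSubtype τ) =
      ∑ σ : Equiv.Perm α with ∀ a, ¬ a ∉ Set.range w → σ a = a, cyclePowerSum σ := by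
    refine sum_bij (fun τ _ => Equiv.Perm.ofSubtype τ) ?_ ?_ ?_ fun _ _ => rfl
    · intro τ _
      rw [mem_filter]
      exact ⟨mem_univ _, fun a ha => Equiv.Perm.ofSubtype_apply_of_not_mem τ ha⟩
    · intro τ _ τ' _ hτ
      exact Equiv.Perm.ofSubtype_injective hτ
    · intro σ hσ
      obtain ⟨τ, hτ⟩ := (Equiv.Perm.subtypeEquivSubtypePerm fun a => a ∉ Set.range w).surjective
        ⟨σ, (mem_filter.1 hσ).2⟩
      exact ⟨τ, mem_univ _, congrArg Subtype.val hτ⟩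
  rw [← h1, sum_congr rfl fun τ _ => cyclePowerSum_ofSubtype _ τ, ← mul_sum, sum_cyclePowerSum,
    hcard, Nat.sub_sub_self hk, mul_smul_comm]

theorem trace_wordRep (α : Type) [Fintype α] [DecidableEq α] (k : ℕ) (σ : Equiv.Perm α) :
    LinearMap.trace ℂ _ (wordRep α k σ) =
      ((univ.filter fun w : Fin k ↪ α => w.trans σ.toEmbedding = w).card : ℂ) :=
  trace_eq_card_fixedPoints Finsupp.basisSingleOne _ _ fun w => by
    rw [Finsupp.coe_basisSingleOne]
    exact Finsupp.mapDomain_single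

/-- Count pairs of a word and a permutation fixing it: there are `n! / (n - k)!` words, and each
contributes `(n - k)! p_1^k h_{n-k}`. -/
theorem sum_trace_wordRep_smul (α : Type) [Fintype α] [DecidableEq α] (k : ℕ)
    (hk : k ≤ Fintype.card α) :
    ∑ σ : Equiv.Perm α, LinearMap.trace ℂ _ (wordRep α k σ) • cyclePowerSum σ =
      ((Fintype.card α).factorial : ℂ) • (p 1 ^ k * h (Fintype.card α - k)) := by
  have h1 : ∀ σ : Equiv.Perm α, LinearMap.trace ℂ _ (wordRep α k σ) • cyclePowerSum σ =
      ∑ w : Fin k ↪ α, if w.trans σ.toEmbedding = w then cyclePowerSum σ else 0 := by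
    intro σ
    rw [trace_wordRep, Nat.cast_smul_eq_nsmul, ← sum_filter, sum_const]
  rw [sum_congr rfl fun σ _ => h1 σ, sum_comm, sum_congr rfl fun w _ => sum_cyclePowerSum_fixing w,
    sum_const, card_univ, Fintype.card_embedding_eq, Fintype.card_fin, ← Nat.cast_smul_eq_nsmul ℂ,
    smul_smul, ← Nat.cast_mul, mul_comm, Nat.factorial_mul_descFactorial hk]

/-! ### Acyclicity of the complex of injective words -/

theorem exists_apply_eq_of_injOn {V : Type*} [AddCommGroup V] [Module ℂ V] (Z : Submodule ℂ V)
    [FiniteDimensional ℂ Z] (f : V →ₗ[ℂ] V) (hf : ∀ x ∈ Z, f x ∈ Z)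
    (hinj : ∀ x ∈ Z, f x = 0 → x = 0) {z : V} (hz : z ∈ Z) : ∃ y ∈ Z, f y = z := by
  have h1 : Function.Injective (f.restrict hf) := by
    rw [injective_iff_map_eq_zero]
    rintro ⟨x, hx⟩ hfx
    exact Subtype.ext (hinj x hx (congrArg Subtype.val hfx))
  obtain ⟨y, hy⟩ := LinearMap.injective_iff_surjective.1 h1 ⟨z, hz⟩
  exact ⟨y.1, y.2, congrArg Subtype.val hy⟩

section Lists

variable {α : Type*}

/-- Prepending a letter. -/
def prepend (a : α) : (List α →₀ ℂ) →ₗ[ℂ] (List α →₀ ℂ) :=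
  Finsupp.lmapDomain ℂ ℂ (List.cons a)

theorem prepend_single (a : α) (w : List α) (c : ℂ) :
    prepend a (Finsupp.single w c) = Finsupp.single (a :: w) c := Finsupp.mapDomain_single

/-- Combinations of words satisfying a predicate. -/
abbrev wordsWith (P : List α → Prop) : Submodule ℂ (List α →₀ ℂ) :=
  Finsupp.supported ℂ ℂ {w | P w}

theorem map_mem_of_single {P : List α → Prop} {N : Submodule ℂ (List α →₀ ℂ)}
    (f : (List α →₀ ℂ) →ₗ[ℂ] (List α →₀ ℂ)) (hf : ∀ w, P w → f (Finsupp.single w 1) ∈ N)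
    {x : List α →₀ ℂ} (hx : x ∈ wordsWith P) : f x ∈ N := by
  have : wordsWith P ≤ N.comap f := by
    rw [wordsWith, Finsupp.supported_eq_span_single, Submodule.span_le]
    rintro _ ⟨w, hw, rfl⟩
    exact hf w hw
  exact this hx

theorem single_mem_wordsWith {P : List α → Prop} {w : List α} (hw : P w) (c : ℂ) :
    Finsupp.single w c ∈ wordsWith P := Finsupp.single_mem_supported ℂ c hw

variable [DecidableEq α]

/-- The alternating sum of the words obtained from a word by deleting one occurrence of `b`. -/
def deleteWord (b : α) : List α → (List α →₀ ℂ)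
  | [] => 0
  | a :: w => (if a = b then Finsupp.single w 1 else 0) - prepend a (deleteWord b w)

/-- The linear extension of `deleteWord b`. -/
def deleteLetter (b : α) : (List α →₀ ℂ) →ₗ[ℂ] (List α →₀ ℂ) :=
  Finsupp.linearCombination ℂ (deleteWord b)

theorem deleteLetter_single (b : α) (w : List α) (c : ℂ) :
    deleteLetter b (Finsupp.single w c) = c • deleteWord b w :=
  Finsupp.linearCombination_single _ _ _

theorem deleteLetter_prepend (a b : α) (x : List α →₀ ℂ) :
    deleteLetter b (prepend a x) = (if a = b then x else 0) - prepend a (deleteLetter b x) := by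
  induction x using Finsupp.induction_linear with
  | zero => simp
  | add x y hx hy =>
    rw [map_add, map_add, hx, hy, map_add, map_add]
    split_ifs <;> abel
  | single w c =>
    rw [prepend_single, deleteLetter_single, deleteLetter_single, deleteWord, map_smul, smul_sub]
    congr 1
    split_ifs <;> simp

/-- Deleting an earlier letter shifts the position of a later one by one, which flips its sign.
Summed over all letters this gives `∂² = 0`. -/
theorem deleteLetter_comm (a b : α) (x : List α →₀ ℂ) :
    deleteLetter b (deleteLetter a x) = -deleteLetter a (deleteLetter b x) := by
  induction x using Finsupp.induction_linear with
  | zero => simp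
  | add x y hx hy => rw [map_add, map_add, hx, hy, map_add, map_add, neg_add]
  | single w c =>
    rw [deleteLetter_single, deleteLetter_single, map_smul, map_smul, ← smul_neg]
    congr 1
    induction w with
    | nil => simp [deleteWord]
    | cons d w ih =>
      rw [deleteWord, deleteWord, map_sub, map_sub, deleteLetter_prepend, deleteLetter_prepend, ih,
        map_neg]
      split_ifs <;> (simp [deleteLetter_single]; try abel)

theorem deleteWord_of_nodup (b : α) (w : List α) (hw : w.Nodup) :
    (b ∉ w → deleteWord b w = 0) ∧ ∃ c : ℂ, deleteWord b w = c • Finsupp.single (w.erase b) 1 := by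
  induction w with
  | nil => exact ⟨fun _ => rfl, 0, by simp [deleteWord]⟩
  | cons a w ih =>
    rw [List.nodup_cons] at hw
    obtain ⟨h1, c, h2⟩ := ih hw.2
    constructor
    · intro hb
      rw [List.mem_cons, not_or] at hb
      rw [deleteWord, if_neg (Ne.symm hb.1), h1 hb.2, map_zero, sub_zero]
    · by_cases hab : a = b
      · subst hab
        exact ⟨1, by rw [deleteWord, h1 hw.1]; simp⟩
      · refine ⟨-c, ?_⟩
        rw [deleteWord, if_neg hab, h2, map_smul, prepend_single, zero_sub, neg_smul,
          List.erase_cons_tail (by simpa using hab)]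

theorem deleteWord_mem (b : α) (w : List α) (r : ℕ) (hw : w.length = r + 1) :
    deleteWord b w ∈ wordsWith fun w : List α => w.length = r := by
  induction w generalizing r with
  | nil => simp at hw
  | cons a w ih =>
    rw [List.length_cons] at hw
    rw [deleteWord]
    refine sub_mem ?_ ?_
    · split_ifs
      · exact single_mem_wordsWith (by omega) _
      · exact zero_mem _
    · rcases r with _ | r
      · obtain rfl : w = [] := List.eq_nil_of_length_eq_zero (by omega)
        simp [deleteWord]
      · refine map_mem_of_single (prepend a) (fun v hv => ?_) (ih r (by omega))
        rw [prepend_single]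
        exact single_mem_wordsWith (by simp [hv]) _

variable [Fintype α]

/-- The signed operator moving each letter of a word to the front. -/
def moveToFront : (List α →₀ ℂ) →ₗ[ℂ] (List α →₀ ℂ) := ∑ a, prepend a ∘ₗ deleteLetter a

theorem moveToFront_apply (x : List α →₀ ℂ) :
    moveToFront x = ∑ a, prepend a (deleteLetter a x) := by
  simp [moveToFront]

theorem deleteLetter_moveToFront (b : α) (x : List α →₀ ℂ) :
    deleteLetter b (moveToFront x) = deleteLetter b x + moveToFront (deleteLetter b x) := by
  have h1 : ∀ a, deleteLetter b (prepend a (deleteLetter a x)) =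
      (if a = b then deleteLetter a x else 0) + prepend a (deleteLetter a (deleteLetter b x)) := by
    intro a
    rw [deleteLetter_prepend, deleteLetter_comm a b, map_neg, sub_neg_eq_add]
  rw [moveToFront_apply, moveToFront_apply, map_sum, sum_congr rfl fun a _ => h1 a,
    sum_add_distrib]
  simp

/-- By `deleteLetter_moveToFront`, deleting a letter sends the eigenvalue `-c` to `-(c + 1)` and
shortens the words. By induction all deletions of `x` vanish, so `moveToFront x = 0`, which forces
`x = 0` as `c ≠ 0`. -/
theorem eq_zero_of_moveToFront_eq (r : ℕ) (c : ℕ) (hc : 0 < c) {x : List α →₀ ℂ}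
    (hx : x ∈ wordsWith fun w : List α => w.length = r)
    (h : moveToFront x = -((c : ℂ) • x)) : x = 0 := by
  have hc0 : (c : ℂ) ≠ 0 := by exact_mod_cast hc.ne'
  have key : (∀ b, deleteLetter b x = 0) → x = 0 := by
    intro h0
    rw [moveToFront_apply] at h
    simp only [h0, map_zero, sum_const_zero] at h
    have := neg_eq_zero.1 h.symm
    exact (smul_eq_zero.1 this).resolve_left hc0
  induction r generalizing x c with
  | zero =>
    refine key fun b => ?_
    have : deleteLetter b x ∈ (⊥ : Submodule ℂ (List α →₀ ℂ)) :=
      map_mem_of_single (deleteLetter b) (fun w hw => by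
        obtain rfl : w = [] := List.eq_nil_of_length_eq_zero hw
        simp [deleteLetter_single, deleteWord]) hx
    simpa using this
  | succ r ih =>
    refine key fun b => ?_
    have h1 : moveToFront (deleteLetter b x) = -(((c + 1 : ℕ) : ℂ) • deleteLetter b x) := by
      have h2 := deleteLetter_moveToFront b x
      rw [h, map_neg, map_smul] at h2
      rw [Nat.cast_add, Nat.cast_one, add_smul, one_smul, neg_add, h2]
      abel
    have h3 : deleteLetter b x ∈ wordsWith fun w : List α => w.length = r :=
      map_mem_of_single (deleteLetter b) (fun w hw => by
        rw [deleteLetter_single, one_smul]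
        exact deleteWord_mem b w r hw) hx
    have hc1 : ((c + 1 : ℕ) : ℂ) ≠ 0 := by exact_mod_cast c.succ_ne_zero
    -- The induction hypothesis carries the reduction `key` as an assumption, which is checked again
    -- for the shortened element.
    refine ih (c + 1) c.succ_pos h3 h1 hc1 fun h0 => ?_
    rw [moveToFront_apply] at h1
    simp only [h0, map_zero, sum_const_zero] at h1
    exact (smul_eq_zero.1 (neg_eq_zero.1 h1.symm)).resolve_left hc1

/-- The boundary map on all words. -/
def listBoundary : (List α →₀ ℂ) →ₗ[ℂ] (List α →₀ ℂ) := ∑ a, deleteLetter a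

theorem listBoundary_apply (x : List α →₀ ℂ) : listBoundary x = ∑ a, deleteLetter a x := by
  simp [listBoundary]

theorem listBoundary_listBoundary (x : List α →₀ ℂ) : listBoundary (listBoundary x) = 0 := by
  have h1 : listBoundary (listBoundary x) = -listBoundary (listBoundary x) := by
    simp only [listBoundary_apply, map_sum]
    conv_rhs => rw [sum_comm]
    simp only [← sum_neg_distrib, ← deleteLetter_comm]
  exact self_eq_neg.1 h1

theorem listBoundary_prepend (a : α) (x : List α →₀ ℂ) :
    listBoundary (prepend a x) = x - prepend a (listBoundary x) := by
  simp only [listBoundary_apply, deleteLetter_prepend, sum_sub_distrib, map_sum]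
  simp

/-- The sum of the words obtained by prepending a letter that does not occur. -/
def prependNew : (List α →₀ ℂ) →ₗ[ℂ] (List α →₀ ℂ) :=
  Finsupp.linearCombination ℂ fun w => ∑ a, if a ∈ w then 0 else Finsupp.single (a :: w) 1

theorem prependNew_single (w : List α) : prependNew (Finsupp.single w 1) =
    ∑ a, if a ∈ w then 0 else Finsupp.single (a :: w) 1 := by
  rw [prependNew, Finsupp.linearCombination_single, one_smul]

/-- After `b` is deleted it counts as new again; that extra letter produces the second term. -/
theorem prependNew_deleteWord (b : α) (w : List α) (hw : w.Nodup) :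
    prependNew (deleteWord b w) = (∑ a, if a ∈ w then 0 else prepend a (deleteWord b w)) +
      prepend b (deleteWord b w) := by
  obtain ⟨h1, c, h2⟩ := deleteWord_of_nodup b w hw
  by_cases hb : b ∈ w
  · rw [h2, map_smul, prependNew_single, ← add_sum_erase univ _ (mem_univ b),
      ← add_sum_erase univ (fun a => if a ∈ w then 0 else _) (mem_univ b), if_pos hb, zero_add,
      if_neg hw.not_mem_erase, add_comm, smul_add, map_smul, prepend_single, smul_sum]
    congr 1
    refine sum_congr rfl fun a ha => ?_
    simp only [List.mem_erase_of_ne (mem_erase.1 ha).1, map_smul, prepend_single]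
    split_ifs <;> simp
  · simp [h1 hb]

/-- For each new letter `a`, `∂(a w) = w - a ∂w`, and there are `n - r` new letters for a word of
length `r`. The terms `a ∂w` cancel against `N∂`, except that `N∂` may also put the deleted letter
back in front: this is `moveToFront`. -/
theorem homotopy (w : List α) (hw : w.Nodup) :
    listBoundary (prependNew (Finsupp.single w 1)) + prependNew (listBoundary (Finsupp.single w 1)) =
      ((Fintype.card α - w.length : ℕ) : ℂ) • Finsupp.single w 1 +
        moveToFront (Finsupp.single w 1) := by
  have h1 : listBoundary (Finsupp.single w (1 : ℂ)) = ∑ b, deleteWord b w := by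
    simp [listBoundary_apply, deleteLetter_single]
  have h2 : ∑ a, (if a ∈ w then 0 else Finsupp.single w (1 : ℂ)) =
      ((Fintype.card α - w.length : ℕ) : ℂ) • Finsupp.single w 1 := by
    rw [← List.toFinset_card_of_nodup hw, ← card_compl, Nat.cast_smul_eq_nsmul, ← sum_const]
    simp only [← ite_not (_ ∈ w)]
    rw [← sum_filter]
    refine sum_congr ?_ fun _ _ => rfl
    ext a
    simp
  have h3 : listBoundary (prependNew (Finsupp.single w 1)) =
      (∑ a, (if a ∈ w then 0 else Finsupp.single w (1 : ℂ))) -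
        ∑ b, ∑ a, if a ∈ w then 0 else prepend a (deleteWord b w) := by
    rw [prependNew_single, map_sum, sum_comm, ← sum_sub_distrib]
    refine sum_congr rfl fun a _ => ?_
    split_ifs
    · simp
    · rw [← prepend_single, listBoundary_prepend, h1, map_sum]
  rw [h3, h2, h1, map_sum, sum_congr rfl fun b _ => prependNew_deleteWord b w hw, sum_add_distrib,
    moveToFront_apply]
  simp only [deleteLetter_single, one_smul]
  abel

/-- Combinations of injective words of length `r`. -/
abbrev injWords (α : Type*) (r : ℕ) : Submodule ℂ (List α →₀ ℂ) :=
  Finsupp.supported ℂ ℂ {w | w.Nodup ∧ w.length = r}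

theorem listBoundary_mem {r : ℕ} {x : List α →₀ ℂ} (hx : x ∈ injWords α (r + 1)) :
    listBoundary x ∈ injWords α r := by
  refine map_mem_of_single listBoundary (P := fun w => w.Nodup ∧ w.length = r + 1)
    (fun w hw => ?_) hx
  rw [listBoundary_apply]
  refine sum_mem fun b _ => ?_
  rw [deleteLetter_single, one_smul]
  obtain ⟨h1, c, h2⟩ := deleteWord_of_nodup b w hw.1
  by_cases hb : b ∈ w
  · rw [h2]
    refine Submodule.smul_mem _ _ (Finsupp.single_mem_supported ℂ 1 ⟨hw.1.erase b, ?_⟩)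
    rw [List.length_erase_of_mem hb, hw.2, Nat.add_sub_cancel]
  · rw [h1 hb]; exact zero_mem _

theorem prependNew_mem {r : ℕ} {x : List α →₀ ℂ} (hx : x ∈ injWords α r) :
    prependNew x ∈ injWords α (r + 1) := by
  refine map_mem_of_single prependNew (P := fun w => w.Nodup ∧ w.length = r) (fun w hw => ?_) hx
  rw [prependNew_single]
  refine sum_mem fun a _ => ?_
  split_ifs with ha
  · exact zero_mem _
  · exact Finsupp.single_mem_supported ℂ 1 ⟨List.nodup_cons.2 ⟨ha, hw.1⟩, by simp [hw.2]⟩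

theorem homotopy_of_mem {r : ℕ} {x : List α →₀ ℂ} (hx : x ∈ injWords α r) :
    listBoundary (prependNew x) + prependNew (listBoundary x) =
      ((Fintype.card α - r : ℕ) : ℂ) • x + moveToFront x := by
  have h1 : (listBoundary ∘ₗ prependNew + prependNew ∘ₗ listBoundary -
      (((Fintype.card α - r : ℕ) : ℂ) • LinearMap.id + moveToFront) : (List α →₀ ℂ) →ₗ[ℂ] (List α →₀ ℂ)) x ∈
      (⊥ : Submodule ℂ (List α →₀ ℂ)) := by
    refine map_mem_of_single _ (P := fun w => w.Nodup ∧ w.length = r) (fun w hw => ?_) hx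
    have := homotopy w hw.1
    rw [hw.2] at this
    simp [this]
  simpa [sub_eq_zero] using h1

/-- The complex of injective words is acyclic below the top degree. -/
theorem exists_listBoundary_eq {r : ℕ} (hr : r < Fintype.card α) {z : List α →₀ ℂ}
    (hz : z ∈ injWords α r) (hz0 : listBoundary z = 0) :
    ∃ y ∈ injWords α (r + 1), listBoundary y = z := by
  have hfin : Finite {w : List α | w.Nodup ∧ w.length = r} :=
    ((List.finite_length_eq α r).subset fun w hw => hw.2).to_subtype
  have hfd : FiniteDimensional ℂ (injWords α r) :=
    Module.Finite.equiv (Finsupp.supportedEquivFinsupp _).symm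
  set Z : Submodule ℂ (List α →₀ ℂ) := injWords α r ⊓ LinearMap.ker listBoundary with hZ
  have hZfd : FiniteDimensional ℂ Z := Submodule.finiteDimensional_inf_left _ _
  -- For a cycle killed by `∂N` the homotopy gives eigenvalue `-(n - r)` of `moveToFront`, which is
  -- negative because `r < n`.
  have hinj : ∀ x ∈ Z, (listBoundary ∘ₗ prependNew) x = 0 → x = 0 := by
    intro x hx hfx
    have h1 : listBoundary (prependNew x) = 0 := hfx
    have h2 := homotopy_of_mem hx.1
    rw [h1, LinearMap.mem_ker.1 hx.2, map_zero, add_zero] at h2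
    refine eq_zero_of_moveToFront_eq r (Fintype.card α - r) (by omega) ?_
      (eq_neg_of_add_eq_zero_right h2.symm)
    exact Finsupp.supported_mono (fun w hw => hw.2) hx.1
  obtain ⟨y, hy, hyz⟩ := exists_apply_eq_of_injOn Z (listBoundary ∘ₗ prependNew) (fun x hx =>
    ⟨listBoundary_mem (prependNew_mem hx.1), listBoundary_listBoundary _⟩) hinj ⟨hz, hz0⟩
  exact ⟨prependNew y, prependNew_mem hy.1, hyz⟩

end Lists

/-! ### Transfer from lists to injective words as embeddings. -/

section Exactness

variable {α : Type}

/-- Injective words as lists. -/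
def wordsToLists (α : Type) (r : ℕ) : ((Fin r ↪ α) →₀ ℂ) →ₗ[ℂ] (List α →₀ ℂ) :=
  Finsupp.lmapDomain ℂ ℂ fun w => List.ofFn w

theorem wordsToLists_single (r : ℕ) (w : Fin r ↪ α) (c : ℂ) :
    wordsToLists α r (Finsupp.single w c) = Finsupp.single (List.ofFn w) c :=
  Finsupp.mapDomain_single

theorem wordsToLists_injective (r : ℕ) : Function.Injective (wordsToLists α r) :=
  Finsupp.mapDomain_injective fun _ _ h => DFunLike.coe_injective (List.ofFn_injective h)

theorem range_wordsToLists (r : ℕ) : LinearMap.range (wordsToLists α r) = injWords α r := by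
  have h1 := Finsupp.lmapDomain_supported (M := ℂ) (R := ℂ) (fun w : Fin r ↪ α => List.ofFn w)
    Set.univ
  rw [Finsupp.supported_univ, Submodule.map_top] at h1
  rw [wordsToLists, h1, injWords]
  congr 1
  ext l
  simp only [Set.image_univ, Set.mem_range, Set.mem_ofPred_eq]
  constructor
  · rintro ⟨w, rfl⟩
    exact ⟨List.nodup_ofFn.2 w.injective, List.length_ofFn⟩
  · rintro ⟨hl, rfl⟩
    exact ⟨⟨l.get, List.nodup_iff_injective_get.1 hl⟩, List.ofFn_get l⟩

variable [Fintype α] [DecidableEq α]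

/-- Peeling off the first letter by `listBoundary_prepend` yields the face `i = 0`, and the minus
sign there shifts the exponents of the other faces by one. -/
theorem listBoundary_single_ofFn (r : ℕ) (w : Fin (r + 1) → α) :
    listBoundary (Finsupp.single (List.ofFn w) 1) =
      ∑ i : Fin (r + 1), (-1 : ℂ) ^ (i : ℕ) • Finsupp.single (List.ofFn (w ∘ i.succAbove)) 1 := by
  induction r with
  | zero =>
    rw [List.ofFn_succ, ← prepend_single, listBoundary_prepend]
    simp [listBoundary_apply, deleteLetter_single, deleteWord]
  | succ r ih =>
    rw [Fin.sum_univ_succ, List.ofFn_succ, ← prepend_single, listBoundary_prepend, ih,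
      sub_eq_add_neg, map_sum, ← sum_neg_distrib]
    congr 1
    · simp only [Fin.val_zero, pow_zero, one_smul, Fin.succAbove_zero]
      rfl
    · refine sum_congr rfl fun i _ => ?_
      rw [map_smul, prepend_single, ← neg_smul, Fin.val_succ, pow_succ, mul_neg_one]
      congr 2
      rw [List.ofFn_succ]
      simp [Function.comp_def]

theorem wordsToLists_wordBoundary (r : ℕ) (x : (Fin (r + 1) ↪ α) →₀ ℂ) :
    wordsToLists α r (wordBoundary α r x) = listBoundary (wordsToLists α (r + 1) x) := by
  have : wordsToLists α r ∘ₗ wordBoundary α r = listBoundary ∘ₗ wordsToLists α (r + 1) := by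
    ext1 w
    ext1
    simp only [LinearMap.comp_apply, Finsupp.lsingle_apply, wordsToLists_single,
      listBoundary_single_ofFn, wordBoundary, Finsupp.linearCombination_single, one_smul, map_sum,
      map_smul]
    rfl
  exact LinearMap.congr_fun this x

theorem wordBoundary_wordBoundary (r : ℕ) (x : (Fin (r + 2) ↪ α) →₀ ℂ) :
    wordBoundary α r (wordBoundary α (r + 1) x) = 0 := by
  apply wordsToLists_injective r
  rw [wordsToLists_wordBoundary, wordsToLists_wordBoundary, listBoundary_listBoundary, map_zero]

theorem exists_wordBoundary_of_listBoundary {r : ℕ} (hr : r < Fintype.card α)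
    (x : (Fin r ↪ α) →₀ ℂ) (hx : listBoundary (wordsToLists α r x) = 0) :
    ∃ y, wordBoundary α r y = x := by
  have hmem : wordsToLists α r x ∈ injWords α r :=
    range_wordsToLists (α := α) r ▸ LinearMap.mem_range_self _ _
  obtain ⟨y, hy, hyx⟩ := exists_listBoundary_eq hr hmem hx
  rw [← range_wordsToLists] at hy
  obtain ⟨y', rfl⟩ := hy
  refine ⟨y', wordsToLists_injective r ?_⟩
  rw [wordsToLists_wordBoundary, hyx]

theorem exists_wordBoundary_eq {r : ℕ} (hr : r + 1 < Fintype.card α) (x : (Fin (r + 1) ↪ α) →₀ ℂ)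
    (hx : wordBoundary α r x = 0) : ∃ y, wordBoundary α (r + 1) y = x :=
  exists_wordBoundary_of_listBoundary hr x (by rw [← wordsToLists_wordBoundary, hx, map_zero])

theorem wordBoundary_zero_surjective (hα : 0 < Fintype.card α) :
    Function.Surjective (wordBoundary α 0) := by
  intro x
  refine exists_wordBoundary_of_listBoundary hα x ?_
  have h1 : listBoundary ∘ₗ wordsToLists α 0 = 0 := by
    ext1 w
    ext1
    simp [wordsToLists_single, listBoundary_apply, deleteLetter_single, deleteWord]
  exact LinearMap.congr_fun h1 x

end Exactness

/-! ### The character of the top homology -/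

/-- A linear splitting suffices, with no equivariance: the identity of `V` is written as `i ∘ P + s
∘ f`, and cyclicity of the trace moves each part to `K` or `W`. -/
theorem trace_of_exact {K V W : Type*} [AddCommGroup K] [Module ℂ K] [AddCommGroup V] [Module ℂ V]
    [AddCommGroup W] [Module ℂ W] [FiniteDimensional ℂ K] [FiniteDimensional ℂ V]
    [FiniteDimensional ℂ W] (i : K →ₗ[ℂ] V) (f : V →ₗ[ℂ] W) (hi : Function.Injective i)
    (hf : Function.Surjective f) (hif : ∀ v, f v = 0 ↔ ∃ k, i k = v) (TK : K →ₗ[ℂ] K)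
    (TV : V →ₗ[ℂ] V) (TW : W →ₗ[ℂ] W) (hK : ∀ k, i (TK k) = TV (i k))
    (hW : ∀ v, f (TV v) = TW (f v)) :
    LinearMap.trace ℂ V TV = LinearMap.trace ℂ K TK + LinearMap.trace ℂ W TW := by
  obtain ⟨s, hs⟩ := f.exists_rightInverse_of_surjective (LinearMap.range_eq_top.2 hf)
  obtain ⟨q, hq⟩ := i.exists_leftInverse_of_injective (LinearMap.ker_eq_bot.2 hi)
  have hs' : ∀ w, f (s w) = w := LinearMap.congr_fun hs
  have hq' : ∀ k, q (i k) = k := LinearMap.congr_fun hq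
  have hfi : ∀ k, f (i k) = 0 := fun k => (hif _).2 ⟨k, rfl⟩
  set P : V →ₗ[ℂ] K := q ∘ₗ (LinearMap.id - s ∘ₗ f) with hP
  have h1 : i ∘ₗ P + s ∘ₗ f = LinearMap.id := by
    ext v
    obtain ⟨k, hk⟩ := (hif (v - s (f v))).1 (by rw [map_sub, hs', sub_self])
    simp [hP, ← hk, hq']
    rw [hk, sub_add_cancel]
  have h2 : P ∘ₗ (TV ∘ₗ i) = TK := by
    ext k
    simp [hP, ← hK, hfi, hq']
  have h3 : f ∘ₗ (TV ∘ₗ s) = TW := by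
    ext w
    simp [hW, hs']
  calc LinearMap.trace ℂ V TV = LinearMap.trace ℂ V (TV ∘ₗ (i ∘ₗ P + s ∘ₗ f)) := by
        rw [h1, LinearMap.comp_id]
    _ = LinearMap.trace ℂ V ((TV ∘ₗ i) ∘ₗ P) + LinearMap.trace ℂ V ((TV ∘ₗ s) ∘ₗ f) := by
        rw [LinearMap.comp_add, map_add, LinearMap.comp_assoc, LinearMap.comp_assoc]
    _ = _ := by
        rw [LinearMap.trace_comp_comm', LinearMap.trace_comp_comm' _ (TV ∘ₗ s), h2, h3]

section Trace

variable (α : Type) [Fintype α] [DecidableEq α]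

/-- The action on the cycles of the complex of injective words. -/
def cycleRep (r : ℕ) (σ : Equiv.Perm α) :
    LinearMap.ker (wordBoundary α r) →ₗ[ℂ] LinearMap.ker (wordBoundary α r) :=
  (wordRep α (r + 1) σ).restrict fun x hx => by
    rw [LinearMap.mem_ker] at hx ⊢
    rw [wordBoundary_comm, hx, map_zero]

theorem trace_cycleRep_zero (hα : 0 < Fintype.card α) (σ : Equiv.Perm α) :
    LinearMap.trace ℂ _ (wordRep α 1 σ) =
      LinearMap.trace ℂ _ (cycleRep α 0 σ) + LinearMap.trace ℂ _ (wordRep α 0 σ) :=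
  trace_of_exact (K := LinearMap.ker (wordBoundary α 0)) (V := (Fin 1 ↪ α) →₀ ℂ)
    (W := (Fin 0 ↪ α) →₀ ℂ) (LinearMap.ker (wordBoundary α 0)).subtype (wordBoundary α 0)
    Subtype.val_injective (wordBoundary_zero_surjective hα)
    (fun v => ⟨fun hv => ⟨⟨v, hv⟩, rfl⟩, by rintro ⟨k, rfl⟩; exact k.2⟩) (cycleRep α 0 σ)
    (wordRep α 1 σ) (wordRep α 0 σ) (fun _ => rfl) fun v => wordBoundary_comm α 0 σ v

theorem trace_cycleRep_succ (r : ℕ) (hr : r + 1 < Fintype.card α) (σ : Equiv.Perm α) :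
    LinearMap.trace ℂ _ (wordRep α (r + 2) σ) =
      LinearMap.trace ℂ _ (cycleRep α (r + 1) σ) + LinearMap.trace ℂ _ (cycleRep α r σ) :=
  trace_of_exact (K := LinearMap.ker (wordBoundary α (r + 1))) (V := (Fin (r + 2) ↪ α) →₀ ℂ)
    (W := LinearMap.ker (wordBoundary α r)) (LinearMap.ker (wordBoundary α (r + 1))).subtype
    ((wordBoundary α (r + 1)).codRestrict (LinearMap.ker (wordBoundary α r))
      fun x => wordBoundary_wordBoundary r x)
    Subtype.val_injective
    (fun ⟨z, hz⟩ => by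
      obtain ⟨y, hy⟩ := exists_wordBoundary_eq hr z hz
      exact ⟨y, Subtype.ext hy⟩)
    (fun v => ⟨fun hv => ⟨⟨v, by exact congrArg Subtype.val hv⟩, rfl⟩, by
      rintro ⟨k, rfl⟩
      exact Subtype.ext k.2⟩) (cycleRep α (r + 1) σ) (wordRep α (r + 2) σ) (cycleRep α r σ)
    (fun _ => rfl)
    fun v => Subtype.ext (wordBoundary_comm α (r + 1) σ v)

/-- Exactness identifies boundaries with cycles one degree lower, so the chain traces telescope. The
bound on `r` is what lets acyclicity be applied at every lower stage, down to the empty word. -/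
theorem trace_cycleRep (r : ℕ) (hr : r < Fintype.card α) (σ : Equiv.Perm α) :
    LinearMap.trace ℂ _ (cycleRep α r σ) =
      ∑ k ∈ range (r + 2), (-1 : ℂ) ^ (r + 1 - k) * LinearMap.trace ℂ _ (wordRep α k σ) := by
  induction r with
  | zero =>
    rw [eq_sub_of_add_eq (trace_cycleRep_zero α hr σ).symm]
    simp [sum_range_succ]
    ring
  | succ r ih =>
    rw [eq_sub_of_add_eq (trace_cycleRep_succ α r hr σ).symm, ih (by omega), sum_range_succ _ (r + 2),
      Nat.sub_self, pow_zero, one_mul, sub_eq_add_neg, add_comm, ← sum_neg_distrib]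
    congr 1
    refine sum_congr rfl fun k hk => ?_
    rw [mem_range] at hk
    rw [show r + 1 + 1 - k = r + 1 - k + 1 by omega, pow_succ]
    ring

/-- There are no injective words longer than the alphabet, so in top degree nothing is divided out
and homology equals cycles. -/
theorem trace_injectiveWordsHomology (r : ℕ) (hr : Fintype.card α = r + 1) (σ : Equiv.Perm α) :
    LinearMap.trace ℂ _ (injectiveWordsHomology α r σ) =
      LinearMap.trace ℂ _ (cycleRep α r σ) := by
  have hempty : IsEmpty (Fin (r + 2) ↪ α) :=
    ⟨fun w => by have := Fintype.card_le_of_embedding w; simp [hr] at this⟩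
  have hbot : (LinearMap.range (wordBoundary α (r + 1))).submoduleOf
      (LinearMap.ker (wordBoundary α r)) = ⊥ := by
    rw [eq_bot_iff]
    rintro ⟨x, hx⟩ ⟨y, hy⟩
    have : y = 0 := Subsingleton.elim _ _
    rw [Submodule.mem_bot]
    ext1
    rw [this, map_zero] at hy
    exact hy.symm
  let eqv : LinearMap.ker (wordBoundary α r) ≃ₗ[ℂ]
      Homology (wordBoundary α (r + 1)) (wordBoundary α r) :=
    LinearEquiv.ofBijective (Submodule.mkQ _)
      ⟨fun x y hxy => by
        rw [Submodule.mkQ_apply, Submodule.mkQ_apply, Submodule.Quotient.eq, hbot,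
          Submodule.mem_bot] at hxy
        exact sub_eq_zero.1 hxy, Submodule.mkQ_surjective _⟩
  suffices h1 : injectiveWordsHomology α r σ = eqv.conj (cycleRep α r σ) by
    rw [h1]
    exact LinearMap.trace_conj' (M := LinearMap.ker (wordBoundary α r)) _ eqv
  refine LinearMap.ext fun x => ?_
  obtain ⟨y, rfl⟩ := eqv.surjective x
  rw [LinearEquiv.conj_apply_apply, LinearEquiv.symm_apply_apply]
  rfl

theorem frobeniusChar_injectiveWordsHomology (r : ℕ) (hr : Fintype.card α = r + 1) :
    frobeniusChar (injectiveWordsHomology α r) =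
      geomSum (p 1) (fun k => (-1 : ℂ) ^ k • h k) (r + 1) := by
  have hα : ((Fintype.card α).factorial : ℂ) ≠ 0 := by exact_mod_cast Nat.factorial_ne_zero _
  have h1 : ∀ σ : Equiv.Perm α, LinearMap.trace ℂ _ (injectiveWordsHomology α r σ) •
      (σ.partition.parts.map p).prod = ∑ k ∈ range (r + 2), (-1 : ℂ) ^ (r + 1 - k) •
        LinearMap.trace ℂ _ (wordRep α k σ) • cyclePowerSum σ := by
    intro σ
    rw [trace_injectiveWordsHomology α r hr, trace_cycleRep α r (by omega), sum_smul]
    simp only [smul_smul]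
    rfl
  -- The chains are indexed by word length and `geomSum` by the number of unused letters, hence the
  -- reflection.
  rw [frobeniusChar, sum_congr rfl fun σ _ => h1 σ, sum_comm, geomSum, ← sum_range_reflect,
    smul_sum]
  refine sum_congr rfl fun k hk => ?_
  rw [mem_range] at hk
  rw [← smul_sum, show r + 2 - 1 - k = r + 1 - k by omega,
    show r + 1 - (r + 1 - k) = k by omega, sum_trace_wordRep_smul α _ (by omega), smul_comm,
    inv_smul_smul₀ hα, hr, show r + 1 - (r + 1 - k) = k by omega, mul_smul_comm]

end Trace

/-! ### The pieces in degree four -/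

theorem ramanujanSum_two (r : ℕ) : ramanujanSum r 2 = if 2 ∣ r then 1 else -1 := by
  have h1 := sum_ramanujanSum r 2 two_pos
  rw [Nat.Prime.sum_divisors Nat.prime_two, ramanujanSum_self_one] at h1
  rw [eq_sub_of_add_eq h1]
  split_ifs <;> norm_num

theorem divisors_four : Nat.divisors 4 = {1, 2, 4} := by decide

theorem ramanujanSum_four (r : ℕ) :
    ramanujanSum r 4 = if 4 ∣ r then 2 else if 2 ∣ r then -2 else 0 := by
  have h1 := sum_ramanujanSum r 4 four_pos
  rw [divisors_four, sum_insert (by decide), sum_insert (by decide), sum_singleton,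
    ramanujanSum_self_one, ramanujanSum_two] at h1
  have h2 : 4 ∣ r → 2 ∣ r := fun h => dvd_trans (by decide) h
  rw [← add_assoc] at h1
  rw [eq_sub_of_add_eq' h1]
  split_ifs <;> first | (exfalso; tauto) | norm_num

theorem cyclicIndChar_two (r : ℕ) :
    cyclicIndChar 2 r = (2 : ℂ)⁻¹ • (p 1 ^ 2 + ramanujanSum r 2 • p 2) := by
  have h1 := smul_cyclicIndChar 2 r
  rw [Nat.Prime.sum_divisors Nat.prime_two, ramanujanSum_self_one] at h1
  rw [eq_inv_smul_iff₀ two_ne_zero]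
  simpa [add_comm] using h1

theorem cyclicIndChar_four (r : ℕ) : cyclicIndChar 4 r =
    (4 : ℂ)⁻¹ • (p 1 ^ 4 + ramanujanSum r 2 • p 2 ^ 2 + ramanujanSum r 4 • p 4) := by
  have h1 := smul_cyclicIndChar 4 r
  rw [divisors_four, sum_insert (by decide), sum_insert (by decide), sum_singleton,
    ramanujanSum_self_one] at h1
  rw [eq_inv_smul_iff₀ (by norm_num)]
  simpa [add_assoc] using h1

theorem newtonPoly_one (c : ℕ → ℂ) : newtonPoly c 1 = c 0 • MvPolynomial.X 0 := by
  simp [newtonPoly]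

theorem newtonPoly_two (c : ℕ → ℂ) : newtonPoly c 2 =
    (2 : ℂ)⁻¹ • (c 0 • MvPolynomial.X 0 * (c 0 • MvPolynomial.X 0) + c 1 • MvPolynomial.X 1) := by
  rw [newtonPoly, Fin.sum_univ_two]
  simp [newtonPoly]

theorem deg_four_mul_self (r : ℕ → ℕ) :
    deg 4 (cyclicSum r * cyclicSum r) = cyclicIndChar 2 (r 2) ^ 2 := by
  rw [deg_mul, Nat.sum_antidiagonal_eq_sum_range_succ_mk]
  simp [sum_range_succ, deg_cyclicSum, sq]

theorem expand_smul_p_one_sq_add (a b : ℂ) :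
    MvPowerSeries.expand 2 two_ne_zero (a • (p 1 ^ 2 + b • p 2)) = a • (p 2 ^ 2 + b • p 4) := by
  rw [map_smul, map_add, map_pow, map_smul, expand_p 2 _ 0, expand_p 2 _ 1]

theorem deg_four_expand_two (r : ℕ → ℕ) : deg 4 (MvPowerSeries.expand 2 two_ne_zero (cyclicSum r)) =
    (2 : ℂ)⁻¹ • (p 2 ^ 2 + ramanujanSum (r 2) 2 • p 4) := by
  rw [deg_expand, if_pos (by decide), deg_cyclicSum, if_pos (by decide)]
  rw [cyclicIndChar_two, expand_smul_p_one_sq_add]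

theorem deg_four_aeval_newtonPoly_one (c : ℕ → ℂ) (r : ℕ → ℕ) :
    deg 4 (MvPolynomial.aeval (fun k : ℕ => MvPowerSeries.expand (k + 1) k.succ_ne_zero
      (cyclicSum r)) (newtonPoly c 1)) = c 0 • cyclicIndChar 4 (r 4) := by
  rw [newtonPoly_one, map_smul, MvPolynomial.aeval_X, deg_smul, MvPowerSeries.expand_one_apply,
    deg_cyclicSum, if_pos (by decide)]

theorem deg_four_aeval_newtonPoly_two (c : ℕ → ℂ) (r : ℕ → ℕ) :
    deg 4 (MvPolynomial.aeval (fun k : ℕ => MvPowerSeries.expand (k + 1) k.succ_ne_zero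
      (cyclicSum r)) (newtonPoly c 2)) = (2 : ℂ)⁻¹ • ((c 0 * c 0) • cyclicIndChar 2 (r 2) ^ 2 +
        c 1 • (2 : ℂ)⁻¹ • (p 2 ^ 2 + ramanujanSum (r 2) 2 • p 4)) := by
  rw [newtonPoly_two, map_smul, map_add, map_mul, map_smul, map_smul, MvPolynomial.aeval_X,
    MvPolynomial.aeval_X, MvPowerSeries.expand_one_apply, deg_smul, deg_add, smul_mul_smul_comm,
    deg_smul, deg_smul, deg_four_mul_self, deg_four_expand_two]

/-- The polynomial `a p_1^4 + b p_1^2 p_2 + c p_2^2 + d p_4` in the power sums. -/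
def quartic (a b c d : ℂ) : MvPolynomial ℕ ℂ :=
  a • MvPolynomial.X 0 ^ 4 + b • (MvPolynomial.X 0 ^ 2 * MvPolynomial.X 1) +
    c • MvPolynomial.X 1 ^ 2 + d • MvPolynomial.X 3

theorem aeval_quartic (a b c d : ℂ) : MvPolynomial.aeval (fun k : ℕ => p (k + 1))
    (quartic a b c d) = a • p 1 ^ 4 + b • (p 1 ^ 2 * p 2) + c • p 2 ^ 2 + d • p 4 := by
  simp [quartic]

theorem omega_aeval_quartic (a b c d : ℂ) : omega (MvPolynomial.aeval (fun k : ℕ => p (k + 1))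
    (quartic a b c d)) = MvPolynomial.aeval (fun k : ℕ => p (k + 1)) (quartic a (-b) c (-d)) := by
  rw [omega_aeval, aeval_quartic]
  simp [omegaHom, quartic]
  norm_num [Odd.neg_one_pow]

/-- Setting only the variable for `p_1`, or only the one for `p_4`, equal to 1 and the others to 0
isolates these two coefficients. -/
theorem aeval_quartic_inj {a b c d a' b' c' d' : ℂ}
    (h : MvPolynomial.aeval (fun k : ℕ => p (k + 1)) (quartic a b c d) =
      MvPolynomial.aeval (fun k : ℕ => p (k + 1)) (quartic a' b' c' d')) : a = a' ∧ d = d' := by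
  have h1 := algebraicIndependent_p h
  constructor
  · simpa [quartic] using congrArg (MvPolynomial.eval fun i => if i = 0 then (1 : ℂ) else 0) h1
  · simpa [quartic] using congrArg (MvPolynomial.eval fun i => if i = 3 then (1 : ℂ) else 0) h1

theorem twoPart_two : twoPart 2 = 2 := by
  simp [twoPart]

theorem twoPart_four : twoPart 4 = 4 := by
  rw [twoPart, show 4 = 2 ^ 2 by norm_num, padicValNat.prime_pow]

theorem deltaPiece_four_one : deltaPiece 4 1 =
    MvPolynomial.aeval (fun k : ℕ => p (k + 1)) (quartic 4⁻¹ 0 4⁻¹ 2⁻¹) := by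
  rw [deltaPiece, plethysm_e, sumGeTwo_lieTwo, deg_four_aeval_newtonPoly_one, twoPart_four,
    cyclicIndChar_four, ramanujanSum_two, ramanujanSum_four, aeval_quartic]
  norm_num [smul_smul]

theorem deltaPiece_four_two : deltaPiece 4 2 =
    MvPolynomial.aeval (fun k : ℕ => p (k + 1)) (quartic 8⁻¹ 4⁻¹ (-8⁻¹) (-4⁻¹)) := by
  rw [deltaPiece, plethysm_e, sumGeTwo_lieTwo, deg_four_aeval_newtonPoly_two, twoPart_two,
    cyclicIndChar_two, ramanujanSum_two, aeval_quartic]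
  simp
  algebra

theorem hodgePiece_four_one : hodgePiece 4 1 =
    MvPolynomial.aeval (fun k : ℕ => p (k + 1)) (quartic 4⁻¹ 0 (-4⁻¹) 0) := by
  rw [hodgePiece, plethysm_h, sumGeTwo_lie, deg_four_aeval_newtonPoly_one,
    cyclicIndChar_four, ramanujanSum_two, ramanujanSum_four, aeval_quartic]
  norm_num [smul_smul]

theorem hodgePiece_four_two : hodgePiece 4 2 =
    MvPolynomial.aeval (fun k : ℕ => p (k + 1)) (quartic 8⁻¹ (-4⁻¹) (3 / 8) (-4⁻¹)) := by
  rw [hodgePiece, plethysm_h, sumGeTwo_lie, deg_four_aeval_newtonPoly_two,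
    cyclicIndChar_two, ramanujanSum_two, aeval_quartic]
  simp
  algebra

/-- The pairs of coefficients of `p_1^4` and `p_4` are `(1/4, 1/2)` and `(1/8, -1/4)` for the `Δ`
pieces, against `(1/4, 0)` and `(1/8, 1/4)` for the Hodge pieces after `ω`. -/
theorem deltaPiece_four_ne (k j : ℕ) (hk : k = 1 ∨ k = 2) (hj : j = 1 ∨ j = 2) :
    deltaPiece 4 k ≠ omega (hodgePiece 4 j) := by
  rcases hk with rfl | rfl <;> rcases hj with rfl | rfl <;>
    simp only [deltaPiece_four_one, deltaPiece_four_two, hodgePiece_four_one, hodgePiece_four_two,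
      omega_aeval_quartic] <;>
    intro h <;> obtain ⟨h1, h2⟩ := aeval_quartic_inj h <;> norm_num at h1 <;> norm_num at h2

end SymFn

end

open SymFn in
theorem mainTheorem5 :
    (∀ n : ℕ, 2 ≤ n →
      delta n = ∑ k ∈ Finset.range (n + 1), (-1) ^ k * p 1 ^ (n - k) * h k ∧
      delta n = p 1 * delta (n - 1) + (-1) ^ n * h n ∧
      frobeniusChar (injectiveWordsHomology (Fin n) (n - 1)) = delta n) ∧
    (∀ n : ℕ, 1 ≤ n →
      ∑ᶠ (r : ℕ) (_ : 1 ≤ r), omega (hodgePiece n r) =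
        ∑ k ∈ Finset.range (n + 1), (-1) ^ k * p 1 ^ (n - k) * h k ∧
      ∑ᶠ (r : ℕ) (_ : 1 ≤ r), deltaPiece n r =
        ∑ k ∈ Finset.range (n + 1), (-1) ^ k * p 1 ^ (n - k) * h k) ∧
    (∀ n : ℕ, 2 ≤ n →
      ∑ᶠ (r : ℕ) (_ : 1 ≤ r),
          (-1) ^ (r - 1) * omega (deg n (plethysm (e r) (sumGeTwo lie))) =
        schur (hookTwo n) ∧
      ∑ᶠ (r : ℕ) (_ : 1 ≤ r), (-1) ^ (r - 1) * deg n (plethysm (h r) (sumGeTwo lieTwo)) =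
        schur (hookTwo n)) ∧
    (∀ k ∈ ({1, 2} : Set ℕ), ∀ j ∈ ({1, 2} : Set ℕ), deltaPiece 4 k ≠ omega (hodgePiece 4 j)) := by
  refine ⟨fun n hn => ?_, fun n hn => ?_, fun n hn => ?_, fun k hk j hj => ?_⟩
  · obtain ⟨n, rfl⟩ := Nat.exists_eq_add_of_le' hn
    refine ⟨?_, ?_, ?_⟩
    · rw [delta_eq_geomSum, geomSum_signed_h]
    · rw [delta_eq_geomSum, show n + 2 - 1 = n + 1 from rfl, delta_eq_geomSum, geomSum_succ,
        neg_one_pow_smul]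
    · rw [delta_eq_geomSum]
      exact frobeniusChar_injectiveWordsHomology (Fin (n + 2)) (n + 1) (Fintype.card_fin _)
  · exact ⟨finsum_omega_hodgePiece n (by omega), finsum_deltaPiece n (by omega)⟩
  · obtain ⟨n, rfl⟩ := Nat.exists_eq_add_of_le' hn
    rw [schur_hookTwo]
    exact ⟨finsum_signed_omega_deg_plethysm_e_lie (n + 1),
      finsum_signed_deg_plethysm_h_lieTwo (n + 1)⟩
  · exact deltaPiece_four_ne k j hk hj
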